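/- **Setting.** Let $m,n\in\mathbb N$, $\gamma\in(0,1]$, $N=\lfloor 1/\gamma\rfloor$, $p\in(1,\infty)$ and $\alpha=1/(p-1)$. For $x\in\mathbb R^m$ write $x^p:=|x|^{p-1}x$. *Forests.* Let $\tau$ range over (combinatorial, i.e. unordered) rooted forests with vertices labelled by $\{1,\dots,n\}$, $|\tau|$ being the number of vertices and $\mathbf 1$ the empty forest. $[\sigma]_i$ is the tree obtained by attaching a root labelled $i$ to $\sigma$; every forest is $\tau=[\sigma_1]_{i_1}\cdots[\sigma_\ell]_{i_\ell}$. The symmetry factor is defined by $s(\mathbf 1)=1$ and $s\big(\prod_j[\sigma_j]_{i_j}^{k_j}\big)=\prod_j k_j!\,s(\sigma_j)^{k_j}$ for pairwise distinct trees $[\sigma_j]_{i_j}$. *Rough path.* $\mathbf X$ is an $n$-dimensional $\gamma$-Hölder branched rough path on $[-1,0]$: continuous maps $\mathbf X^\tau\colon[-1,0]^2\to\mathbb R$, $|\tau|\le N$, with $\mathbf X^{\mathbf 1}\equiv1$, $\mathbf X^{\tau\kappa}=\mathbf X^\tau\mathbf X^\kappa$ for $|\tau|+|\kappa|\le N$,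 Chen's relation $\mathbf X^\tau_{s,t}=\sum_{(\tau)}\mathbf X^{\tau^{(1)}}_{s,u}\mathbf X^{\tau^{(2)}}_{u,t}$ for the Connes–Kreimer coproduct $\Delta_{\mathrm{CK}}\tau=\sum_{(\tau)}\tau^{(1)}\otimes\tau^{(2)}$ (multiplicative, with $\Delta_{\mathrm{CK}}[\tau]_i=[\tau]_i\otimes\mathbf 1+(\mathrm{id}\otimes[\cdot]_i)\Delta_{\mathrm{CK}}\tau$), and $\sup_{s\ne t}|\mathbf X^\tau_{s,t}|/|t-s|^{\gamma|\tau|}<\infty$. Let $\mathbf X^{[\tau]}=(\mathbf X^{[\tau]_i})_{i=1}^n$, which is $\mathbb R^n$-valued, and, for an interval $I\subset[-1,0]$, $\|\mathbf X^{[\tau]}\|_I=\sup_{s\ne t\in I}|\mathbf X^{[\tau]}_{s,t}|/|t-s|^{\gamma(|\tau|+1)}$. *Equation.* Let $f\in\mathcal C^N(\mathbb R^m,L(\mathbb R^n,\mathbb R^m))$. The elementary differentials $f^\tau\colon\mathbb R^m\to L(\mathbb R^n,\mathbb R^m)$, $|\tau|\le N-1$, are $f^{\mathbf 1}=f$ and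 $f^\tau=(D^\ell f)(f^{\sigma_1}_{i_1},\dots,f^{\sigma_\ell}_{i_\ell})$ for $\tau=[\sigma_1]_{i_1}\cdots[\sigma_\ell]_{i_\ell}$, where $f^\sigma_i$ is the $i$-th component of $f^\sigma$. A $\gamma$-Hölder path $\phi\colon[-1,0]\to\mathbb R^m$ solves $d\phi_t=-\phi_t^p\,dt+f(\phi_t)\,d\mathbf X_t$ if, uniformly over $-1\le s\le t\le0$, $$\phi_t-\phi_s=-\phi_s^p(t-s)+\sum_{0\le|\tau|\le N-1}\frac1{s(\tau)}f^\tau(\phi_s)\mathbf X^{[\tau]}_{s,t}+o(|t-s|).$$ *Weights and exponents.* For $\eta\in\mathbb R$ let $|x|_\eta=|x|^\eta+1$ if $\eta\ge0$ and $|x|_\eta=|x|^\eta$ if $\eta<0$, and $\|g\|_{\infty;\eta}=\sup_x|g(x)|/|x|_\eta$. Let $\eta(\tau,\ell)\in\mathbb R$ be given for $0\le|\tau|\le N-1$, $0\le\ell\le N-|\tau|$, and put $$\Delta(\tau,\ell)=\gamma(|\tau|+1)+\alpha(1-\ell-\eta(\tau,\ell)),\qquad \zeta_{\tau,\ell,\sigma}=\frac{(|\tau|+1)\gamma+\ell-1}{1-(|\sigma|+1)\gamma}.$$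 Call $(\tau,\ell,\sigma)$ admissible if $0\le|\tau|\le N-1$, $1\le\ell\le N-|\tau|$ and $0\le|\sigma|\le N-1$, where $|\sigma|=N-1$ is excluded if $\gamma=1/N$. Assume $\Delta(\tau,0)>0$ for all $0\le|\tau|\le N-1$ and $\Delta(\tau,\ell)+\zeta_{\tau,\ell,\sigma}\Delta(\sigma,0)>0$ for all admissible $(\tau,\ell,\sigma)$, and put $$\rho_\tau=\frac{\alpha}{\Delta(\tau,0)},\qquad\rho_{\tau,\ell,\sigma}=\frac{\alpha}{\Delta(\tau,\ell)+\zeta_{\tau,\ell,\sigma}\Delta(\sigma,0)}.$$ *Local norms.* For $z\in(-1,0]$ and $0<\lambda\le|z+1|$ let $H_\tau=\|f^\tau\|_{\infty;\eta(\tau,0)}\|\mathbf X^{[\tau]}\|_{[z-\lambda,z]}$ and $$[\![(f,\mathbf X)]\!]^{(1)}_{z,\lambda}=\max_{0\le|\tau|\le N-1}H_\tau^{\rho_\tau},\qquad [\![(f,\mathbf X)]\!]^{(2)}_{z,\lambda}=\max_{(\tau,\ell,\sigma)\text{ admissible}}\Big(\|D^\ell f^\tau\|_{\infty;\eta(\tau,\ell)}\|\mathbf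 X^{[\tau]}\|_{[z-\lambda,z]}H_\sigma^{\zeta_{\tau,\ell,\sigma}}\Big)^{\rho_{\tau,\ell,\sigma}}$$ (the latter is $0$ if there is no admissible triple, i.e. if $\gamma=N=1$). **Theorem.** There exists $C>0$, depending only on $m,n,\gamma,p$ and the collection of exponents $\eta(\tau,\ell)$, such that the following holds. Let $f\in\mathcal C^N(\mathbb R^m,L(\mathbb R^n,\mathbb R^m))$ satisfy $\|D^\ell f^\tau\|_{\infty;\eta(\tau,\ell)}<\infty$ for all $0\le|\tau|\le N-1$ and $0\le\ell\le N-|\tau|$, let $\mathbf X$ be an $n$-dimensional $\gamma$-Hölder branched rough path on $[-1,0]$, and let $\phi\colon[-1,0]\to\mathbb R^m$ solve $d\phi_t=-\phi_t^p\,dt+f(\phi_t)\,d\mathbf X_t$. Then, for all $z\in(-1,0]$, $$|\phi_z|\le C\Big([\![(f,\mathbf X)]\!]^{(1)}_{z,\lambda_z}+[\![(f,\mathbf X)]\!]^{(2)}_{z,\lambda_z}+|z+1|^{-\alpha}\Big),$$ where $\lambda_z=(C|\phi_z|^{-1/\alpha})\wedge(\tfrac12|z+1|)$ (with $\lambda_z=\tfrac12|z+1|$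 if $\phi_z=0$). -/

import Mathlib

noncomputable section

namespace RDE

/-! ### Labelled rooted forests -/

/-- Plane (ordered) rooted forests with vertices labelled by `Fin n`.
`nil` is the empty forest, `cons i σ ρ` is the forest `[σ]_i · ρ`, whose first tree has a root
labelled `i` carrying the forest `σ`, and whose remaining trees form `ρ`. -/
inductive PlaneForest (n : ℕ) : Type
  | nil : PlaneForest n
  | cons (i : Fin n) (σ ρ : PlaneForest n) : PlaneForest n

namespace PlaneForest

variable {n : ℕ}

/-- Number of vertices. -/
def size : PlaneForest n → ℕ
  | nil => 0
  | cons _ σ ρ => size σ + 1 + size ρ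

/-- Juxtaposition of forests. -/
def append : PlaneForest n → PlaneForest n → PlaneForest n
  | nil, τ => τ
  | cons i σ ρ, τ => cons i σ (append ρ τ)

/-- Two plane forests are equivalent if they differ only by the order of the trees, at the top
level and below every vertex. -/
inductive Rel : PlaneForest n → PlaneForest n → Prop
  | refl (τ : PlaneForest n) : Rel τ τ
  | symm {τ τ' : PlaneForest n} : Rel τ τ' → Rel τ' τ
  | trans {τ τ' τ'' : PlaneForest n} : Rel τ τ' → Rel τ' τ'' → Rel τ τ''
  | swap (i j : Fin n) (σ σ' ρ : PlaneForest n) :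
      Rel (cons i σ (cons j σ' ρ)) (cons j σ' (cons i σ ρ))
  | congr (i : Fin n) {σ σ' ρ ρ' : PlaneForest n} :
      Rel σ σ' → Rel ρ ρ' → Rel (cons i σ ρ) (cons i σ' ρ')

instance setoid (n : ℕ) : Setoid (PlaneForest n) where
  r := Rel
  iseqv := ⟨Rel.refl, Rel.symm, Rel.trans⟩

open Classical in
/-- Number of trees of the forest that are equivalent to `[σ]_i`. -/
def count (i : Fin n) (σ : PlaneForest n) : PlaneForest n → ℕ
  | nil => 0
  | cons j σ' ρ => (if i = j ∧ Rel σ σ' then 1 else 0) + count i σ ρ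

/-- The symmetry factor (order of the automorphism group): for `τ = ∏ ([σ_j]_{i_j})^{k_j}` with
pairwise distinct trees `[σ_j]_{i_j}` it equals `∏ k_j! s(σ_j)^{k_j}`. -/
def symFactor : PlaneForest n → ℕ
  | nil => 1
  | cons i σ ρ => (count i σ ρ + 1) * symFactor σ * symFactor ρ

/-- The Connes–Kreimer coproduct, as the list of the terms `τ⁽¹⁾ ⊗ τ⁽²⁾` (pruned part, trunk). It is
multiplicative and satisfies `Δ [σ]_i = [σ]_i ⊗ 1 + (id ⊗ [·]_i) Δ σ`. -/
def coproduct : PlaneForest n → List (PlaneForest n × PlaneForest n)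
  | nil => [(nil, nil)]
  | cons i σ ρ =>
      (coproduct ρ).map (fun b => (cons i σ b.1, b.2)) ++
      (coproduct σ).flatMap (fun a =>
        (coproduct ρ).map (fun b => (append a.1 b.1, cons i a.2 b.2)))

theorem size_eq_of_rel {τ τ' : PlaneForest n} (h : Rel τ τ') : size τ = size τ' := by
  induction h with
  | refl => rfl
  | symm _ ih => exact ih.symm
  | trans _ _ ih₁ ih₂ => exact ih₁.trans ih₂
  | swap => simp only [size]; omega
  | congr _ _ _ ih₁ ih₂ => simp only [size, ih₁, ih₂]

open Classical in
theorem count_eq_of_rel (i : Fin n) {σ σ' τ τ' : PlaneForest n} (hσ : Rel σ σ') (h : Rel τ τ') :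
    count i σ τ = count i σ' τ' := by
  have key : ∀ ρ : PlaneForest n, count i σ ρ = count i σ' ρ := by
    intro ρ
    induction ρ with
    | nil => rfl
    | cons j κ ρ _ ih =>
      have : Rel σ κ ↔ Rel σ' κ := ⟨fun h => hσ.symm.trans h, fun h => hσ.trans h⟩
      rw [count, count, ih, if_congr (and_congr_right fun _ => this) rfl rfl]
  rw [key]
  induction h with
  | refl => rfl
  | symm _ ih => exact ih.symm
  | trans _ _ ih₁ ih₂ => exact ih₁.trans ih₂
  | swap => simp only [count]; omega
  | @congr j κ κ' _ _ h₁ _ _ ih₂ =>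
      have : Rel σ' κ ↔ Rel σ' κ' := ⟨fun h => h.trans h₁, fun h => h.trans h₁.symm⟩
      rw [count, count, ih₂, if_congr (and_congr_right fun _ => this) rfl rfl]

theorem symFactor_eq_of_rel {τ τ' : PlaneForest n} (h : Rel τ τ') :
    symFactor τ = symFactor τ' := by
  induction h with
  | refl => rfl
  | symm _ ih => exact ih.symm
  | trans _ _ ih₁ ih₂ => exact ih₁.trans ih₂
  | swap i j σ σ' ρ =>
      simp only [symFactor, count]
      by_cases hc : i = j ∧ Rel σ σ'
      · obtain ⟨rfl, hr⟩ := hc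
        simp only [hr, hr.symm, and_self, if_true, count_eq_of_rel i hr (Rel.refl ρ)]
        ring
      · have hc' : ¬ (j = i ∧ Rel σ' σ) := fun h => hc ⟨h.1.symm, h.2.symm⟩
        simp only [hc, hc', if_false]
        ring
  | congr i h₁ h₂ ih₁ ih₂ => simp only [symFactor, ih₁, ih₂, count_eq_of_rel i h₁ h₂]

theorem append_rel {τ τ' κ κ' : PlaneForest n} (h : Rel τ τ') (h' : Rel κ κ') :
    Rel (append τ κ) (append τ' κ') := by
  have key : ∀ ρ : PlaneForest n, Rel (append ρ κ) (append ρ κ') := by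
    intro ρ
    induction ρ with
    | nil => exact h'
    | cons j σ ρ _ ih => exact Rel.congr j (Rel.refl σ) ih
  refine Rel.trans (key τ) ?_
  induction h with
  | refl => exact Rel.refl _
  | symm _ ih => exact ih.symm
  | trans _ _ ih₁ ih₂ => exact ih₁.trans ih₂
  | swap => exact Rel.swap _ _ _ _ _
  | congr i h₁ _ _ ih₂ => exact Rel.congr i h₁ ih₂

theorem finite_size_le (n k : ℕ) : {τ : PlaneForest n | size τ ≤ k}.Finite := by
  induction k with
  | zero =>
      refine (Set.finite_singleton (nil : PlaneForest n)).subset ?_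
      rintro (_ | ⟨i, σ, ρ⟩) h
      · rfl
      · simp [size] at h
  | succ k ih =>
      refine ((Set.finite_singleton (nil : PlaneForest n)).union
        (((Set.finite_univ (α := Fin n)).prod (ih.prod ih)).image
          (fun q => cons q.1 q.2.1 q.2.2))).subset ?_
      rintro (_ | ⟨i, σ, ρ⟩) h
      · exact Or.inl rfl
      · have h : size σ + 1 + size ρ ≤ k + 1 := h
        refine Or.inr ⟨(i, σ, ρ), ⟨Set.mem_univ _, ?_, ?_⟩, rfl⟩
        · change size σ ≤ k
          omega
        · change size ρ ≤ k
          omega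

end PlaneForest

/-- (Combinatorial) labelled rooted forests: the order of the trees is irrelevant. -/
def Forest (n : ℕ) : Type := Quotient (PlaneForest.setoid n)

namespace Forest

variable {n : ℕ}

/-- The forest underlying a plane forest. -/
def mk (τ : PlaneForest n) : Forest n := Quotient.mk _ τ

/-- The empty forest. -/
def empty : Forest n := mk PlaneForest.nil

/-- Number of vertices `|τ|`. -/
def size (τ : Forest n) : ℕ :=
  Quotient.lift PlaneForest.size (fun _ _ h => PlaneForest.size_eq_of_rel h) τ

/-- The symmetry factor `s(τ)`. -/
def symFactor (τ : Forest n) : ℕ :=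
  Quotient.lift PlaneForest.symFactor (fun _ _ h => PlaneForest.symFactor_eq_of_rel h) τ

/-- The commutative product of forests. -/
def mul (τ κ : Forest n) : Forest n :=
  Quotient.map₂ PlaneForest.append (fun _ _ h _ _ h' => PlaneForest.append_rel h h') τ κ

/-- The tree `[τ]_i`, obtained by attaching a root labelled `i` to `τ`. -/
def graft (i : Fin n) (τ : Forest n) : Forest n :=
  Quotient.map (fun σ => PlaneForest.cons i σ PlaneForest.nil)
    (fun _ _ h => PlaneForest.Rel.congr i h (PlaneForest.Rel.refl _)) τ

theorem finite_size_lt (n k : ℕ) : {τ : Forest n | size τ < k}.Finite := by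
  refine ((PlaneForest.finite_size_le n k).image mk).subset ?_
  rintro ⟨τ⟩ h
  exact ⟨τ, le_of_lt (show PlaneForest.size τ < k from h), rfl⟩

/-- The finite set of forests with fewer than `k` vertices. -/
def below (n k : ℕ) : Finset (Forest n) := (finite_size_lt n k).toFinset

end Forest

/-! ### Elementary differentials -/

/-- `ℝᵐ` with its Euclidean norm. -/
abbrev Vec (m : ℕ) : Type := EuclideanSpace ℝ (Fin m)

/-- `L(ℝⁿ, ℝᵐ)` with its operator norm. -/
abbrev Lin (n m : ℕ) : Type := Vec n →L[ℝ] Vec m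

section ElementaryDifferential

variable {m n : ℕ}

/-- The value `(D^ℓ f)(x)(v₁, …, v_ℓ)` for a list `v₁, …, v_ℓ` of vectors. -/
def applyDeriv (f : Vec m → Lin n m) (x : Vec m) (v : List (Vec m)) : Lin n m :=
  iteratedFDeriv ℝ v.length f x v.get

/-- For a plane forest `[σ₁]_{i₁} ⋯ [σ_ℓ]_{i_ℓ}`, the list of the vector fields
`f^{σ₁}_{i₁}, …, f^{σ_ℓ}_{i_ℓ}` evaluated at `x`, where `f^{σ}_i` is the `i`-th component of
`f^σ = (D^ℓ f)(f^{σ₁}_{i₁}, …, f^{σ_ℓ}_{i_ℓ})`. -/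
def PlaneForest.fields (f : Vec m → Lin n m) (x : Vec m) : PlaneForest n → List (Vec m)
  | .nil => []
  | .cons i σ ρ =>
      applyDeriv f x (PlaneForest.fields f x σ) (EuclideanSpace.single i (1 : ℝ)) ::
        PlaneForest.fields f x ρ

/-- The elementary differential of a plane forest. -/
def PlaneForest.elemDiff (f : Vec m → Lin n m) (τ : PlaneForest n) (x : Vec m) : Lin n m :=
  applyDeriv f x (PlaneForest.fields f x τ)

/-- The Butcher elementary differential `f^τ : ℝᵐ → L(ℝⁿ, ℝᵐ)`, defined by `f^𝟏 = f` and
`f^τ = (D^ℓ f)(f^{σ₁}_{i₁}, …, f^{σ_ℓ}_{i_ℓ})` for `τ = [σ₁]_{i₁} ⋯ [σ_ℓ]_{i_ℓ}`. For `f` of class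
`C^N` and `|τ| ≤ N`, it does not depend on the ordering of the trees that is used to compute it
(`elemDiff_mk` below). -/
def elemDiff (f : Vec m → Lin n m) (τ : Forest n) : Vec m → Lin n m :=
  PlaneForest.elemDiff f (Quotient.out τ)

theorem applyDeriv_cons {f : Vec m → Lin n m} {v : List (Vec m)}
    (hf : ContDiff ℝ (v.length + 1 : ℕ) f) (a x : Vec m) :
    applyDeriv f x (a :: v) = fderiv ℝ (fun y => applyDeriv f y v) x a := by
  have hd : DifferentiableAt ℝ (iteratedFDeriv ℝ v.length f) x :=
    (hf.differentiable_iteratedFDeriv (by exact_mod_cast Nat.lt_succ_self _)) x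
  have h := (ContinuousMultilinearMap.apply ℝ (fun _ : Fin v.length => Vec m) (Lin n m)
    v.get).hasFDerivAt.comp x hd.hasFDerivAt
  have h' : HasFDerivAt (fun y => applyDeriv f y v) _ x := h
  rw [h'.fderiv]
  rfl

theorem contDiff_applyDeriv {f : Vec m → Lin n m} {k : ℕ} {v : List (Vec m)}
    (hf : ContDiff ℝ (v.length + k : ℕ) f) : ContDiff ℝ k (fun y => applyDeriv f y v) := by
  have hd : ContDiff ℝ k (iteratedFDeriv ℝ v.length f) :=
    hf.iteratedFDeriv_right (by norm_cast; omega)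
  exact (ContinuousMultilinearMap.apply ℝ (fun _ : Fin v.length => Vec m) (Lin n m)
    v.get).contDiff.comp hd

theorem applyDeriv_perm {f : Vec m → Lin n m} {v w : List (Vec m)} (h : v.Perm w)
    (hf : ContDiff ℝ v.length f) (x : Vec m) : applyDeriv f x v = applyDeriv f x w := by
  induction h generalizing x with
  | nil => rfl
  | cons a h ih =>
      have hf' := hf
      rw [applyDeriv_cons hf, applyDeriv_cons (by simpa [h.length_eq] using hf')]
      have : ∀ y, _ := ih (hf.of_le (by simp))
      simp only [this]
  | swap a b l =>
      have h1 : ContDiff ℝ (l.length + 1 : ℕ) f := hf.of_le (by simp)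
      rw [applyDeriv_cons (by simpa using hf), applyDeriv_cons (by simpa using hf)]
      simp only [applyDeriv_cons h1]
      have h2 : ContDiff ℝ 2 (fun y => applyDeriv f y l) :=
        contDiff_applyDeriv (k := 2) hf
      have hs : IsSymmSndFDerivAt ℝ (fun y => applyDeriv f y l) x :=
        h2.contDiffAt.isSymmSndFDerivAt (by simp)
      have hd : DifferentiableAt ℝ (fderiv ℝ (fun y => applyDeriv f y l)) x :=
        (h2.fderiv_right (m := 1) (by norm_num)).differentiable (by norm_num) x
      have e : ∀ c d : Vec m,
          fderiv ℝ (fun y => fderiv ℝ (fun y => applyDeriv f y l) y c) x d =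
            fderiv ℝ (fderiv ℝ (fun y => applyDeriv f y l)) x d c := by
        intro c d
        rw [fderiv_clm_apply hd (differentiableAt_const c)]
        simp
      rw [e, e]
      exact hs _ _
  | trans h₁ _ ih₁ ih₂ =>
      exact (ih₁ hf x).trans (ih₂ (by rwa [← h₁.length_eq]) x)

theorem PlaneForest.length_fields_le (f : Vec m → Lin n m) (x : Vec m) (τ : PlaneForest n) :
    (τ.fields f x).length ≤ τ.size := by
  induction τ with
  | nil => simp [fields]
  | cons i σ ρ _ ih => simp only [fields, size, List.length_cons]; omega

theorem PlaneForest.fields_perm {f : Vec m → Lin n m} {N : ℕ} (hf : ContDiff ℝ N f) (x : Vec m)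
    {τ τ' : PlaneForest n} (h : Rel τ τ') (hτ : τ.size ≤ N) :
    (τ.fields f x).Perm (τ'.fields f x) := by
  induction h with
  | refl => exact List.Perm.refl _
  | symm h ih => exact (ih (by rwa [size_eq_of_rel h])).symm
  | trans h₁ _ ih₁ ih₂ => exact (ih₁ hτ).trans (ih₂ (by rwa [← size_eq_of_rel h₁]))
  | swap => exact List.Perm.swap _ _ _
  | congr i h₁ _ ih₁ ih₂ =>
      rename_i σ σ' ρ ρ' _
      simp only [size] at hτ
      have hl := length_fields_le f x σ
      simp only [fields]
      rw [applyDeriv_perm (ih₁ (by omega)) (hf.of_le (by norm_cast; omega)) x]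
      exact (ih₂ (by omega)).cons _

theorem elemDiff_mk {f : Vec m → Lin n m} {N : ℕ} (hf : ContDiff ℝ N f) (τ : PlaneForest n)
    (hτ : τ.size ≤ N) : elemDiff f (Forest.mk τ) = τ.elemDiff f := by
  funext x
  have h : PlaneForest.Rel (Quotient.out (Forest.mk τ)) τ := Quotient.mk_out τ
  have hs : (Quotient.out (Forest.mk τ)).size ≤ N := by rwa [PlaneForest.size_eq_of_rel h]
  have hl := PlaneForest.length_fields_le f x (Quotient.out (Forest.mk τ))
  exact applyDeriv_perm (PlaneForest.fields_perm hf x h hs)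
    (hf.of_le (by exact_mod_cast hl.trans hs)) x

end ElementaryDifferential

/-! ### Branched rough paths and solutions -/

/-- The truncation level `N = ⌊1/γ⌋`. -/
def level (γ : ℝ) : ℕ := ⌊1 / γ⌋₊

/-- An `n`-dimensional `γ`-Hölder branched rough path on `[-1, 0]`: real-valued maps
`X^τ_{s,t}`, indexed by the forests with `|τ| ≤ N`, which are continuous, form a character
(`X^𝟏 = 1`, `X^{τκ} = X^τ X^κ`), satisfy Chen's relation
`X^τ_{s,t} = ∑ X^{τ⁽¹⁾}_{s,u} X^{τ⁽²⁾}_{u,t}`, and have `sup |X^τ_{s,t}| / |t - s|^{γ|τ|} < ∞`.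
(The values for `|τ| > N`, or for times outside `[-1, 0]`, are irrelevant.) -/
structure BranchedRoughPath (n : ℕ) (γ : ℝ) where
  X : Forest n → ℝ → ℝ → ℝ
  continuous : ∀ τ : Forest n, τ.size ≤ level γ →
    ContinuousOn (fun q : ℝ × ℝ => X τ q.1 q.2) (Set.Icc (-1) 0 ×ˢ Set.Icc (-1) 0)
  map_empty : ∀ s ∈ Set.Icc (-1 : ℝ) 0, ∀ t ∈ Set.Icc (-1 : ℝ) 0, X Forest.empty s t = 1
  map_mul : ∀ τ κ : Forest n, τ.size + κ.size ≤ level γ →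
    ∀ s ∈ Set.Icc (-1 : ℝ) 0, ∀ t ∈ Set.Icc (-1 : ℝ) 0, X (τ.mul κ) s t = X τ s t * X κ s t
  chen : ∀ τ : PlaneForest n, τ.size ≤ level γ →
    ∀ s ∈ Set.Icc (-1 : ℝ) 0, ∀ u ∈ Set.Icc (-1 : ℝ) 0, ∀ t ∈ Set.Icc (-1 : ℝ) 0,
      X (Forest.mk τ) s t =
        (τ.coproduct.map (fun a => X (Forest.mk a.1) s u * X (Forest.mk a.2) u t)).sum
  holder : ∀ τ : Forest n, τ.size ≤ level γ → ∃ K : ℝ,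
    ∀ s ∈ Set.Icc (-1 : ℝ) 0, ∀ t ∈ Set.Icc (-1 : ℝ) 0,
      |X τ s t| ≤ K * |t - s| ^ (γ * (τ.size : ℝ))

/-- `X^{[τ]}_{s,t} ∈ ℝⁿ`, with `i`-th component `X^{[τ]_i}_{s,t}`. -/
def BranchedRoughPath.vec {n : ℕ} {γ : ℝ} (X : BranchedRoughPath n γ) (τ : Forest n) (s t : ℝ) :
    Vec n :=
  WithLp.toLp 2 (fun i => X.X (τ.graft i) s t)

/-- The Hölder seminorm `‖X^{[τ]}‖_{[a,b]} = sup_{s ≠ t} |X^{[τ]}_{s,t}| / |t - s|^{γ(|τ|+1)}`, over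
`s, t ∈ [a, b]`. -/
def BranchedRoughPath.seminorm {n : ℕ} {γ : ℝ} (X : BranchedRoughPath n γ) (τ : Forest n)
    (a b : ℝ) : ℝ :=
  ⨆ q : {q : ℝ × ℝ // q.1 ∈ Set.Icc a b ∧ q.2 ∈ Set.Icc a b ∧ q.1 ≠ q.2},
    ‖X.vec τ q.1.1 q.1.2‖ / |q.1.2 - q.1.1| ^ (γ * ((τ.size : ℝ) + 1))

/-- `φ : [-1, 0] → ℝᵐ` is `γ`-Hölder and solves `dφ = -φ^p dt + f(φ) dX`, where
`φ^p = |φ|^{p-1} φ`, in the sense of Davie: uniformly over `s ≤ t` in `[-1, 0]`,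
`φ_t - φ_s = -φ_s^p (t - s) + ∑_{|τ| ≤ N-1} s(τ)⁻¹ f^τ(φ_s) X^{[τ]}_{s,t} + o(t - s)`. -/
def IsSolution {m n : ℕ} {γ : ℝ} (p : ℝ) (f : Vec m → Lin n m) (X : BranchedRoughPath n γ)
    (φ : ℝ → Vec m) : Prop :=
  (∃ K : ℝ, ∀ s ∈ Set.Icc (-1 : ℝ) 0, ∀ t ∈ Set.Icc (-1 : ℝ) 0,
    ‖φ t - φ s‖ ≤ K * |t - s| ^ γ) ∧
  ∀ ε > 0, ∃ δ > 0, ∀ s ∈ Set.Icc (-1 : ℝ) 0, ∀ t ∈ Set.Icc (-1 : ℝ) 0, s ≤ t → t - s < δ →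
    ‖φ t - φ s - (-((t - s) • (‖φ s‖ ^ (p - 1) • φ s)) +
      ∑ τ ∈ Forest.below n (level γ),
        ((τ.symFactor : ℝ)⁻¹) • elemDiff f τ (φ s) (X.vec τ s t))‖ ≤ ε * (t - s)

/-! ### Weighted norms, exponents and local norms -/

/-- The weight `|x|_η`, equal to `|x|^η + 1` if `η ≥ 0` and to `|x|^η` if `η < 0`. -/
def weight {m : ℕ} (η : ℝ) (x : Vec m) : ℝ :=
  if 0 ≤ η then ‖x‖ ^ η + 1 else ‖x‖ ^ η

/-- `|D^ℓ g(x)| / |x|_η`. For `η < 0` this is `0` at `x = 0`, where `|x|^η` means `+∞`. -/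
def weightedQuotient {m n : ℕ} (g : Vec m → Lin n m) (ℓ : ℕ) (η : ℝ) (x : Vec m) : ℝ :=
  ‖iteratedFDeriv ℝ ℓ g x‖ / weight η x

/-- `‖D^ℓ g‖_{∞;η} = sup_x |D^ℓ g(x)| / |x|_η` (used only when this is finite). -/
def weightedNorm {m n : ℕ} (g : Vec m → Lin n m) (ℓ : ℕ) (η : ℝ) : ℝ :=
  ⨆ x : Vec m, weightedQuotient g ℓ η x

/-- `‖D^ℓ f^τ‖_{∞;η(τ,ℓ)} < ∞` for all `0 ≤ |τ| < N` and `0 ≤ ℓ ≤ N - |τ|`. -/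
def WeightedBounds {m n : ℕ} (γ : ℝ) (η : Forest n → ℕ → ℝ) (f : Vec m → Lin n m) : Prop :=
  ∀ (τ : Forest n) (ℓ : ℕ), τ.size < level γ → τ.size + ℓ ≤ level γ →
    BddAbove (Set.range (weightedQuotient (elemDiff f τ) ℓ (η τ ℓ)))

/-- `α = 1 / (p - 1)`. -/
def alpha (p : ℝ) : ℝ := 1 / (p - 1)

/-- `Δ(τ,ℓ) = γ(|τ|+1) + α(1 - ℓ - η(τ,ℓ))`. -/
def Delta {n : ℕ} (γ p : ℝ) (η : Forest n → ℕ → ℝ) (τ : Forest n) (ℓ : ℕ) : ℝ :=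
  γ * ((τ.size : ℝ) + 1) + alpha p * (1 - (ℓ : ℝ) - η τ ℓ)

/-- `ζ_{τ,ℓ,σ} = ((|τ|+1)γ + ℓ - 1) / (1 - (|σ|+1)γ)`. -/
def zeta {n : ℕ} (γ : ℝ) (τ : Forest n) (ℓ : ℕ) (σ : Forest n) : ℝ :=
  (((τ.size : ℝ) + 1) * γ + (ℓ : ℝ) - 1) / (1 - ((σ.size : ℝ) + 1) * γ)

/-- The triples `(τ, ℓ, σ)` with `0 ≤ |τ| ≤ N-1`, `1 ≤ ℓ ≤ N - |τ|` and `0 ≤ |σ| ≤ N-1`, where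
`|σ| = N-1` is excluded if `γ = 1/N`. -/
def IsTriple {n : ℕ} (γ : ℝ) (q : Forest n × ℕ × Forest n) : Prop :=
  q.1.size < level γ ∧ 1 ≤ q.2.1 ∧ q.1.size + q.2.1 ≤ level γ ∧ q.2.2.size < level γ ∧
    ¬ (γ = 1 / (level γ : ℝ) ∧ q.2.2.size + 1 = level γ)

/-- `Δ(τ,0) > 0` and `Δ(τ,ℓ) + ζ_{τ,ℓ,σ} Δ(σ,0) > 0` for all admissible indices. -/
def PositiveExponents {n : ℕ} (γ p : ℝ) (η : Forest n → ℕ → ℝ) : Prop :=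
  (∀ τ : Forest n, τ.size < level γ → 0 < Delta γ p η τ 0) ∧
  ∀ (τ : Forest n) (ℓ : ℕ) (σ : Forest n), IsTriple γ (τ, ℓ, σ) →
    0 < Delta γ p η τ ℓ + zeta γ τ ℓ σ * Delta γ p η σ 0

section LocalNorms

variable {m n : ℕ} {γ : ℝ}

/-- `H_τ = ‖f^τ‖_{∞;η(τ,0)} ‖X^{[τ]}‖_{[z-r,z]}`. -/
def locH (η : Forest n → ℕ → ℝ) (f : Vec m → Lin n m) (X : BranchedRoughPath n γ) (z r : ℝ)
    (τ : Forest n) : ℝ :=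
  weightedNorm (elemDiff f τ) 0 (η τ 0) * X.seminorm τ (z - r) z

/-- `⟦(f,X)⟧⁽¹⁾_{z,r} = max_{|τ| ≤ N-1} H_τ^{ρ_τ}` with `ρ_τ = α / Δ(τ,0)`. -/
def locNorm₁ (p : ℝ) (η : Forest n → ℕ → ℝ) (f : Vec m → Lin n m) (X : BranchedRoughPath n γ)
    (z r : ℝ) : ℝ :=
  ⨆ τ : {τ : Forest n // τ.size < level γ},
    locH η f X z r τ.1 ^ (alpha p / Delta γ p η τ.1 0)

/-- `⟦(f,X)⟧⁽²⁾_{z,r}`, the maximum over all admissible triples `(τ,ℓ,σ)` of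
`(‖D^ℓ f^τ‖_{∞;η(τ,ℓ)} ‖X^{[τ]}‖_{[z-r,z]} H_σ^{ζ_{τ,ℓ,σ}})^{ρ_{τ,ℓ,σ}}` with
`ρ_{τ,ℓ,σ} = α / (Δ(τ,ℓ) + ζ_{τ,ℓ,σ} Δ(σ,0))`; it is `0` if there is no such triple. -/
def locNorm₂ (p : ℝ) (η : Forest n → ℕ → ℝ) (f : Vec m → Lin n m) (X : BranchedRoughPath n γ)
    (z r : ℝ) : ℝ :=
  ⨆ q : {q : Forest n × ℕ × Forest n // IsTriple γ q},
    (weightedNorm (elemDiff f q.1.1) q.1.2.1 (η q.1.1 q.1.2.1) * X.seminorm q.1.1 (z - r) z *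
        locH η f X z r q.1.2.2 ^ zeta γ q.1.1 q.1.2.1 q.1.2.2) ^
      (alpha p / (Delta γ p η q.1.1 q.1.2.1 +
        zeta γ q.1.1 q.1.2.1 q.1.2.2 * Delta γ p η q.1.2.2 0))

end LocalNorms

open Classical in
/-- `λ_z = (C |x|^{-1/α}) ∧ (|z+1| / 2)` with `x = φ_z`, where `|x|^{-1/α} = +∞` if `x = 0`. -/
def localScale {m : ℕ} (p C z : ℝ) (x : Vec m) : ℝ :=
  if x = 0 then |z + 1| / 2 else min (C * ‖x‖ ^ (-(1 / alpha p))) (|z + 1| / 2)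

end RDE

end

/-!
The proof compares the solution with the ordinary differential equation `dφ = -φ^p dt`, whose
solutions come down from infinity in a finite time, on the time scale `M^{-1/α}` that belongs to a
value of size `M`.

*Davie's expansion.* Let `V` be a primitive of `φ^p` and let `R_{st}` be the remainder `φ_t - φ_s +
V_t - V_s - ∑ s(τ)⁻¹ f^τ(φ_s) X^{[τ]}_{st}` (`davieRem`). By Chen's relation, the defect of
additivity `R_{st} - R_{su} - R_{ut}` is a sum of terms `(f^τ(φ_u) - T_τ) X^{[τ]}_{ut}`, where
`T_τ` collects the terms that the coproduct contributes. The main algebraic point,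
`sum_coproductSum_eq_sum_davieTaylor`, is that `T_τ` is the Taylor polynomial of degree `< N - |τ|`
of `f^τ` along the curve `ϵ ↦ φ_s + ∑_σ ϵ^{|σ|+1} s(σ)⁻¹ f^σ(φ_s) X^{[σ]}_{su}` (`davieCurve`). It
is not proved by combinatorics of cuts. Two expansions of `D^ℓ G` over forests, one at `φ_s` and
one at a point of the curve, are shown by induction on `K` to agree up to `O(ϵ^K)`
(`hasOrder_forestSum_sub`): they agree for `θ = 0`, where `θ` weights the number of trees, and
their `θ`-derivatives are expansions of the same kind of lower order. Polynomials of degree `< N`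
which agree up to `O(ϵ^N)` are equal.

*Sewing.* The remainder is `o(t - s)` by the definition of a solution. Bisection of intervals turns
the bound for the defect into a quantitative bound for the remainder at a time scale `T` and a
space scale `S` (`ScaleBounds.norm_davieRem_le`), which involves the derivatives `D^ℓ f^τ` at
distances comparable to `S` from the path.

*Choice of the scale.* Suppose that `φ_b` has size `M`, that `φ` is of size at most a multiple of
`M` on an interval before `b` of length comparable to `M^{-1/α}`, and that the local norms are at
most `ω M`. With `T = M^{-1/α} δ` and `S = M δ`, the powers of `M` in the bounds for the
coefficients combine to `M^{-Δ(τ,ℓ)/α}` (`rpow_mul_scale`). The scale `δ` is the smallest one at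
which the terms `f^τ X^{[τ]}` are a small perturbation; the conditions on the products `‖D^ℓ f^τ‖
‖X^{[τ]}‖ H_σ^ζ` then say that the terms with derivatives are small too (`exists_scale`,
`exists_scale_of_locNorm_le`). Hence `φ_b - φ_s + V_b - V_s` is small compared with `M`, and `φ`
behaves like a solution of the unperturbed equation: the interval has length at most a fixed
multiple of `M^{-1/α}` (`sub_mul_rpow_le_of_norm_sub_add_le`).

*Conclusion.* If the claimed bound fails at `z`, a maximum point `b` of `|φ_t|^{1/α} (t - a)` on an
interval `[a, z]` yields a time at which the assumptions of the previous step hold on an interval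
longer than that step allows (`exists_time_norm_le_mul`).
-/

noncomputable section

namespace RDE

/-! ### Forests as multisets of trees -/

instance {n : ℕ} : DecidableEq (Forest n) := Classical.decEq _

namespace PlaneForest

variable {n : ℕ}

/-- The trees of a plane forest from left to right; the tree `[σ]_i` is encoded by `(i, σ)`. -/
def treeList : PlaneForest n → List (Fin n × Forest n)
  | nil => []
  | cons i σ ρ => (i, Forest.mk σ) :: treeList ρ

theorem treeList_perm {τ τ' : PlaneForest n} (h : Rel τ τ') :
    τ.treeList.Perm τ'.treeList := by
  induction h with
  | refl => exact List.Perm.refl _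
  | symm _ ih => exact ih.symm
  | trans _ _ ih₁ ih₂ => exact ih₁.trans ih₂
  | swap => exact List.Perm.swap _ _ _
  | congr i h₁ _ _ ih₂ =>
      have : Forest.mk _ = Forest.mk _ := Quotient.sound h₁
      simp only [treeList, this]
      exact ih₂.cons _

theorem count_treeList (i : Fin n) (σ τ : PlaneForest n) :
    (τ.treeList : Multiset (Fin n × Forest n)).count (i, Forest.mk σ) = count i σ τ := by
  induction τ with
  | nil => simp [treeList, count]
  | cons j κ ρ _ ih =>
      have : Forest.mk κ = Forest.mk σ ↔ Rel σ κ :=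
        ⟨fun h => (Quotient.exact h).symm, fun h => Quotient.sound h.symm⟩
      rw [treeList, ← Multiset.cons_coe, Multiset.count_cons, ih, count, add_comm]
      congr 1
      by_cases h : i = j ∧ Rel σ κ
      · rw [if_pos h, if_pos]
        simp [h.1, this.2 h.2]
      · rw [if_neg h, if_neg]
        intro h'
        simp only [Prod.mk.injEq] at h'
        exact h ⟨h'.1, this.1 h'.2.symm⟩

theorem length_treeList_le (τ : PlaneForest n) : τ.treeList.length ≤ τ.size := by
  induction τ with
  | nil => simp [treeList]
  | cons i σ ρ _ ih => simp only [treeList, size, List.length_cons]; omega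

end PlaneForest

namespace Forest

variable {n : ℕ}

@[elab_as_elim]
theorem ind_mk {P : Forest n → Prop} (h : ∀ τ : PlaneForest n, P (mk τ)) (τ : Forest n) : P τ :=
  Quotient.inductionOn τ h

/-- The forest `[σ]_i · ρ`. -/
def cons (i : Fin n) (σ ρ : Forest n) : Forest n :=
  Quotient.map₂ (PlaneForest.cons i) (fun _ _ h _ _ h' => PlaneForest.Rel.congr i h h') σ ρ

/-- The multiset of trees of a forest. -/
def trees (τ : Forest n) : Multiset (Fin n × Forest n) :=
  Quotient.lift (fun σ : PlaneForest n => (σ.treeList : Multiset (Fin n × Forest n)))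
    (fun _ _ h => Multiset.coe_eq_coe.2 (PlaneForest.treeList_perm h)) τ

@[simp] theorem cons_mk (i : Fin n) (σ ρ : PlaneForest n) :
    cons i (mk σ) (mk ρ) = mk (PlaneForest.cons i σ ρ) := rfl

@[simp] theorem trees_mk (τ : PlaneForest n) :
    trees (mk τ) = (τ.treeList : Multiset (Fin n × Forest n)) := rfl

@[simp] theorem size_mk (τ : PlaneForest n) : size (mk τ) = τ.size := rfl

@[simp] theorem trees_empty : trees (empty : Forest n) = 0 := rfl

@[simp] theorem size_empty : size (empty : Forest n) = 0 := rfl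

@[simp] theorem symFactor_empty : symFactor (empty : Forest n) = 1 := rfl

@[simp] theorem trees_cons (i : Fin n) (σ ρ : Forest n) :
    trees (cons i σ ρ) = (i, σ) ::ₘ trees ρ := by
  induction σ using ind_mk; induction ρ using ind_mk; rfl

@[simp] theorem size_cons (i : Fin n) (σ ρ : Forest n) :
    size (cons i σ ρ) = size σ + 1 + size ρ := by
  induction σ using ind_mk; induction ρ using ind_mk; rfl

@[simp] theorem size_graft (i : Fin n) (σ : Forest n) : size (graft i σ) = size σ + 1 := by
  induction σ using ind_mk; rfl

theorem cons_eq_mul (i : Fin n) (σ ρ : Forest n) : cons i σ ρ = mul (graft i σ) ρ := by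
  induction σ using ind_mk; induction ρ using ind_mk; rfl

theorem symFactor_cons (i : Fin n) (σ ρ : Forest n) :
    symFactor (cons i σ ρ) =
      (cons i σ ρ).trees.count (i, σ) * symFactor σ * symFactor ρ := by
  induction σ using ind_mk with | h σ =>
  induction ρ using ind_mk with | h ρ =>
  change (PlaneForest.count i σ ρ + 1) * _ * _ = _
  rw [trees_cons, Multiset.count_cons_self, trees_mk,
    PlaneForest.count_treeList]
  rfl

theorem symFactor_pos (τ : Forest n) : 0 < symFactor τ := by
  induction τ using ind_mk with | h τ =>
  change 0 < PlaneForest.symFactor τ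
  induction τ with
  | nil => exact Nat.one_pos
  | cons i σ ρ ih₁ ih₂ =>
      simp only [PlaneForest.symFactor]
      positivity

theorem cons_left_comm (i j : Fin n) (σ κ ρ : Forest n) :
    cons i σ (cons j κ ρ) = cons j κ (cons i σ ρ) := by
  induction σ using ind_mk; induction κ using ind_mk; induction ρ using ind_mk
  exact Quotient.sound (PlaneForest.Rel.swap _ _ _ _ _)

@[elab_as_elim]
theorem cons_induction {P : Forest n → Prop} (h0 : P empty)
    (hc : ∀ i σ ρ, P σ → P ρ → P (cons i σ ρ)) (τ : Forest n) : P τ := by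
  induction τ using ind_mk with | h τ =>
  induction τ with
  | nil => exact h0
  | cons i σ ρ ih₁ ih₂ => exact hc i (mk σ) (mk ρ) ih₁ ih₂

/-- Any tree of a forest may be written first. -/
theorem exists_eq_cons_of_mem {τ : Forest n} {t : Fin n × Forest n} (h : t ∈ trees τ) :
    ∃ ρ, τ = cons t.1 t.2 ρ := by
  induction τ using cons_induction with
  | h0 => simp at h
  | hc i σ ρ _ ih =>
      rw [trees_cons, Multiset.mem_cons] at h
      rcases h with rfl | h
      · exact ⟨ρ, rfl⟩
      · obtain ⟨ρ', rfl⟩ := ih h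
        exact ⟨cons i σ ρ', cons_left_comm _ _ _ _ _⟩

theorem eq_empty_of_trees_eq_zero {τ : Forest n} (h : trees τ = 0) : τ = empty := by
  induction τ using cons_induction with
  | h0 => rfl
  | hc i σ ρ _ _ => simp at h

/-- A forest is determined by the multiset of its trees, so that its decompositions `[σ]_i · ρ` are
determined by `(i, σ)`. -/
theorem trees_injective : Function.Injective (trees : Forest n → _) := by
  intro τ
  induction τ using cons_induction with
  | h0 => exact fun κ h => (eq_empty_of_trees_eq_zero h.symm).symm
  | hc i σ ρ _ ih =>
      intro κ h
      have hm : (i, σ) ∈ trees κ := by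
        rw [← h, trees_cons]
        exact Multiset.mem_cons_self _ _
      obtain ⟨ρ', rfl⟩ := exists_eq_cons_of_mem hm
      rw [trees_cons, trees_cons, Multiset.cons_inj_right] at h
      rw [ih h]

theorem card_trees_le (τ : Forest n) : (trees τ).card ≤ size τ := by
  induction τ using ind_mk with | h τ => exact PlaneForest.length_treeList_le τ

@[simp] theorem mem_below {k : ℕ} {τ : Forest n} : τ ∈ below n k ↔ size τ < k := by
  simp [below]

/-- The finite set of the triples `(i, σ, ρ)` with `|[σ]_i · ρ| ≤ K`. -/
def splitsBelow (n K : ℕ) : Finset (Fin n × Forest n × Forest n) :=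
  (Finset.univ ×ˢ below n K ×ˢ below n K).filter fun q => size q.2.1 + size q.2.2 < K

theorem mem_splitsBelow {K : ℕ} {q : Fin n × Forest n × Forest n} :
    q ∈ splitsBelow n K ↔ size q.2.1 + size q.2.2 < K := by
  simp only [splitsBelow, Finset.mem_filter, Finset.mem_product, Finset.mem_univ, mem_below,
    true_and]
  omega

/-- A forest has as many decompositions `[σ]_i · ρ`, counted with the multiplicity of `[σ]_i`, as it
has trees. -/
theorem sum_count_fiber (K : ℕ) {τ : Forest n} (hτ : τ ∈ below n (K + 1)) :
    ∑ q ∈ splitsBelow n K with cons q.1 q.2.1 q.2.2 = τ, ((trees τ).count (q.1, q.2.1) : ℝ) =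
      (trees τ).card := by
  rw [← Multiset.toFinset_sum_count_eq, Nat.cast_sum]
  refine Finset.sum_nbij (fun q => (q.1, q.2.1)) ?_ ?_ ?_ fun _ _ => rfl
  · rintro ⟨i, σ, ρ⟩ hq
    simp only [Finset.mem_filter] at hq
    rw [Multiset.mem_toFinset, ← hq.2, trees_cons]
    exact Multiset.mem_cons_self _ _
  · rintro ⟨i, σ, ρ⟩ hq ⟨i', σ', ρ'⟩ hq' he
    have hq := (Finset.mem_filter.1 (Finset.mem_coe.1 hq)).2
    have hq' := (Finset.mem_filter.1 (Finset.mem_coe.1 hq')).2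
    simp only [Prod.mk.injEq] at he
    obtain ⟨rfl, rfl⟩ := he
    have h := congrArg trees (hq.trans hq'.symm)
    rw [trees_cons, trees_cons, Multiset.cons_inj_right] at h
    exact congrArg (fun κ => (i, σ, κ)) (trees_injective h)
  · rintro ⟨i, σ⟩ ht
    obtain ⟨ρ, rfl⟩ := exists_eq_cons_of_mem (Multiset.mem_toFinset.1 (Finset.mem_coe.1 ht))
    refine ⟨(i, σ, ρ), Finset.mem_coe.2 (Finset.mem_filter.2 ⟨?_, rfl⟩), rfl⟩
    rw [mem_splitsBelow]
    simp only [mem_below, size_cons] at hτ ⊢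
    omega

/-- The decompositions `τ = [σ]_i · ρ`, weighted by the inverse symmetry factors of `σ` and `ρ`,
have total weight `ℓ / s(τ)`, where `ℓ` is the number of trees of `τ`. -/
theorem sum_below_succ_card_trees {E : Type*} [AddCommGroup E] [Module ℝ E] (K : ℕ)
    (Φ : Forest n → E) :
    ∑ τ ∈ below n (K + 1), (((trees τ).card : ℝ) * (symFactor τ : ℝ)⁻¹) • Φ τ =
      ∑ q ∈ splitsBelow n K,
        ((symFactor q.2.1 : ℝ)⁻¹ * (symFactor q.2.2 : ℝ)⁻¹) • Φ (cons q.1 q.2.1 q.2.2) := by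
  rw [← Finset.sum_fiberwise_of_maps_to (s := splitsBelow n K) (t := below n (K + 1))
    (g := fun q : Fin n × Forest n × Forest n => cons q.1 q.2.1 q.2.2)]
  · refine Finset.sum_congr rfl fun τ hτ => ?_
    rw [← sum_count_fiber K hτ, Finset.sum_mul, Finset.sum_smul]
    refine Finset.sum_congr rfl fun q hq => ?_
    obtain ⟨i, σ, ρ⟩ := q
    have hq := (Finset.mem_filter.1 hq).2
    simp only at hq
    subst hq
    congr 1
    rw [symFactor_cons]
    have h1 : ((cons i σ ρ).trees.count (i, σ) : ℝ) ≠ 0 := by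
      rw [trees_cons, Multiset.count_cons_self]
      positivity
    push_cast
    rw [mul_inv, mul_inv]
    field_simp
  · rintro ⟨i, σ, ρ⟩ hq
    rw [mem_splitsBelow] at hq
    simp only [mem_below, size_cons]
    simp only at hq
    omega

end Forest

/-! ### Derivatives along the trees of a forest -/

section ElementaryDifferential

variable {m n : ℕ}

theorem Forest.size_lt_of_mem_trees {τ : Forest n} {t : Fin n × Forest n} (h : t ∈ τ.trees) :
    t.2.size < τ.size := by
  obtain ⟨ρ, rfl⟩ := Forest.exists_eq_cons_of_mem h
  rw [Forest.size_cons]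
  omega

/-- The value `(D^ℓ G)(z)(b_{t₁}, …, b_{t_ℓ})`, where `t₁, …, t_ℓ` are the trees of `τ`. -/
def treeDeriv (G : Vec m → Lin n m) (z : Vec m) (b : Fin n × Forest n → Vec m) (τ : Forest n) :
    Lin n m :=
  applyDeriv G z (τ.trees.toList.map b)

theorem treeDeriv_eq {G : Vec m → Lin n m} {τ : Forest n} (hG : ContDiff ℝ τ.trees.card G)
    (z : Vec m) (b : Fin n × Forest n → Vec m) {L : List (Fin n × Forest n)}
    (hL : (L : Multiset (Fin n × Forest n)) = τ.trees) :
    treeDeriv G z b τ = applyDeriv G z (L.map b) := by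
  refine applyDeriv_perm (List.Perm.map _ ?_) (by simpa using hG) z
  rw [← Multiset.coe_eq_coe, Multiset.coe_toList, hL]

@[simp] theorem treeDeriv_empty (G : Vec m → Lin n m) (z : Vec m)
    (b : Fin n × Forest n → Vec m) : treeDeriv G z b Forest.empty = G z := by
  have h : (Forest.empty : Forest n).trees.toList = [] := by simp
  rw [treeDeriv, h]
  exact iteratedFDeriv_zero_apply _

/-- The list of vectors of `applyDeriv` may be shortened at the expense of a derivative of `G`. -/
theorem applyDeriv_fderiv {G : Vec m → Lin n m} {v : List (Vec m)} (a : Vec m)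
    (hG : ContDiff ℝ (v.length + 1 : ℕ) G) (z : Vec m) :
    applyDeriv (fun y => fderiv ℝ G y a) z v = applyDeriv G z (a :: v) := by
  induction v generalizing z with
  | nil =>
      rw [applyDeriv_cons hG]
      simp [applyDeriv, iteratedFDeriv_zero_apply]
  | cons b v ih =>
      have hG1 : ContDiff ℝ (v.length + 1 : ℕ) (fun y => fderiv ℝ G y a) :=
        (hG.fderiv_right (by simp)).clm_apply contDiff_const
      rw [applyDeriv_cons hG1, applyDeriv_perm (List.Perm.swap b a v) (by simpa using hG),
        applyDeriv_cons (by simpa using hG)]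
      have : ∀ y, _ := ih (hG.of_le (by simp))
      simp only [this]

theorem contDiff_fderiv_apply {G : Vec m → Lin n m} {k : ℕ} (hG : ContDiff ℝ (k + 1 : ℕ) G)
    (a : Vec m) : ContDiff ℝ k (fun y => fderiv ℝ G y a) :=
  (hG.fderiv_right (by simp)).clm_apply contDiff_const

theorem treeDeriv_cons {G : Vec m → Lin n m} {i : Fin n} {σ ρ : Forest n}
    (hG : ContDiff ℝ (ρ.trees.card + 1 : ℕ) G) (z : Vec m) (b : Fin n × Forest n → Vec m) :
    treeDeriv G z b (Forest.cons i σ ρ) =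
      applyDeriv G z (b (i, σ) :: ρ.trees.toList.map b) := by
  rw [treeDeriv_eq (L := (i, σ) :: ρ.trees.toList) (by simpa using hG) z b]
  · rfl
  · rw [← Multiset.cons_coe, Multiset.coe_toList, Forest.trees_cons]

theorem treeDeriv_fderiv {G : Vec m → Lin n m} {ρ : Forest n} (a : Vec m)
    (hG : ContDiff ℝ (ρ.trees.card + 1 : ℕ) G) (z : Vec m) (b : Fin n × Forest n → Vec m) :
    treeDeriv (fun y => fderiv ℝ G y a) z b ρ = applyDeriv G z (a :: ρ.trees.toList.map b) :=
  applyDeriv_fderiv a (by simpa using hG) z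

theorem hasDerivAt_applyDeriv {G : Vec m → Lin n m} {v : List (Vec m)}
    (hG : ContDiff ℝ (v.length + 1 : ℕ) G) (x w : Vec m) (θ : ℝ) :
    HasDerivAt (fun θ : ℝ => applyDeriv G (x + θ • w) v) (applyDeriv G (x + θ • w) (w :: v)) θ := by
  rw [applyDeriv_cons hG]
  have h1 : HasDerivAt (fun θ : ℝ => x + θ • w) w θ := by
    simpa using ((hasDerivAt_id θ).smul_const w).const_add x
  exact (((contDiff_applyDeriv (k := 1) hG).differentiable (by norm_num)
    (x + θ • w)).hasFDerivAt.comp_hasDerivAt θ h1)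

theorem applyDeriv_map_smul {G : Vec m → Lin n m} {ι : Type*} (L : List ι)
    (hG : ContDiff ℝ L.length G) (z : Vec m) (r : ι → ℝ) (b : ι → Vec m) :
    applyDeriv G z (L.map fun t => r t • b t) = (L.map r).prod • applyDeriv G z (L.map b) := by
  induction L generalizing z with
  | nil => simp
  | cons t L ih =>
      have hG' := hG
      simp only [List.map_cons]
      rw [applyDeriv_cons (by simpa using hG), applyDeriv_cons (by simpa using hG)]
      have : ∀ y, _ := ih (hG.of_le (by simp))
      simp only [this]
      have hd : DifferentiableAt ℝ (fun y => applyDeriv G y (L.map b)) z :=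
        (contDiff_applyDeriv (k := 1) (by simpa using hG)).differentiable (by norm_num) z
      rw [fderiv_fun_const_smul hd, List.prod_cons]
      simp only [FunLike.coe_smul, Pi.smul_apply, map_smul, smul_smul]

theorem norm_applyDeriv_le (G : Vec m → Lin n m) (z : Vec m) (v : List (Vec m)) :
    ‖applyDeriv G z v‖ ≤ ‖iteratedFDeriv ℝ v.length G z‖ * (v.map norm).prod := by
  refine ((iteratedFDeriv ℝ v.length G z).le_opNorm v.get).trans (le_of_eq ?_)
  congr 1
  rw [← List.prod_ofFn]
  congr 1
  conv_rhs => rw [← List.ofFn_get v, List.map_ofFn]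
  rfl

theorem applyDeriv_map {ι : Type*} (G : Vec m → Lin n m) (z : Vec m) (L : List ι) (b : ι → Vec m) :
    applyDeriv G z (L.map b) = iteratedFDeriv ℝ L.length G z (fun j => b (L.get j)) := by
  have key : ∀ (k : ℕ) (v : List (Vec m)) (h : v.length = k),
      applyDeriv G z v = iteratedFDeriv ℝ k G z (fun j => v.get (j.cast h.symm)) := by
    rintro k v rfl
    rfl
  rw [key L.length _ (by simp)]
  congr 1
  funext j
  simp

/-- The expansion of the vectors in the standard basis reduces the claim to finitely many fixed
vectors. -/
theorem contDiff_multilinear_apply {H F : Type*} [NormedAddCommGroup H] [NormedSpace ℝ H]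
    [NormedAddCommGroup F] [NormedSpace ℝ F] {k ℓ : ℕ}
    {M : H → ContinuousMultilinearMap ℝ (fun _ : Fin ℓ => Vec m) F} {a : Fin ℓ → H → Vec m}
    (hM : ContDiff ℝ k M) (ha : ∀ j, ContDiff ℝ k (a j)) :
    ContDiff ℝ k (fun h => M h (fun j => a j h)) := by
  have he : (fun h => M h (fun j => a j h)) = fun h => ∑ r : Fin ℓ → Fin m,
      (∏ j, a j h (r j)) • M h (fun j => EuclideanSpace.single (r j) (1 : ℝ)) := by
    funext h
    have h1 : (fun j => a j h) =
        fun j => ∑ i, (a j h i) • (EuclideanSpace.single i (1 : ℝ) : Vec m) := by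
      funext j
      simpa using ((EuclideanSpace.basisFun (Fin m) ℝ).sum_repr (a j h)).symm
    rw [h1, ContinuousMultilinearMap.map_sum]
    exact Finset.sum_congr rfl fun r _ => (M h).map_smul_univ _ _
  rw [he]
  refine ContDiff.sum fun r _ => ContDiff.smul (contDiff_prod fun j _ => ?_) ?_
  · exact (EuclideanSpace.proj (r j) : Vec m →L[ℝ] ℝ).contDiff.comp (ha j)
  · exact (ContinuousMultilinearMap.apply ℝ (fun _ : Fin ℓ => Vec m) F _).contDiff.comp hM

theorem PlaneForest.fields_eq {f : Vec m → Lin n m} {N : ℕ} (hf : ContDiff ℝ N f) (x : Vec m)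
    (τ : PlaneForest n) (hτ : τ.size ≤ N) :
    τ.fields f x =
      τ.treeList.map (fun t => RDE.elemDiff f t.2 x (EuclideanSpace.single t.1 (1 : ℝ))) := by
  induction τ with
  | nil => rfl
  | cons i σ ρ _ ih =>
      simp only [size] at hτ
      simp only [fields, treeList, List.map_cons]
      rw [ih (by omega), elemDiff_mk hf σ (by omega)]
      rfl

theorem elemDiff_eq_treeDeriv {f : Vec m → Lin n m} {N : ℕ} (hf : ContDiff ℝ N f)
    {τ : Forest n} (hτ : τ.size ≤ N) (x : Vec m) :
    elemDiff f τ x =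
      treeDeriv f x (fun t => elemDiff f t.2 x (EuclideanSpace.single t.1 (1 : ℝ))) τ := by
  induction τ using Forest.ind_mk with | h τ =>
  rw [elemDiff_mk hf τ hτ, PlaneForest.elemDiff, PlaneForest.fields_eq hf x τ hτ,
    treeDeriv_eq _ _ _ rfl]
  exact hf.of_le (by exact_mod_cast (Forest.card_trees_le _).trans hτ)

theorem contDiff_elemDiff {f : Vec m → Lin n m} {N : ℕ} (hf : ContDiff ℝ N f)
    {τ : Forest n} {k : ℕ} (hτ : τ.size + k ≤ N) : ContDiff ℝ k (elemDiff f τ) := by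
  induction hs : τ.size using Nat.strong_induction_on generalizing τ with
  | _ s ih =>
    have he : elemDiff f τ = fun x => iteratedFDeriv ℝ τ.trees.toList.length f x
        (fun j => elemDiff f (τ.trees.toList.get j).2 x
          (EuclideanSpace.single (τ.trees.toList.get j).1 (1 : ℝ))) := by
      funext x
      rw [elemDiff_eq_treeDeriv hf (by omega), treeDeriv, applyDeriv_map]
    rw [he]
    have hc := Forest.card_trees_le τ
    refine contDiff_multilinear_apply (hf.iteratedFDeriv_right ?_) fun j => ?_
    · rw [Multiset.length_toList]
      norm_cast
      omega
    · have hm : τ.trees.toList.get j ∈ τ.trees := Multiset.mem_toList.1 (List.get_mem _ _)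
      have hlt := Forest.size_lt_of_mem_trees hm
      exact (ih _ (hs ▸ hlt) (by omega) rfl).clm_apply contDiff_const

end ElementaryDifferential

/-! ### Characters and the coproduct -/

section Character

variable {n : ℕ}

theorem Forest.prod_trees_pow (r : ℝ) (τ : Forest n) :
    (τ.trees.map fun t => r ^ (t.2.size + 1)).prod = r ^ τ.size := by
  induction τ using Forest.cons_induction with
  | h0 => simp
  | hc i σ ρ _ ih =>
      rw [Forest.trees_cons, Multiset.map_cons, Multiset.prod_cons, ih, Forest.size_cons, ← pow_add]

/-- The multiplicative extension to forests of a function on trees. -/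
def character (c : Fin n → Forest n → ℝ) (τ : Forest n) : ℝ :=
  (τ.trees.map fun t => c t.1 t.2).prod

@[simp] theorem character_empty (c : Fin n → Forest n → ℝ) : character c Forest.empty = 1 := rfl

@[simp] theorem character_cons (c : Fin n → Forest n → ℝ) (i : Fin n) (σ ρ : Forest n) :
    character c (Forest.cons i σ ρ) = c i σ * character c ρ := by
  simp [character]

theorem character_append (c : Fin n → Forest n → ℝ) (σ ρ : PlaneForest n) :
    character c (Forest.mk (σ.append ρ)) =
      character c (Forest.mk σ) * character c (Forest.mk ρ) := by
  induction σ with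
  | nil =>
      change character c (Forest.mk ρ) = character c Forest.empty * _
      simp
  | cons i κ σ _ ih =>
      change character c (Forest.cons i (Forest.mk κ) (Forest.mk (σ.append ρ))) =
        character c (Forest.cons i (Forest.mk κ) (Forest.mk σ)) * _
      rw [character_cons, character_cons, ih, mul_assoc]

/-- `∑_{(τ)} χ(τ⁽¹⁾) g(τ⁽²⁾)` for the character `χ` with values `c` on trees. -/
def PlaneForest.coproductSum (c : Fin n → Forest n → ℝ) (g : Forest n → ℝ) (τ : PlaneForest n) :
    ℝ :=
  (τ.coproduct.map fun a => character c (Forest.mk a.1) * g (Forest.mk a.2)).sum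

namespace PlaneForest

variable (c : Fin n → Forest n → ℝ)

theorem coproductSum_nil (g : Forest n → ℝ) : coproductSum c g nil = g Forest.empty := by
  change (([(nil, nil)] : List (PlaneForest n × PlaneForest n)).map _).sum = _
  simp only [List.map_cons, List.map_nil, List.sum_cons, List.sum_nil, add_zero]
  change character c Forest.empty * g Forest.empty = _
  simp

theorem coproductSum_add (g h : Forest n → ℝ) (τ : PlaneForest n) :
    coproductSum c (fun κ => g κ + h κ) τ = coproductSum c g τ + coproductSum c h τ := by
  simp only [coproductSum, mul_add, List.sum_map_add]

theorem coproductSum_smul (r : ℝ) (g : Forest n → ℝ) (τ : PlaneForest n) :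
    coproductSum c (fun κ => r * g κ) τ = r * coproductSum c g τ := by
  simp only [coproductSum, ← List.sum_map_mul_left]
  congr 2
  funext a
  ring

theorem coproductSum_comm (g : Forest n → Forest n → ℝ) (σ ρ : PlaneForest n) :
    coproductSum c (fun b => coproductSum c (fun a => g a b) σ) ρ =
      coproductSum c (fun a => coproductSum c (fun b => g a b) ρ) σ := by
  simp only [coproductSum, ← Multiset.sum_coe, ← Multiset.map_coe, ← Multiset.sum_map_mul_left]
  rw [Multiset.sum_map_sum_map]
  congr 2
  funext a
  congr 2
  funext b
  ring

theorem coproductSum_cons (g : Forest n → ℝ) (i : Fin n) (σ ρ : PlaneForest n) :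
    coproductSum c g (cons i σ ρ) = c i (Forest.mk σ) * coproductSum c g ρ +
      coproductSum c (fun b => coproductSum c (fun a => g (Forest.cons i a b)) σ) ρ := by
  rw [coproductSum_comm, coproductSum, coproduct, List.map_append, List.sum_append]
  congr 1
  · simp only [coproductSum, List.map_map, ← List.sum_map_mul_left]
    congr 2
    funext a
    simp only [Function.comp, ← Forest.cons_mk, character_cons, mul_assoc]
  · rw [List.map_flatMap, List.flatMap_def, List.sum_flatten, List.map_map]
    unfold coproductSum
    congr 2
    funext a
    simp only [Function.comp, List.map_map, ← List.sum_map_mul_left]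
    congr 2
    funext b
    simp only [Function.comp, character_append, Forest.cons_mk]
    ring

theorem coproductSum_eq_of_rel {τ τ' : PlaneForest n} (h : Rel τ τ') (g : Forest n → ℝ) :
    coproductSum c g τ = coproductSum c g τ' := by
  induction h generalizing g with
  | refl => rfl
  | symm _ ih => exact (ih g).symm
  | trans _ _ ih₁ ih₂ => exact (ih₁ g).trans (ih₂ g)
  | swap i j σ σ' ρ =>
      simp only [coproductSum_cons]
      have h1 : ∀ b, coproductSum c (fun a' => coproductSum c
            (fun a => g (Forest.cons i a (Forest.cons j a' b))) σ) σ' =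
          coproductSum c (fun a => coproductSum c
            (fun a' => g (Forest.cons j a' (Forest.cons i a b))) σ') σ := by
        intro b
        rw [coproductSum_comm]
        simp only [Forest.cons_left_comm]
      simp only [h1]
      ring
  | @congr i σ σ' ρ ρ' h₁ _ ih₁ ih₂ =>
      have : Forest.mk σ = Forest.mk σ' := Quotient.sound h₁
      simp only [coproductSum_cons, ih₁, ih₂, this]

end PlaneForest

/-- `∑_{(τ)} χ(τ⁽¹⁾) g(τ⁽²⁾)` for the character `χ` with values `c` on trees. -/
def Forest.coproductSum (c : Fin n → Forest n → ℝ) (g : Forest n → ℝ) (τ : Forest n) : ℝ :=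
  Quotient.lift (PlaneForest.coproductSum c g)
    (fun _ _ h => PlaneForest.coproductSum_eq_of_rel c h g) τ

namespace Forest

variable (c : Fin n → Forest n → ℝ)

theorem coproductSum_mk (g : Forest n → ℝ) (τ : PlaneForest n) :
    coproductSum c g (mk τ) = τ.coproductSum c g := rfl

@[simp] theorem coproductSum_empty (g : Forest n → ℝ) : coproductSum c g empty = g empty :=
  PlaneForest.coproductSum_nil c g

theorem coproductSum_cons (g : Forest n → ℝ) (i : Fin n) (σ ρ : Forest n) :
    coproductSum c g (cons i σ ρ) =
      coproductSum c (fun b => c i σ * g b + coproductSum c (fun a => g (cons i a b)) σ) ρ := by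
  induction σ using ind_mk with | h σ =>
  induction ρ using ind_mk with | h ρ =>
  rw [cons_mk, coproductSum_mk, PlaneForest.coproductSum_cons, coproductSum_mk,
    PlaneForest.coproductSum_add, PlaneForest.coproductSum_smul]
  rfl

end Forest

end Character

/-! ### Orders of vanishing -/

section Order

variable {E F : Type*} [NormedAddCommGroup E] [NormedAddCommGroup F]

/-- `F(θ, ϵ) = O(ϵ^K)` for `ϵ ∈ [0, 1]`, uniformly in `θ ∈ [0, 1]`. -/
def HasOrder (K : ℕ) (F : ℝ → ℝ → E) : Prop :=
  ∃ C : ℝ, ∀ θ ∈ Set.Icc (0 : ℝ) 1, ∀ ϵ ∈ Set.Icc (0 : ℝ) 1, ‖F θ ϵ‖ ≤ C * ϵ ^ K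

namespace HasOrder

variable {K J : ℕ} {A B : ℝ → ℝ → E}

theorem mono (h : HasOrder K A) (hJ : J ≤ K) : HasOrder J A := by
  obtain ⟨C, hC⟩ := h
  refine ⟨max C 0, fun θ hθ ϵ hϵ => (hC θ hθ ϵ hϵ).trans ?_⟩
  have h1 : ϵ ^ K ≤ ϵ ^ J := pow_le_pow_of_le_one hϵ.1 hϵ.2 hJ
  calc C * ϵ ^ K ≤ max C 0 * ϵ ^ K :=
        mul_le_mul_of_nonneg_right (le_max_left _ _) (pow_nonneg hϵ.1 _)
    _ ≤ max C 0 * ϵ ^ J := mul_le_mul_of_nonneg_left h1 (le_max_right _ _)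

theorem congr (h : HasOrder K A) (he : ∀ θ ϵ, A θ ϵ = B θ ϵ) : HasOrder K B := by
  have : A = B := by
    funext θ ϵ
    exact he θ ϵ
  exact this ▸ h

theorem zero : HasOrder K (fun _ _ => (0 : E)) := ⟨0, fun _ _ _ _ => by simp⟩

theorem add (hA : HasOrder K A) (hB : HasOrder K B) :
    HasOrder K (fun θ ϵ => A θ ϵ + B θ ϵ) := by
  obtain ⟨C, hC⟩ := hA
  obtain ⟨C', hC'⟩ := hB
  refine ⟨C + C', fun θ hθ ϵ hϵ => (norm_add_le _ _).trans ?_⟩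
  rw [add_mul]
  exact add_le_add (hC θ hθ ϵ hϵ) (hC' θ hθ ϵ hϵ)

theorem neg (hA : HasOrder K A) : HasOrder K (fun θ ϵ => -A θ ϵ) := by
  obtain ⟨C, hC⟩ := hA
  exact ⟨C, fun θ hθ ϵ hϵ => by simpa using hC θ hθ ϵ hϵ⟩

theorem sub (hA : HasOrder K A) (hB : HasOrder K B) :
    HasOrder K (fun θ ϵ => A θ ϵ - B θ ϵ) := by
  simpa only [sub_eq_add_neg] using hA.add hB.neg

theorem sum {ι : Type*} {s : Finset ι} {A : ι → ℝ → ℝ → E} (h : ∀ i ∈ s, HasOrder K (A i)) :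
    HasOrder K (fun θ ϵ => ∑ i ∈ s, A i θ ϵ) := by
  classical
  induction s using Finset.induction_on with
  | empty => simpa using zero
  | insert i s hi ih =>
      simp only [Finset.sum_insert hi]
      exact (h i (Finset.mem_insert_self _ _)).add
        (ih fun j hj => h j (Finset.mem_insert_of_mem hj))

theorem smul [NormedSpace ℝ E] {r : ℝ → ℝ → ℝ} (hr : HasOrder J r) (hA : HasOrder K A) :
    HasOrder (J + K) (fun θ ϵ => r θ ϵ • A θ ϵ) := by
  obtain ⟨C, hC⟩ := hr
  obtain ⟨C', hC'⟩ := hA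
  refine ⟨C * C', fun θ hθ ϵ hϵ => ?_⟩
  rw [norm_smul, pow_add]
  calc ‖r θ ϵ‖ * ‖A θ ϵ‖ ≤ (C * ϵ ^ J) * (C' * ϵ ^ K) :=
        mul_le_mul (hC θ hθ ϵ hϵ) (hC' θ hθ ϵ hϵ) (norm_nonneg _)
          ((norm_nonneg _).trans (hC θ hθ ϵ hϵ))
    _ = _ := by ring

theorem clm_apply [NormedSpace ℝ E] [NormedSpace ℝ F] {H : ℝ → ℝ → E →L[ℝ] F}
    (hH : HasOrder J H) (hA : HasOrder K A) :
    HasOrder (J + K) (fun θ ϵ => H θ ϵ (A θ ϵ)) := by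
  obtain ⟨C, hC⟩ := hH
  obtain ⟨C', hC'⟩ := hA
  refine ⟨C * C', fun θ hθ ϵ hϵ => ((H θ ϵ).le_opNorm _).trans ?_⟩
  rw [pow_add]
  calc ‖H θ ϵ‖ * ‖A θ ϵ‖ ≤ (C * ϵ ^ J) * (C' * ϵ ^ K) :=
        mul_le_mul (hC θ hθ ϵ hϵ) (hC' θ hθ ϵ hϵ) (norm_nonneg _)
          ((norm_nonneg _).trans (hC θ hθ ϵ hϵ))
    _ = _ := by ring

theorem const (a : E) : HasOrder 0 (fun _ _ => a) := ⟨‖a‖, fun _ _ _ _ => by simp⟩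

theorem pow (K : ℕ) : HasOrder K (fun _ ϵ : ℝ => ϵ ^ K) :=
  ⟨1, fun _ _ ϵ hϵ => by simp [abs_of_nonneg hϵ.1]⟩

theorem const_mul_pow_left (a : ℝ) (K : ℕ) : HasOrder 0 (fun θ _ : ℝ => a * θ ^ K) :=
  ⟨|a|, fun θ hθ ϵ _ => by
    rw [norm_mul, Real.norm_eq_abs, pow_zero]
    refine mul_le_mul_of_nonneg_left ?_ (abs_nonneg _)
    rw [norm_pow, Real.norm_eq_abs, abs_of_nonneg hθ.1]
    exact pow_le_one₀ hθ.1 hθ.2⟩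

theorem of_continuous {A : ℝ → E} (h : Continuous A) : HasOrder 0 (fun _ ϵ => A ϵ) := by
  obtain ⟨C, hC⟩ := (isCompact_Icc (a := (0 : ℝ)) (b := 1)).exists_bound_of_continuousOn
    h.continuousOn
  exact ⟨C, fun _ _ ϵ hϵ => by simpa using hC ϵ hϵ⟩

theorem of_hasDerivAt [NormedSpace ℝ E] {A A' : ℝ → ℝ → E} (h0 : ∀ ϵ, A 0 ϵ = 0)
    (hA : ∀ θ ϵ, HasDerivAt (fun θ => A θ ϵ) (A' θ ϵ) θ) (h : HasOrder K A') : HasOrder K A := by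
  obtain ⟨C, hC⟩ := h
  refine ⟨C, fun θ hθ ϵ hϵ => ?_⟩
  have := norm_image_sub_le_of_norm_deriv_le_segment' (f := fun θ => A θ ϵ) (a := 0) (b := 1)
    (fun θ _ => (hA θ ϵ).hasDerivWithinAt) (fun θ hθ => hC θ ⟨hθ.1, hθ.2.le⟩ ϵ hϵ) θ hθ
  simp only [h0, sub_zero] at this
  refine this.trans (mul_le_of_le_one_right ?_ hθ.2)
  exact (norm_nonneg _).trans (hC θ hθ ϵ hϵ)

end HasOrder

variable [NormedSpace ℝ E]

/-- A polynomial of degree less than `N` which is `O(ϵ^N)` vanishes. -/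
theorem eq_zero_of_norm_sum_pow_le {N : ℕ} {d : ℕ → E} {C : ℝ}
    (h : ∀ ϵ ∈ Set.Ioc (0 : ℝ) 1, ‖∑ k ∈ Finset.range N, ϵ ^ k • d k‖ ≤ C * ϵ ^ N) :
    ∀ k < N, d k = 0 := by
  induction N generalizing d with
  | zero => exact fun k hk => absurd hk (Nat.not_lt_zero k)
  | succ N ih =>
      have h0 : d 0 = 0 := by
        have h1 : Filter.Tendsto (fun ϵ : ℝ => ‖∑ k ∈ Finset.range (N + 1), ϵ ^ k • d k‖)
            (nhdsWithin 0 (Set.Ioi 0)) (nhds ‖d 0‖) := by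
          have : Continuous (fun ϵ : ℝ => ‖∑ k ∈ Finset.range (N + 1), ϵ ^ k • d k‖) := by
            fun_prop
          have h2 := this.tendsto 0
          simp only [Finset.sum_range_succ', zero_pow (Nat.succ_ne_zero _), zero_smul,
            Finset.sum_const_zero, pow_zero, one_smul, zero_add] at h2
          simp only [Finset.sum_range_succ', pow_zero, one_smul]
          exact h2.mono_left nhdsWithin_le_nhds
        have h2 : Filter.Tendsto (fun ϵ : ℝ => C * ϵ ^ (N + 1)) (nhdsWithin 0 (Set.Ioi 0))
            (nhds 0) := by
          have : Continuous (fun ϵ : ℝ => C * ϵ ^ (N + 1)) := by fun_prop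
          have h3 := this.tendsto 0
          simp only [zero_pow (Nat.succ_ne_zero _), mul_zero] at h3
          exact h3.mono_left nhdsWithin_le_nhds
        have h3 : ‖d 0‖ ≤ 0 := by
          refine le_of_tendsto_of_tendsto h1 h2 ?_
          filter_upwards [Ioc_mem_nhdsGT (zero_lt_one (α := ℝ))] with ϵ hϵ using h ϵ hϵ
        exact norm_le_zero_iff.1 h3
      have h1 := ih (d := fun k => d (k + 1)) fun ϵ hϵ => by
        have h2 := h ϵ hϵ
        rw [Finset.sum_range_succ', h0, smul_zero, add_zero] at h2
        have h3 : ∑ k ∈ Finset.range N, ϵ ^ (k + 1) • d (k + 1) =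
            ϵ • ∑ k ∈ Finset.range N, ϵ ^ k • d (k + 1) := by
          rw [Finset.smul_sum]
          exact Finset.sum_congr rfl fun k _ => by rw [smul_smul, pow_succ']
        rw [h3, norm_smul, Real.norm_of_nonneg hϵ.1.le, pow_succ', ← mul_assoc, mul_comm C,
          mul_assoc] at h2
        exact le_of_mul_le_mul_left h2 hϵ.1
      intro k hk
      cases k with
      | zero => exact h0
      | succ k => exact h1 k (by omega)

/-- `P` is a polynomial function of degree less than `N`. -/
def IsPolyLT (N : ℕ) (P : ℝ → E) : Prop :=
  ∃ d : ℕ → E, ∀ ϵ, P ϵ = ∑ k ∈ Finset.range N, ϵ ^ k • d k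

theorem IsPolyLT.add {N : ℕ} {P Q : ℝ → E} (hP : IsPolyLT N P) (hQ : IsPolyLT N Q) :
    IsPolyLT N (fun ϵ => P ϵ + Q ϵ) := by
  obtain ⟨d, hd⟩ := hP
  obtain ⟨d', hd'⟩ := hQ
  exact ⟨fun k => d k + d' k, fun ϵ => by simp only [hd, hd', smul_add, Finset.sum_add_distrib]⟩

theorem IsPolyLT.sum {ι : Type*} {s : Finset ι} {N : ℕ} {P : ι → ℝ → E}
    (h : ∀ i ∈ s, IsPolyLT N (P i)) : IsPolyLT N (fun ϵ => ∑ i ∈ s, P i ϵ) := by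
  classical
  induction s using Finset.induction_on with
  | empty => exact ⟨0, by simp⟩
  | insert i s hi ih =>
      simp only [Finset.sum_insert hi]
      exact (h i (Finset.mem_insert_self _ _)).add
        (ih fun j hj => h j (Finset.mem_insert_of_mem hj))

theorem IsPolyLT.pow_smul {N k : ℕ} (hk : k < N) (a : E) : IsPolyLT N (fun ϵ => ϵ ^ k • a) := by
  refine ⟨fun j => if j = k then a else 0, fun ϵ => ?_⟩
  simp [smul_ite, hk]

theorem IsPolyLT.neg {N : ℕ} {P : ℝ → E} (hP : IsPolyLT N P) : IsPolyLT N (fun ϵ => -P ϵ) := by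
  obtain ⟨d, hd⟩ := hP
  exact ⟨fun k => -d k, fun ϵ => by simp only [hd, smul_neg, Finset.sum_neg_distrib]⟩

end Order

/-! ### Weighted sums over forests -/

section ForestSum

variable {m n : ℕ}

/-- The derivative of `z ↦ (D^ℓ G)(z)(b_{t₁}, …, b_{t_ℓ})`, where `t₁, …, t_ℓ` are the trees of
`ρ`. -/
def headDeriv (G : Vec m → Lin n m) (z : Vec m) (b : Fin n × Forest n → Vec m) (ρ : Forest n) :
    Vec m →L[ℝ] Lin n m :=
  fderiv ℝ (fun y => treeDeriv G y b ρ) z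

theorem headDeriv_apply {G : Vec m → Lin n m} {ρ : Forest n}
    (hG : ContDiff ℝ (ρ.trees.card + 1 : ℕ) G) (z : Vec m) (b : Fin n × Forest n → Vec m)
    (a : Vec m) : headDeriv G z b ρ a = applyDeriv G z (a :: ρ.trees.toList.map b) :=
  (applyDeriv_cons (by simpa using hG) a z).symm

theorem treeDeriv_cons_eq_headDeriv {G : Vec m → Lin n m} {i : Fin n} {σ ρ : Forest n}
    (hG : ContDiff ℝ (ρ.trees.card + 1 : ℕ) G) (z : Vec m) (b : Fin n × Forest n → Vec m) :
    treeDeriv G z b (Forest.cons i σ ρ) = headDeriv G z b ρ (b (i, σ)) := by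
  rw [treeDeriv_cons hG, headDeriv_apply hG]

theorem treeDeriv_fderiv_eq_headDeriv {G : Vec m → Lin n m} {ρ : Forest n} (a : Vec m)
    (hG : ContDiff ℝ (ρ.trees.card + 1 : ℕ) G) (z : Vec m) (b : Fin n × Forest n → Vec m) :
    treeDeriv (fun y => fderiv ℝ G y a) z b ρ = headDeriv G z b ρ a := by
  rw [treeDeriv_fderiv a hG, headDeriv_apply hG]

theorem hasDerivAt_treeDeriv {G : Vec m → Lin n m} {ρ : Forest n}
    (hG : ContDiff ℝ (ρ.trees.card + 1 : ℕ) G) (x w : Vec m) (b : Fin n × Forest n → Vec m)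
    (θ : ℝ) : HasDerivAt (fun θ : ℝ => treeDeriv G (x + θ • w) b ρ)
      (headDeriv G (x + θ • w) b ρ w) θ := by
  rw [headDeriv_apply hG]
  exact hasDerivAt_applyDeriv (by simpa using hG) x w θ

/-- `b_t(ϵ) = O(ϵ^{|t|})` for the trees `t` with at most `N` vertices. -/
def TreeOrder (N : ℕ) (b : ℝ → Fin n × Forest n → Vec m) : Prop :=
  ∀ t : Fin n × Forest n, t.2.size < N → HasOrder (t.2.size + 1) (fun _ ϵ => b ϵ t)

theorem hasOrder_prod_norm {N : ℕ} {b : ℝ → Fin n × Forest n → Vec m} (hb : TreeOrder N b)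
    {ρ : Forest n} (hρ : ρ.size ≤ N) :
    HasOrder ρ.size (fun _ ϵ => ((ρ.trees.map fun t => ‖b ϵ t‖).prod : ℝ)) := by
  induction ρ using Forest.cons_induction with
  | h0 => simpa using HasOrder.const (1 : ℝ)
  | hc i σ ρ _ ih =>
      rw [Forest.size_cons] at hρ
      simp only [Forest.trees_cons, Multiset.map_cons, Multiset.prod_cons, Forest.size_cons]
      have h1 : HasOrder (σ.size + 1) (fun _ ϵ => ‖b ϵ (i, σ)‖) := by
        obtain ⟨C, hC⟩ := hb (i, σ) (show σ.size < N by omega)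
        exact ⟨C, fun θ hθ ϵ hϵ => by simpa using hC θ hθ ϵ hϵ⟩
      exact h1.smul (ih (by omega))

theorem exists_bound_iteratedFDeriv {G : Vec m → Lin n m} {k : ℕ} (hG : ContDiff ℝ k G)
    {w : ℝ → Vec m} (hw : Continuous w) (x : Vec m) :
    HasOrder 0 (fun θ ϵ => ‖iteratedFDeriv ℝ k G (x + θ • w ϵ)‖) := by
  have hc : Continuous (fun q : ℝ × ℝ => iteratedFDeriv ℝ k G (x + q.1 • w q.2)) :=
    (hG.continuous_iteratedFDeriv le_rfl).comp (by fun_prop)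
  obtain ⟨C, hC⟩ := ((isCompact_Icc (a := (0 : ℝ)) (b := 1)).prod
    (isCompact_Icc (a := (0 : ℝ)) (b := 1))).exists_bound_of_continuousOn hc.continuousOn
  exact ⟨C, fun θ hθ ϵ hϵ => by simpa using hC (θ, ϵ) ⟨hθ, hϵ⟩⟩

theorem hasOrder_headDeriv {N : ℕ} {b : ℝ → Fin n × Forest n → Vec m} (hb : TreeOrder N b)
    {w : ℝ → Vec m} (hw : Continuous w) (x : Vec m) {G : Vec m → Lin n m} {ρ : Forest n}
    (hρ : ρ.size ≤ N) (hG : ContDiff ℝ (ρ.trees.card + 1 : ℕ) G) :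
    HasOrder ρ.size (fun θ ϵ => headDeriv G (x + θ • w ϵ) (b ϵ) ρ) := by
  obtain ⟨C, hC⟩ := (exists_bound_iteratedFDeriv hG hw x).smul (hasOrder_prod_norm hb hρ)
  refine ⟨C, fun θ hθ ϵ hϵ => ?_⟩
  have h := hC θ hθ ϵ hϵ
  rw [zero_add] at h
  refine le_trans ?_ h
  change ‖headDeriv G (x + θ • w ϵ) (b ϵ) ρ‖ ≤
    ‖‖iteratedFDeriv ℝ (ρ.trees.card + 1) G (x + θ • w ϵ)‖ * (ρ.trees.map fun t => ‖b ϵ t‖).prod‖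
  refine le_trans (ContinuousLinearMap.opNorm_le_bound _ ?_ fun a => ?_) (le_abs_self _)
  · refine mul_nonneg (norm_nonneg _) (Multiset.prod_nonneg fun r hr => ?_)
    obtain ⟨t, _, rfl⟩ := Multiset.mem_map.1 hr
    exact norm_nonneg _
  · rw [headDeriv_apply hG]
    refine (norm_applyDeriv_le _ _ _).trans (le_of_eq ?_)
    have h1 : (ρ.trees.map fun t => ‖b ϵ t‖).prod =
        ((ρ.trees.toList.map (b ϵ)).map norm).prod := by
      conv_lhs => rw [← Multiset.coe_toList ρ.trees]
      rw [Multiset.map_coe, Multiset.prod_coe, List.map_map]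
      rfl
    have h2 : (a :: ρ.trees.toList.map (b ϵ)).length = ρ.trees.card + 1 := by simp
    rw [h2, h1, List.map_cons, List.prod_cons]
    ring

/-- `∑_{|τ| < K} s(τ)⁻¹ g(τ) θ^ℓ (D^ℓ G)(z)(b_{t₁}, …, b_{t_ℓ})`, where `t₁, …, t_ℓ` are the trees
of `τ`. -/
def forestSum (G : Vec m → Lin n m) (z : Vec m) (b : Fin n × Forest n → Vec m)
    (g : Forest n → ℝ) (K : ℕ) (θ : ℝ) : Lin n m :=
  ∑ τ ∈ Forest.below n K,
    ((τ.symFactor : ℝ)⁻¹ * g τ * θ ^ τ.trees.card) • treeDeriv G z b τ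

/-- The `θ`-derivative of `forestSum`, when the base point moves with `θ`. The second sum arises
from the powers of `θ`: the factor `ℓ` counts the ways to write one of the trees of `τ` first. -/
theorem hasDerivAt_forestSum {G : Vec m → Lin n m} {K : ℕ} (hG : ContDiff ℝ (K + 1 : ℕ) G)
    (x w : Vec m) (b : Fin n × Forest n → Vec m) (g : Forest n → ℝ) (θ : ℝ) :
    HasDerivAt (fun θ => forestSum G (x + θ • w) b g (K + 1) θ)
      (∑ τ ∈ Forest.below n (K + 1),
          ((τ.symFactor : ℝ)⁻¹ * g τ * θ ^ τ.trees.card) • headDeriv G (x + θ • w) b τ w +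
        ∑ q ∈ Forest.splitsBelow n K,
          ((q.2.1.symFactor : ℝ)⁻¹ * (q.2.2.symFactor : ℝ)⁻¹) •
            (g (Forest.cons q.1 q.2.1 q.2.2) * θ ^ q.2.2.trees.card) •
              headDeriv G (x + θ • w) b q.2.2 (b (q.1, q.2.1))) θ := by
  have hcard : ∀ τ : Forest n, τ ∈ Forest.below n (K + 1) →
      ContDiff ℝ (τ.trees.card + 1 : ℕ) G := fun τ hτ => by
    have := Forest.card_trees_le τ
    rw [Forest.mem_below] at hτ
    exact hG.of_le (by norm_cast; omega)
  have h1 : ∀ τ ∈ Forest.below n (K + 1), HasDerivAt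
      (fun θ => ((τ.symFactor : ℝ)⁻¹ * g τ * θ ^ τ.trees.card) • treeDeriv G (x + θ • w) b τ)
      (((τ.symFactor : ℝ)⁻¹ * g τ * θ ^ τ.trees.card) • headDeriv G (x + θ • w) b τ w +
        ((τ.trees.card : ℝ) * (τ.symFactor : ℝ)⁻¹) • (g τ * θ ^ (τ.trees.card - 1)) •
          treeDeriv G (x + θ • w) b τ) θ := by
    intro τ hτ
    have h2 := ((hasDerivAt_pow τ.trees.card θ).const_mul ((τ.symFactor : ℝ)⁻¹ * g τ)).smul
      (hasDerivAt_treeDeriv (hcard τ hτ) x w b θ)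
    refine h2.congr_deriv ?_
    rw [smul_smul]
    congr 2
    ring
  have h2 := HasDerivAt.fun_sum h1
  rw [Finset.sum_add_distrib, Forest.sum_below_succ_card_trees K
    (fun τ => (g τ * θ ^ (τ.trees.card - 1)) • treeDeriv G (x + θ • w) b τ)] at h2
  refine h2.congr_deriv ?_
  congr 1
  refine Finset.sum_congr rfl fun q hq => ?_
  rw [Forest.mem_splitsBelow] at hq
  rw [treeDeriv_cons_eq_headDeriv (hcard q.2.2 (by rw [Forest.mem_below]; omega)),
    Forest.trees_cons, Multiset.card_cons, Nat.add_sub_cancel]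

theorem forestSum_zero {G : Vec m → Lin n m} (K : ℕ) (z : Vec m)
    (b : Fin n × Forest n → Vec m) (g : Forest n → ℝ) :
    forestSum G z b g (K + 1) 0 = g Forest.empty • G z := by
  rw [forestSum, Finset.sum_eq_single Forest.empty]
  · simp
  · intro τ _ hτ
    have : τ.trees.card ≠ 0 := fun h => hτ (Forest.eq_empty_of_trees_eq_zero
      (Multiset.card_eq_zero.1 h))
    rw [zero_pow this, mul_zero]
    exact zero_smul ℝ (treeDeriv G z b τ)
  · simp

end ForestSum

/-! ### Chen's relation and Taylor expansions -/

section ChenTaylor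

variable {m n : ℕ}

/-- The term `s(σ)⁻¹ f^σ(x) c^{[σ]}` of the Davie expansion at `x`. -/
def davieTerm (f : Vec m → Lin n m) (x : Vec m) (c : Fin n → Forest n → ℝ) (σ : Forest n) :
    Vec m :=
  (σ.symFactor : ℝ)⁻¹ • elemDiff f σ x (WithLp.toLp 2 fun i => c i σ)

/-- The Davie expansion at `x` with each term multiplied by `ϵ` to the number of vertices of its
tree. -/
def davieCurve (N : ℕ) (f : Vec m → Lin n m) (x : Vec m) (c : Fin n → Forest n → ℝ) (ϵ : ℝ) :
    Vec m :=
  ∑ σ ∈ Forest.below n N, ϵ ^ (σ.size + 1) • davieTerm f x c σ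

/-- The vector `ϵ^{|t|} f^σ_i(y)` attached to the tree `t = [σ]_i`. -/
def treeVec (f : Vec m → Lin n m) (y : Vec m) (ϵ : ℝ) (t : Fin n × Forest n) : Vec m :=
  ϵ ^ (t.2.size + 1) • elemDiff f t.2 y (EuclideanSpace.single t.1 (1 : ℝ))

theorem contDiff_davieCurve {k : ℕ} (N : ℕ) (f : Vec m → Lin n m) (x : Vec m)
    (c : Fin n → Forest n → ℝ) : ContDiff ℝ k (davieCurve N f x c) :=
  ContDiff.sum fun _ _ => (contDiff_id.pow _).smul contDiff_const

theorem treeOrder_treeVec {N : ℕ} {f : Vec m → Lin n m} (hf : ContDiff ℝ N f)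
    {y : ℝ → Vec m} (hy : Continuous y) : TreeOrder N (fun ϵ => treeVec f (y ϵ) ϵ) := by
  intro t ht
  have h1 : Continuous (fun ϵ => elemDiff f t.2 (y ϵ) (EuclideanSpace.single t.1 (1 : ℝ))) :=
    ((contDiff_elemDiff (k := 0) hf (by omega)).continuous.comp hy).clm_apply continuous_const
  simpa [treeVec] using (HasOrder.pow (t.2.size + 1)).smul (HasOrder.of_continuous h1)

theorem treeDeriv_treeVec {N : ℕ} {f : Vec m → Lin n m} (hf : ContDiff ℝ N f) {τ : Forest n}
    (hτ : τ.size ≤ N) (y : Vec m) (ϵ : ℝ) :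
    treeDeriv f y (treeVec f y ϵ) τ = ϵ ^ τ.size • elemDiff f τ y := by
  rw [elemDiff_eq_treeDeriv hf hτ, treeDeriv, treeDeriv, ← Forest.prod_trees_pow]
  have hl : ContDiff ℝ τ.trees.toList.length f :=
    hf.of_le (by simpa using (Forest.card_trees_le τ).trans hτ)
  refine (applyDeriv_map_smul τ.trees.toList hl y (fun t => ϵ ^ (t.2.size + 1)) _).trans ?_
  congr 1
  conv_rhs => rw [← Multiset.coe_toList τ.trees]
  rw [Multiset.map_coe, Multiset.prod_coe]

theorem forestSum_treeVec_one {N K : ℕ} {f : Vec m → Lin n m} (hf : ContDiff ℝ N f)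
    (hK : K ≤ N) (y : Vec m) (g : Forest n → ℝ) (ϵ : ℝ) :
    forestSum f y (treeVec f y ϵ) g K 1 =
      ∑ σ ∈ Forest.below n K,
        ((σ.symFactor : ℝ)⁻¹ * g σ * ϵ ^ σ.size) • elemDiff f σ y := by
  refine Finset.sum_congr rfl fun σ hσ => ?_
  rw [Forest.mem_below] at hσ
  rw [treeDeriv_treeVec hf (by omega), one_pow, mul_one, smul_smul]

theorem toLp_eq_sum (c : Fin n → ℝ) :
    (WithLp.toLp 2 c : Vec n) = ∑ i, c i • EuclideanSpace.single i (1 : ℝ) := by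
  simpa using ((EuclideanSpace.basisFun (Fin n) ℝ).sum_repr (WithLp.toLp 2 c)).symm

/-- The term of the `θ`-derivative of `forestSum` that corresponds to the decomposition
`τ = [σ]_i · ρ`. -/
def splitTerm (G : Vec m → Lin n m) (z : Vec m) (b : Fin n × Forest n → Vec m)
    (g : Forest n → ℝ) (θ : ℝ) (q : Fin n × Forest n × Forest n) : Lin n m :=
  ((q.2.1.symFactor : ℝ)⁻¹ * (q.2.2.symFactor : ℝ)⁻¹) •
    (g (Forest.cons q.1 q.2.1 q.2.2) * θ ^ q.2.2.trees.card) •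
      headDeriv G z b q.2.2 (b (q.1, q.2.1))

theorem hasDerivAt_forestSum_const {G : Vec m → Lin n m} {K : ℕ} (hG : ContDiff ℝ (K + 1 : ℕ) G)
    (x : Vec m) (b : Fin n × Forest n → Vec m) (g : Forest n → ℝ) (θ : ℝ) :
    HasDerivAt (fun θ => forestSum G x b g (K + 1) θ)
      (∑ q ∈ Forest.splitsBelow n K, splitTerm G x b g θ q) θ := by
  have h := hasDerivAt_forestSum hG x 0 b g θ
  simp only [smul_zero, add_zero] at h
  refine h.congr_deriv ?_
  rw [Finset.sum_eq_zero, zero_add]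
  · rfl
  · intro τ _
    rw [map_zero]
    exact smul_zero (M := ℝ) (A := Lin n m) _

theorem contDiff_of_size_le {K : ℕ} {G : Vec m → Lin n m} (hG : ContDiff ℝ (K + 1 : ℕ) G)
    {ρ : Forest n} (hρ : ρ.size ≤ K) : ContDiff ℝ (ρ.trees.card + 1 : ℕ) G :=
  hG.of_le (by exact_mod_cast Nat.succ_le_succ ((Forest.card_trees_le ρ).trans hρ))

/-- Up to terms of order `K + 1`, the constraint `|σ| + |ρ| < K` on the decompositions may be
relaxed to `|σ|, |ρ| < K`. -/
theorem hasOrder_sum_splitTerm {N K : ℕ} (hK : K ≤ N) {G : Vec m → Lin n m}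
    (hG : ContDiff ℝ (K + 1 : ℕ) G) {b : ℝ → Fin n × Forest n → Vec m} (hb : TreeOrder N b)
    {w : ℝ → Vec m} (hw : Continuous w) (x : Vec m) (g : Forest n → ℝ) :
    HasOrder (K + 1) (fun θ ϵ =>
      ∑ q ∈ Finset.univ ×ˢ Forest.below n K ×ˢ Forest.below n K,
        splitTerm G (x + θ • w ϵ) (b ϵ) g θ q -
      ∑ q ∈ Forest.splitsBelow n K, splitTerm G (x + θ • w ϵ) (b ϵ) g θ q) := by
  have he : ∀ θ ϵ, ∑ q ∈ (Finset.univ ×ˢ Forest.below n K ×ˢ Forest.below n K) with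
      ¬ q.2.1.size + q.2.2.size < K, splitTerm G (x + θ • w ϵ) (b ϵ) g θ q =
      ∑ q ∈ Finset.univ ×ˢ Forest.below n K ×ˢ Forest.below n K,
        splitTerm G (x + θ • w ϵ) (b ϵ) g θ q -
      ∑ q ∈ Forest.splitsBelow n K, splitTerm G (x + θ • w ϵ) (b ϵ) g θ q := by
    intro θ ϵ
    rw [← Finset.sum_filter_add_sum_filter_not (Finset.univ ×ˢ _ ×ˢ _)
      (fun q : Fin n × Forest n × Forest n => q.2.1.size + q.2.2.size < K), Forest.splitsBelow,
      add_sub_cancel_left]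
  refine HasOrder.congr (HasOrder.sum fun q hq => ?_) he
  simp only [Finset.mem_filter, Finset.mem_product, Finset.mem_univ, Forest.mem_below,
    true_and] at hq
  obtain ⟨⟨h1, h2⟩, h3⟩ := hq
  have hh := (hasOrder_headDeriv hb hw x (by omega : q.2.2.size ≤ N)
    (contDiff_of_size_le hG h2.le)).clm_apply (hb (q.1, q.2.1) (by simp only; omega))
  have := (HasOrder.const ((q.2.1.symFactor : ℝ)⁻¹ * (q.2.2.symFactor : ℝ)⁻¹)).smul
    ((HasOrder.const_mul_pow_left (g (Forest.cons q.1 q.2.1 q.2.2)) q.2.2.trees.card).smul hh)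
  exact this.mono (by simp only; omega)

/-- The contribution of the decompositions with `[σ]_i = t` to the recursion of the coproduct. -/
def splitCoeff (c : Fin n → Forest n → ℝ) (g : Forest n → ℝ) (t : Fin n × Forest n)
    (ρ : Forest n) : ℝ :=
  c t.1 t.2 * g ρ + Forest.coproductSum c (fun κ => g (Forest.cons t.1 κ ρ)) t.2

/-- The recursion of the coproduct turns the split terms at `x` into expansions of the derivatives
of `G` in the directions `f^σ_i(x)`. -/
theorem sum_splitTerm_treeVec {K : ℕ} (f : Vec m → Lin n m) {G : Vec m → Lin n m}
    (hG : ContDiff ℝ (K + 1 : ℕ) G) (x : Vec m) (c : Fin n → Forest n → ℝ) (g : Forest n → ℝ)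
    (θ ϵ : ℝ) :
    ∑ q ∈ Finset.univ ×ˢ Forest.below n K ×ˢ Forest.below n K,
        splitTerm G x (treeVec f x ϵ) (Forest.coproductSum c g) θ q =
      ∑ t ∈ Finset.univ ×ˢ Forest.below n K, ((t.2.symFactor : ℝ)⁻¹ * ϵ ^ (t.2.size + 1)) •
        forestSum (fun z => fderiv ℝ G z (elemDiff f t.2 x (EuclideanSpace.single t.1 (1 : ℝ)))) x
          (treeVec f x ϵ) (Forest.coproductSum c (splitCoeff c g t)) K θ := by
  rw [Finset.sum_product, Finset.sum_product]
  refine Finset.sum_congr rfl fun i _ => ?_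
  rw [Finset.sum_product]
  refine Finset.sum_congr rfl fun σ _ => ?_
  rw [forestSum, Finset.smul_sum]
  refine Finset.sum_congr rfl fun ρ hρ => ?_
  rw [Forest.mem_below] at hρ
  rw [treeDeriv_fderiv_eq_headDeriv _ (contDiff_of_size_le hG hρ.le), splitTerm,
    Forest.coproductSum_cons]
  change _ = _ • (_ * Forest.coproductSum c (fun b => c i σ * g b +
    Forest.coproductSum c (fun a => g (Forest.cons i a b)) σ) ρ * _) • _
  simp only [treeVec, map_smul, smul_smul]
  congr 1
  ring

theorem sum_smul_forestSum_fderiv {K : ℕ} (f : Vec m → Lin n m) {G : Vec m → Lin n m}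
    (hG : ContDiff ℝ (K + 1 : ℕ) G) (x z : Vec m) (b : Fin n × Forest n → Vec m)
    (h : Fin n × Forest n → Forest n → ℝ) (θ ϵ : ℝ) :
    ∑ t ∈ Finset.univ ×ˢ Forest.below n K, ((t.2.symFactor : ℝ)⁻¹ * ϵ ^ (t.2.size + 1)) •
        forestSum (fun z => fderiv ℝ G z (elemDiff f t.2 x (EuclideanSpace.single t.1 (1 : ℝ)))) z
          b (h t) K θ =
      ∑ ρ ∈ Forest.below n K, ((ρ.symFactor : ℝ)⁻¹ * θ ^ ρ.trees.card) • headDeriv G z b ρ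
        (∑ t ∈ Finset.univ ×ˢ Forest.below n K,
          ((t.2.symFactor : ℝ)⁻¹ * ϵ ^ (t.2.size + 1) * h t ρ) •
            elemDiff f t.2 x (EuclideanSpace.single t.1 (1 : ℝ))) := by
  simp only [forestSum, Finset.smul_sum]
  rw [Finset.sum_comm]
  refine Finset.sum_congr rfl fun ρ hρ => ?_
  rw [Forest.mem_below] at hρ
  rw [map_sum, Finset.smul_sum]
  refine Finset.sum_congr rfl fun t _ => ?_
  rw [treeDeriv_fderiv_eq_headDeriv _ (contDiff_of_size_le hG hρ.le), map_smul, smul_smul,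
    smul_smul]
  congr 1
  ring

theorem sum_headDeriv_add_sum_splitTerm {K : ℕ} (G : Vec m → Lin n m) (z w : Vec m)
    (b : Fin n × Forest n → Vec m) (g : Forest n → ℝ) (θ : ℝ) :
    ∑ τ ∈ Forest.below n K,
          ((τ.symFactor : ℝ)⁻¹ * g τ * θ ^ τ.trees.card) • headDeriv G z b τ w +
        ∑ q ∈ Finset.univ ×ˢ Forest.below n K ×ˢ Forest.below n K, splitTerm G z b g θ q =
      ∑ ρ ∈ Forest.below n K, ((ρ.symFactor : ℝ)⁻¹ * θ ^ ρ.trees.card) • headDeriv G z b ρ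
        (g ρ • w + ∑ t ∈ Finset.univ ×ˢ Forest.below n K,
          ((t.2.symFactor : ℝ)⁻¹ * g (Forest.cons t.1 t.2 ρ)) • b t) := by
  have h1 : ∑ q ∈ Finset.univ ×ˢ Forest.below n K ×ˢ Forest.below n K, splitTerm G z b g θ q =
      ∑ ρ ∈ Forest.below n K, ∑ t ∈ Finset.univ ×ˢ Forest.below n K,
        splitTerm G z b g θ (t.1, t.2, ρ) := by
    rw [Finset.sum_comm, Finset.sum_product, Finset.sum_product]
    refine Finset.sum_congr rfl fun i _ => ?_
    rw [Finset.sum_product]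
  rw [h1, ← Finset.sum_add_distrib]
  refine Finset.sum_congr rfl fun ρ _ => ?_
  rw [map_add, smul_add, map_smul, smul_smul, map_sum, Finset.smul_sum]
  congr 1
  · congr 1
    ring
  · refine Finset.sum_congr rfl fun t _ => ?_
    rw [splitTerm, map_smul, smul_smul, smul_smul]
    congr 1
    ring

theorem sum_davieTerm {K : ℕ} (f : Vec m → Lin n m) (x : Vec m) (c : Fin n → Forest n → ℝ)
    (ϵ : ℝ) :
    ∑ t ∈ Finset.univ ×ˢ Forest.below n K,
        ((t.2.symFactor : ℝ)⁻¹ * ϵ ^ (t.2.size + 1) * c t.1 t.2) •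
          elemDiff f t.2 x (EuclideanSpace.single t.1 (1 : ℝ)) =
      davieCurve K f x c ϵ := by
  rw [Finset.sum_product_right, davieCurve]
  refine Finset.sum_congr rfl fun σ _ => ?_
  rw [davieTerm, toLp_eq_sum, map_sum, Finset.smul_sum, Finset.smul_sum]
  refine Finset.sum_congr rfl fun i _ => ?_
  rw [map_smul, smul_smul, smul_smul]
  congr 1
  ring

theorem hasOrder_davieCurve_sub {K N : ℕ} (hK : K ≤ N) (f : Vec m → Lin n m) (x : Vec m)
    (c : Fin n → Forest n → ℝ) :
    HasOrder (K + 1) (fun _ ϵ => davieCurve N f x c ϵ - davieCurve K f x c ϵ) := by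
  have hsub : Forest.below n K ⊆ Forest.below n N := fun τ hτ => by
    rw [Forest.mem_below] at hτ ⊢
    omega
  refine HasOrder.congr (HasOrder.sum (s := Forest.below n N \ Forest.below n K) fun σ hσ => ?_)
    fun _ ϵ => eq_sub_of_add_eq (Finset.sum_sdiff hsub)
  simp only [Finset.mem_sdiff, Forest.mem_below] at hσ
  exact ((HasOrder.pow (σ.size + 1)).smul (HasOrder.const (davieTerm f x c σ))).mono (by omega)

/-- The two arguments of the head derivatives in the recursions for both sides of
`hasOrder_forestSum_sub` agree up to order `K + 1`. -/
theorem hasOrder_head_sub {N K : ℕ} (hK : K ≤ N) {f : Vec m → Lin n m} (hf : ContDiff ℝ N f)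
    (x : Vec m) (c : Fin n → Forest n → ℝ) (g : Forest n → ℝ) (ρ : Forest n)
    (ih : ∀ g : Forest n → ℝ, HasOrder K (fun θ ϵ =>
      forestSum f x (treeVec f x ϵ) (Forest.coproductSum c g) K θ -
      forestSum f (x + θ • davieCurve N f x c ϵ) (treeVec f (x + davieCurve N f x c ϵ) ϵ) g K θ)) :
    HasOrder (K + 1) (fun _ ϵ =>
      (g ρ • davieCurve N f x c ϵ + ∑ t ∈ Finset.univ ×ˢ Forest.below n K,
          ((t.2.symFactor : ℝ)⁻¹ * g (Forest.cons t.1 t.2 ρ)) •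
            treeVec f (x + davieCurve N f x c ϵ) ϵ t) -
      ∑ t ∈ Finset.univ ×ˢ Forest.below n K,
          ((t.2.symFactor : ℝ)⁻¹ * ϵ ^ (t.2.size + 1) * splitCoeff c g t ρ) •
            elemDiff f t.2 x (EuclideanSpace.single t.1 (1 : ℝ))) := by
  have h1 : HasOrder (K + 1) (fun _ ϵ =>
      g ρ • (davieCurve N f x c ϵ - davieCurve K f x c ϵ)) := by
    simpa using (HasOrder.const (g ρ)).smul (hasOrder_davieCurve_sub hK f x c)
  have h2 : ∀ i : Fin n, HasOrder (K + 1) (fun _ ϵ : ℝ => ϵ •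
      (forestSum f x (treeVec f x ϵ) (Forest.coproductSum c fun κ => g (Forest.cons i κ ρ)) K 1 -
      forestSum f (x + davieCurve N f x c ϵ) (treeVec f (x + davieCurve N f x c ϵ) ϵ)
        (fun κ => g (Forest.cons i κ ρ)) K 1) (EuclideanSpace.single i (1 : ℝ))) := by
    intro i
    obtain ⟨C, hC⟩ := ih fun κ => g (Forest.cons i κ ρ)
    have h3 : HasOrder K (fun _ ϵ : ℝ =>
      forestSum f x (treeVec f x ϵ) (Forest.coproductSum c fun κ => g (Forest.cons i κ ρ)) K 1 -
      forestSum f (x + davieCurve N f x c ϵ) (treeVec f (x + davieCurve N f x c ϵ) ϵ)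
        (fun κ => g (Forest.cons i κ ρ)) K 1) :=
      ⟨C, fun _ _ ϵ hϵ => by simpa using hC 1 (by simp) ϵ hϵ⟩
    have h4 := (HasOrder.pow 1).smul (h3.clm_apply
      (HasOrder.const (EuclideanSpace.single i (1 : ℝ) : Vec n)))
    simp only [pow_one] at h4
    exact h4.mono (by omega)
  refine HasOrder.congr (h1.sub (HasOrder.sum (s := Finset.univ) fun i _ => h2 i)) fun _ ϵ => ?_
  simp only [splitCoeff, mul_add, add_smul, Finset.sum_add_distrib]
  have e1 : ∑ t ∈ Finset.univ ×ˢ Forest.below n K,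
      ((t.2.symFactor : ℝ)⁻¹ * ϵ ^ (t.2.size + 1) * (c t.1 t.2 * g ρ)) •
        elemDiff f t.2 x (EuclideanSpace.single t.1 (1 : ℝ)) = g ρ • davieCurve K f x c ϵ := by
    rw [← sum_davieTerm, Finset.smul_sum]
    refine Finset.sum_congr rfl fun t _ => ?_
    rw [smul_smul]
    congr 1
    ring
  have e2 : ∑ t ∈ Finset.univ ×ˢ Forest.below n K, ((t.2.symFactor : ℝ)⁻¹ * ϵ ^ (t.2.size + 1) *
        Forest.coproductSum c (fun κ => g (Forest.cons t.1 κ ρ)) t.2) •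
        elemDiff f t.2 x (EuclideanSpace.single t.1 (1 : ℝ)) =
      ∑ i, ϵ • forestSum f x (treeVec f x ϵ)
        (Forest.coproductSum c fun κ => g (Forest.cons i κ ρ)) K 1
          (EuclideanSpace.single i (1 : ℝ)) := by
    rw [Finset.sum_product]
    refine Finset.sum_congr rfl fun i _ => ?_
    rw [forestSum_treeVec_one hf hK, sum_apply, Finset.smul_sum]
    refine Finset.sum_congr rfl fun σ _ => ?_
    rw [smul_apply, smul_smul]
    congr 1
    ring
  have e3 : ∑ t ∈ Finset.univ ×ˢ Forest.below n K,
        ((t.2.symFactor : ℝ)⁻¹ * g (Forest.cons t.1 t.2 ρ)) •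
          treeVec f (x + davieCurve N f x c ϵ) ϵ t =
      ∑ i, ϵ • forestSum f (x + davieCurve N f x c ϵ) (treeVec f (x + davieCurve N f x c ϵ) ϵ)
        (fun κ => g (Forest.cons i κ ρ)) K 1 (EuclideanSpace.single i (1 : ℝ)) := by
    rw [Finset.sum_product]
    refine Finset.sum_congr rfl fun i _ => ?_
    rw [forestSum_treeVec_one hf hK, sum_apply, Finset.smul_sum]
    refine Finset.sum_congr rfl fun σ _ => ?_
    rw [smul_apply, smul_smul, treeVec, smul_smul]
    congr 1
    ring
  simp only [sub_apply, smul_sub, Finset.sum_sub_distrib]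
  rw [e1, e2, e3]
  abel

/-- The Davie expansion of `G` at `x`, with coefficients recombined through the coproduct, agrees
up to terms of order `K` with the expansion of `G` at the point of the Davie curve. -/
theorem hasOrder_forestSum_sub {N K : ℕ} (hK : K ≤ N) {f : Vec m → Lin n m}
    (hf : ContDiff ℝ N f) (x : Vec m) (c : Fin n → Forest n → ℝ) {G : Vec m → Lin n m}
    (hG : ContDiff ℝ K G) (g : Forest n → ℝ) :
    HasOrder K (fun θ ϵ =>
      forestSum G x (treeVec f x ϵ) (Forest.coproductSum c g) K θ -
      forestSum G (x + θ • davieCurve N f x c ϵ) (treeVec f (x + davieCurve N f x c ϵ) ϵ)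
        g K θ) := by
  induction K generalizing G g with
  | zero =>
      refine HasOrder.congr HasOrder.zero fun θ ϵ => ?_
      have : Forest.below n 0 = ∅ := by
        ext τ
        simp
      simp [forestSum, this]
  | succ K ih =>
      have hw : Continuous (davieCurve N f x c) := (contDiff_davieCurve (k := 0) N f x c).continuous
      have hy : Continuous fun ϵ => x + davieCurve N f x c ϵ := continuous_const.add hw
      have hb := treeOrder_treeVec hf hy
      have ha := treeOrder_treeVec hf (continuous_const : Continuous fun _ : ℝ => x)
      -- both sides agree at `θ = 0`, so it suffices to compare the `θ`-derivatives
      refine HasOrder.of_hasDerivAt (fun ϵ => ?_) (fun θ ϵ => ?_)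
        (A' := fun θ ϵ => ∑ q ∈ Forest.splitsBelow n K,
            splitTerm G x (treeVec f x ϵ) (Forest.coproductSum c g) θ q -
          (∑ τ ∈ Forest.below n (K + 1), ((τ.symFactor : ℝ)⁻¹ * g τ * θ ^ τ.trees.card) •
              headDeriv G (x + θ • davieCurve N f x c ϵ)
                (treeVec f (x + davieCurve N f x c ϵ) ϵ) τ (davieCurve N f x c ϵ) +
            ∑ q ∈ Forest.splitsBelow n K, splitTerm G (x + θ • davieCurve N f x c ϵ)
              (treeVec f (x + davieCurve N f x c ϵ) ϵ) g θ q)) ?_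
      · rw [forestSum_zero, forestSum_zero, zero_smul, add_zero, Forest.coproductSum_empty,
          sub_self]
      · exact (hasDerivAt_forestSum_const hG x _ _ θ).sub (hasDerivAt_forestSum hG x _ _ g θ)
      · have o1 := hasOrder_sum_splitTerm (by omega : K ≤ N) hG hb hw x g
        have o2 := hasOrder_sum_splitTerm (by omega : K ≤ N) hG ha
          (continuous_const : Continuous fun _ : ℝ => (0 : Vec m)) x (Forest.coproductSum c g)
        simp only [smul_zero, add_zero] at o2
        have o3 : HasOrder (K + 1) (fun θ ϵ =>
            ∑ τ ∈ Forest.below n (K + 1) \ Forest.below n K,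
              ((τ.symFactor : ℝ)⁻¹ * g τ * θ ^ τ.trees.card) •
                headDeriv G (x + θ • davieCurve N f x c ϵ)
                  (treeVec f (x + davieCurve N f x c ϵ) ϵ) τ (davieCurve N f x c ϵ)) := by
          refine HasOrder.sum fun τ hτ => ?_
          simp only [Finset.mem_sdiff, Forest.mem_below] at hτ
          have hw1 : HasOrder 1 (fun _ ϵ => davieCurve N f x c ϵ) :=
            HasOrder.sum fun σ _ => ((HasOrder.pow (σ.size + 1)).smul
              (HasOrder.const (davieTerm f x c σ))).mono (by omega)
          have := (HasOrder.const_mul_pow_left ((τ.symFactor : ℝ)⁻¹ * g τ) τ.trees.card).smul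
            ((hasOrder_headDeriv hb hw x (by omega : τ.size ≤ N)
              (contDiff_of_size_le hG (by omega))).clm_apply hw1)
          exact this.mono (by omega)
        -- the induction hypothesis for the derivatives of `G` in the directions `f^σ_i(x)`
        have o4 : HasOrder (K + 1) (fun θ ϵ => ∑ t ∈ Finset.univ ×ˢ Forest.below n K,
            ((t.2.symFactor : ℝ)⁻¹ * ϵ ^ (t.2.size + 1)) •
              (forestSum (fun z => fderiv ℝ G z
                  (elemDiff f t.2 x (EuclideanSpace.single t.1 (1 : ℝ)))) x (treeVec f x ϵ)
                  (Forest.coproductSum c (splitCoeff c g t)) K θ -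
                forestSum (fun z => fderiv ℝ G z
                  (elemDiff f t.2 x (EuclideanSpace.single t.1 (1 : ℝ))))
                  (x + θ • davieCurve N f x c ϵ) (treeVec f (x + davieCurve N f x c ϵ) ϵ)
                  (splitCoeff c g t) K θ)) := by
          refine HasOrder.sum fun t _ => ?_
          have h1 := (HasOrder.const ((t.2.symFactor : ℝ)⁻¹)).smul (HasOrder.pow (t.2.size + 1))
          exact (h1.smul (ih (by omega) (contDiff_fderiv_apply hG _)
            (splitCoeff c g t))).mono (by omega)
        -- the induction hypothesis for `f` itself, at `θ = 1`
        have o5 : HasOrder (K + 1) (fun θ ϵ => ∑ ρ ∈ Forest.below n K,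
            ((ρ.symFactor : ℝ)⁻¹ * θ ^ ρ.trees.card) •
              headDeriv G (x + θ • davieCurve N f x c ϵ)
                (treeVec f (x + davieCurve N f x c ϵ) ϵ) ρ
              ((g ρ • davieCurve N f x c ϵ + ∑ t ∈ Finset.univ ×ˢ Forest.below n K,
                  ((t.2.symFactor : ℝ)⁻¹ * g (Forest.cons t.1 t.2 ρ)) •
                    treeVec f (x + davieCurve N f x c ϵ) ϵ t) -
                ∑ t ∈ Finset.univ ×ˢ Forest.below n K,
                  ((t.2.symFactor : ℝ)⁻¹ * ϵ ^ (t.2.size + 1) * splitCoeff c g t ρ) •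
                    elemDiff f t.2 x (EuclideanSpace.single t.1 (1 : ℝ)))) := by
          refine HasOrder.sum fun ρ hρ => ?_
          rw [Forest.mem_below] at hρ
          have := (HasOrder.const_mul_pow_left ((ρ.symFactor : ℝ)⁻¹) ρ.trees.card).smul
            ((hasOrder_headDeriv hb hw x (by omega : ρ.size ≤ N)
              (contDiff_of_size_le hG hρ.le)).clm_apply
              (hasOrder_head_sub (by omega : K ≤ N) hf x c g ρ
                fun g => ih (by omega) (hf.of_le (by exact_mod_cast (by omega : K ≤ N))) g))
          exact this.mono (by omega)
        refine HasOrder.congr (((o4.sub o5).sub o2).add (o1.sub o3)) fun θ ϵ => ?_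
        simp only [smul_sub, map_sub, Finset.sum_sub_distrib]
        rw [← sum_splitTerm_treeVec f hG, sum_smul_forestSum_fderiv f hG,
          ← sum_headDeriv_add_sum_splitTerm]
        have hsub : Forest.below n K ⊆ Forest.below n (K + 1) := fun τ hτ => by
          rw [Forest.mem_below] at hτ ⊢
          omega
        rw [← Finset.sum_sdiff hsub]
        abel

end ChenTaylor

/-! ### Taylor polynomials along the Davie curve -/

section DavieTaylor

variable {m n : ℕ}

/-- The Taylor polynomial of degree less than `N - |τ|` at `ϵ = 0` of the values of `f^τ` along the
Davie curve, evaluated at `ϵ`. -/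
def davieTaylor (N : ℕ) (f : Vec m → Lin n m) (x : Vec m) (c : Fin n → Forest n → ℝ)
    (τ : Forest n) (ϵ : ℝ) : Lin n m :=
  taylorWithinEval (fun ϵ => elemDiff f τ (x + davieCurve N f x c ϵ)) (N - 1 - τ.size)
    (Set.Icc 0 1) 0 ϵ

theorem contDiff_elemDiff_davieCurve {N : ℕ} {f : Vec m → Lin n m} (hf : ContDiff ℝ N f)
    (x : Vec m) (c : Fin n → Forest n → ℝ) {τ : Forest n} (hτ : τ.size < N) :
    ContDiff ℝ (N - 1 - τ.size + 1 : ℕ) (fun ϵ => elemDiff f τ (x + davieCurve N f x c ϵ)) :=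
  (contDiff_elemDiff hf (by omega)).comp (contDiff_const.add (contDiff_davieCurve N f x c))

theorem norm_sub_davieTaylor_le {N : ℕ} {f : Vec m → Lin n m} (hf : ContDiff ℝ N f)
    (x : Vec m) (c : Fin n → Forest n → ℝ) {τ : Forest n} (hτ : τ.size < N) {C : ℝ}
    (hC : ∀ ϵ ∈ Set.Icc (0 : ℝ) 1,
      ‖iteratedDeriv (N - τ.size) (fun ϵ => elemDiff f τ (x + davieCurve N f x c ϵ)) ϵ‖ ≤ C)
    {ϵ : ℝ} (hϵ : ϵ ∈ Set.Icc (0 : ℝ) 1) :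
    ‖elemDiff f τ (x + davieCurve N f x c ϵ) - davieTaylor N f x c τ ϵ‖ ≤
      C * ϵ ^ (N - τ.size) := by
  have hk : N - τ.size = N - 1 - τ.size + 1 := by omega
  have hcd := contDiff_elemDiff_davieCurve hf x c hτ
  have hC0 : 0 ≤ C := (norm_nonneg _).trans (hC 0 (by simp))
  have h := taylor_mean_remainder_bound (n := N - 1 - τ.size) (zero_le_one (α := ℝ))
    (f := fun ϵ => elemDiff f τ (x + davieCurve N f x c ϵ)) (by exact_mod_cast hcd.contDiffOn)
    hϵ (C := C) (fun ϵ hϵ => by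
      rw [iteratedDerivWithin_eq_iteratedDeriv (uniqueDiffOn_Icc zero_lt_one)
        hcd.contDiffAt hϵ, ← hk]
      exact hC ϵ hϵ)
  rw [sub_zero, ← hk] at h
  exact h.trans (div_le_self (mul_nonneg hC0 (pow_nonneg hϵ.1 _))
    (by exact_mod_cast Nat.one_le_iff_ne_zero.2 (Nat.factorial_ne_zero _)))

theorem isPolyLT_davieTaylor {N : ℕ} (f : Vec m → Lin n m)
    (x : Vec m) (c : Fin n → Forest n → ℝ) {τ : Forest n} (hτ : τ.size < N) (r : ℝ) :
    IsPolyLT N (fun ϵ => (r * ϵ ^ τ.size) • davieTaylor N f x c τ ϵ) := by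
  have h : (fun ϵ => (r * ϵ ^ τ.size) • davieTaylor N f x c τ ϵ) = fun ϵ =>
      ∑ k ∈ Finset.range (N - 1 - τ.size + 1), ϵ ^ (τ.size + k) • ((r * (k.factorial : ℝ)⁻¹) •
        iteratedDerivWithin k (fun ϵ => elemDiff f τ (x + davieCurve N f x c ϵ))
          (Set.Icc 0 1) 0) := by
    funext ϵ
    rw [davieTaylor, taylor_within_apply, Finset.smul_sum]
    refine Finset.sum_congr rfl fun k _ => ?_
    rw [smul_smul, smul_smul, sub_zero]
    congr 1
    ring
  rw [h]
  refine IsPolyLT.sum fun k hk => IsPolyLT.pow_smul ?_ _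
  rw [Finset.mem_range] at hk
  omega

/-- The algebraic identity behind the sewing argument. In the sum over forests obtained by Chen's
relation, the coefficient of `g(τ)` is the Taylor polynomial of `f^τ` along the Davie curve. -/
theorem sum_coproductSum_eq_sum_davieTaylor {N : ℕ} {f : Vec m → Lin n m} (hf : ContDiff ℝ N f)
    (x : Vec m) (c : Fin n → Forest n → ℝ) (g : Forest n → ℝ) :
    ∑ κ ∈ Forest.below n N,
        ((κ.symFactor : ℝ)⁻¹ * Forest.coproductSum c g κ) • elemDiff f κ x =
      ∑ τ ∈ Forest.below n N, ((τ.symFactor : ℝ)⁻¹ * g τ) • davieTaylor N f x c τ 1 := by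
  set P : ℝ → Lin n m := fun ϵ =>
    ∑ κ ∈ Forest.below n N,
        ((κ.symFactor : ℝ)⁻¹ * Forest.coproductSum c g κ * ϵ ^ κ.size) • elemDiff f κ x +
      -∑ τ ∈ Forest.below n N, ((τ.symFactor : ℝ)⁻¹ * g τ * ϵ ^ τ.size) •
        davieTaylor N f x c τ ϵ with hP
  have hpoly : IsPolyLT N P := by
    refine IsPolyLT.add (IsPolyLT.sum fun κ hκ => ?_)
      (IsPolyLT.neg (IsPolyLT.sum fun τ hτ => ?_))
    · have := IsPolyLT.pow_smul (Forest.mem_below.1 hκ)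
        (((κ.symFactor : ℝ)⁻¹ * Forest.coproductSum c g κ) • elemDiff f κ x)
      simpa only [smul_smul, mul_comm] using this
    · exact isPolyLT_davieTaylor f x c (Forest.mem_below.1 hτ) _
  -- `P` vanishes to order `N` at `ϵ = 0` and has degree less than `N`
  have horder : HasOrder N (fun _ ϵ => P ϵ) := by
    obtain ⟨C, hC⟩ := hasOrder_forestSum_sub le_rfl hf x c hf g
    have h1 : HasOrder N (fun _ ϵ => forestSum f x (treeVec f x ϵ) (Forest.coproductSum c g) N 1 -
        forestSum f (x + davieCurve N f x c ϵ) (treeVec f (x + davieCurve N f x c ϵ) ϵ) g N 1) :=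
      ⟨C, fun _ _ ϵ hϵ => by simpa using hC 1 (by simp) ϵ hϵ⟩
    have h2 : HasOrder N (fun _ ϵ => ∑ τ ∈ Forest.below n N,
        ((τ.symFactor : ℝ)⁻¹ * g τ) • ϵ ^ τ.size •
          (elemDiff f τ (x + davieCurve N f x c ϵ) - davieTaylor N f x c τ ϵ)) := by
      refine HasOrder.sum fun τ hτ => ?_
      rw [Forest.mem_below] at hτ
      have hcont := (contDiff_elemDiff_davieCurve hf x c hτ).continuous_iteratedDeriv
        (N - τ.size) (by norm_cast; omega)
      obtain ⟨C', hC'⟩ := (isCompact_Icc (a := (0 : ℝ)) (b := 1)).exists_bound_of_continuousOn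
        hcont.continuousOn
      have h3 : HasOrder (N - τ.size) (fun _ ϵ =>
          elemDiff f τ (x + davieCurve N f x c ϵ) - davieTaylor N f x c τ ϵ) :=
        ⟨C', fun _ _ ϵ hϵ => norm_sub_davieTaylor_le hf x c hτ hC' hϵ⟩
      exact ((HasOrder.const ((τ.symFactor : ℝ)⁻¹ * g τ)).smul
        ((HasOrder.pow τ.size).smul h3)).mono (by omega)
    refine HasOrder.congr (h1.add h2) fun _ ϵ => ?_
    rw [forestSum_treeVec_one hf le_rfl, forestSum_treeVec_one hf le_rfl, hP]
    simp only [smul_sub, Finset.sum_sub_distrib, smul_smul]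
    abel
  obtain ⟨d, hd⟩ := hpoly
  obtain ⟨C, hC⟩ := horder
  have hd0 := eq_zero_of_norm_sum_pow_le (d := d) (N := N) (C := C) fun ϵ hϵ => by
    rw [← hd]
    exact hC 0 (by simp) ϵ ⟨hϵ.1.le, hϵ.2⟩
  have h1 : P 1 = 0 := by
    rw [hd]
    refine Finset.sum_eq_zero fun k hk => ?_
    rw [hd0 k (Finset.mem_range.1 hk)]
    exact smul_zero (M := ℝ) (A := Lin n m) _
  simp only [hP, one_pow, mul_one] at h1
  exact add_neg_eq_zero.1 h1

theorem norm_iteratedDeriv_davieCurve_le {N : ℕ} (f : Vec m → Lin n m) (x : Vec m)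
    (c : Fin n → Forest n → ℝ) {S r : ℝ} (hS : 0 ≤ S) (hr0 : 0 ≤ r) (hr1 : r ≤ 1)
    (h : ∀ σ ∈ Forest.below n N, ‖davieTerm f x c σ‖ ≤ S * r ^ (σ.size + 1)) (i : ℕ) {ϵ : ℝ}
    (hϵ : ϵ ∈ Set.Icc (0 : ℝ) 1) :
    ‖iteratedDeriv i (davieCurve N f x c) ϵ‖ ≤
      ((Forest.below n N).card * N.factorial : ℝ) * (S * r ^ i) := by
  have h1 : iteratedDeriv i (davieCurve N f x c) ϵ = ∑ σ ∈ Forest.below n N,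
      (((σ.size + 1).descFactorial i : ℝ) * ϵ ^ (σ.size + 1 - i)) • davieTerm f x c σ := by
    refine (iteratedDeriv_fun_sum fun σ _ =>
      ((contDiff_id.pow _).smul contDiff_const).contDiffAt).trans ?_
    refine Finset.sum_congr rfl fun σ _ => ?_
    refine (iteratedDeriv_smul_const (f := fun ϵ : ℝ => ϵ ^ (σ.size + 1))
      (contDiff_id.pow _).contDiffAt _).trans ?_
    rw [iteratedDeriv_pow]
  rw [h1, mul_assoc, ← nsmul_eq_mul]
  refine (norm_sum_le _ _).trans (Finset.sum_le_card_nsmul _ _ _ fun σ hσ => ?_)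
  have hσ' := Forest.mem_below.1 hσ
  rw [norm_smul, norm_mul, norm_pow, Real.norm_of_nonneg hϵ.1, Real.norm_of_nonneg (by positivity)]
  rcases lt_or_ge (σ.size + 1) i with hi | hi
  · rw [Nat.descFactorial_eq_zero_iff_lt.2 hi]
    simp only [Nat.cast_zero, zero_mul]
    positivity
  · have e1 : ((σ.size + 1).descFactorial i : ℝ) ≤ N.factorial := by
      have := Nat.factorial_mul_descFactorial hi
      have h3 : (σ.size + 1).descFactorial i ≤ (σ.size + 1).factorial := by
        rw [← this]
        exact Nat.le_mul_of_pos_left _ (Nat.factorial_pos _)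
      exact_mod_cast h3.trans (Nat.factorial_le (by omega))
    have e2 : ϵ ^ (σ.size + 1 - i) ≤ 1 := pow_le_one₀ hϵ.1 hϵ.2
    have e3 : r ^ (σ.size + 1) ≤ r ^ i := pow_le_pow_of_le_one hr0 hr1 hi
    calc ((σ.size + 1).descFactorial i : ℝ) * ϵ ^ (σ.size + 1 - i) * ‖davieTerm f x c σ‖
        ≤ (N.factorial * 1) * (S * r ^ i) := by
          refine mul_le_mul (mul_le_mul e1 e2 (pow_nonneg hϵ.1 _) (by positivity))
            ((h σ hσ).trans (mul_le_mul_of_nonneg_left e3 hS)) (norm_nonneg _) (by positivity)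
      _ = _ := by ring

/-- The distance from `f^τ` along the Davie curve to its Taylor polynomial, in terms of bounds for
the derivatives of `f^τ` near `x` and for the terms of the Davie expansion. -/
theorem norm_sub_davieTaylor_one_le {N : ℕ} {f : Vec m → Lin n m} (hf : ContDiff ℝ N f)
    (x : Vec m) (c : Fin n → Forest n → ℝ) {τ : Forest n} (hτ : τ.size < N) {S r A : ℝ}
    (hS : 0 < S) (hr0 : 0 ≤ r) (hr1 : r ≤ 1)
    (h : ∀ σ ∈ Forest.below n N, ‖davieTerm f x c σ‖ ≤ S * r ^ (σ.size + 1))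
    (hA : ∀ ℓ, 1 ≤ ℓ → τ.size + ℓ ≤ N → ∀ y, ‖y - x‖ ≤ (Forest.below n N).card * N.factorial * S →
      ‖iteratedFDeriv ℝ ℓ (elemDiff f τ) y‖ * S ^ ℓ ≤ A) :
    ‖elemDiff f τ (x + davieCurve N f x c 1) - davieTaylor N f x c τ 1‖ ≤
      N.factorial * A * (((Forest.below n N).card * N.factorial : ℝ) ^ N * r ^ (N - τ.size)) := by
  set W : ℝ := (Forest.below n N).card * N.factorial with hW
  have hW1 : 1 ≤ W := by
    have h1 : 1 ≤ (Forest.below n N).card := Finset.card_pos.2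
      ⟨Forest.empty, by rw [Forest.mem_below, Forest.size_empty]; omega⟩
    have h2 : 1 ≤ N.factorial := Nat.factorial_pos N
    rw [hW]
    exact_mod_cast Nat.mul_pos h1 h2
  have hA0 : 0 ≤ A := le_trans (by positivity)
    (hA 1 le_rfl (by omega) x (by simp only [sub_self, norm_zero]; positivity))
  set k := N - τ.size with hk
  have key : ∀ ϵ ∈ Set.Icc (0 : ℝ) 1,
      ‖iteratedDeriv k (fun ϵ => elemDiff f τ (x + davieCurve N f x c ϵ)) ϵ‖ ≤
        k.factorial * A * (W * r) ^ k := by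
    intro ϵ hϵ
    have hcd : ContDiff ℝ k (elemDiff f τ) := contDiff_elemDiff hf (by omega)
    have hshift : ContDiff ℝ k (fun z => elemDiff f τ (x + z)) :=
      hcd.comp (contDiff_const.add contDiff_id)
    have hcg : ContDiff ℝ k (fun z => elemDiff f τ (x + S • z)) :=
      hshift.comp (contDiff_const_smul S)
    -- after a rescaling by `S` and the subtraction of its value at the given point, all derivatives
    -- of the outer function, including the one of order `0`, are bounded by `A`
    set a : Lin n m := -elemDiff f τ (x + davieCurve N f x c ϵ)
    have hcomp : (fun ϵ => a + elemDiff f τ (x + davieCurve N f x c ϵ)) =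
        (fun z => a + elemDiff f τ (x + S • z)) ∘ fun ϵ => S⁻¹ • davieCurve N f x c ϵ := by
      funext ϵ'
      simp only [Function.comp, smul_smul, mul_inv_cancel₀ hS.ne', one_smul]
    rw [← iteratedDeriv_const_add (by omega : 0 < k) a, hcomp,
      ← norm_iteratedFDeriv_eq_norm_iteratedDeriv]
    have hcg' : ContDiff ℝ k (fun z => a + elemDiff f τ (x + S • z)) := contDiff_const.add hcg
    have hch : ContDiff ℝ k (fun ϵ => S⁻¹ • davieCurve N f x c ϵ) :=
      (contDiff_davieCurve N f x c).const_smul S⁻¹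
    refine norm_iteratedFDeriv_comp_le (N := k) hcg' hch le_rfl ϵ ?_ ?_
    · intro i hi
      rcases Nat.eq_zero_or_pos i with rfl | hi0
      · rw [norm_iteratedFDeriv_zero]
        simp only [smul_smul, mul_inv_cancel₀ hS.ne', one_smul, a, neg_add_cancel, norm_zero]
        exact hA0
      · have hle : (i : WithTop ℕ∞) ≤ k := by exact_mod_cast hi
        have e1 : iteratedFDeriv ℝ i (fun z => a + elemDiff f τ (x + S • z)) =
            iteratedFDeriv ℝ i (fun z => elemDiff f τ (x + S • z)) := by
          have := iteratedFDeriv_add (𝕜 := ℝ) (i := i)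
            (f := fun _ : Vec m => a) (g := fun z => elemDiff f τ (x + S • z))
            contDiff_const (hcg.of_le hle)
          rw [iteratedFDeriv_const_of_ne (by omega), zero_add] at this
          exact this
        rw [e1, iteratedFDeriv_comp_const_smul (f := fun z => elemDiff f τ (x + z)) S
          (hshift.of_le hle)]
        simp only [iteratedFDeriv_comp_add_left, norm_smul, norm_pow, Real.norm_of_nonneg hS.le]
        rw [mul_comm, smul_smul, mul_inv_cancel₀ hS.ne', one_smul]
        refine hA i hi0 (by omega) _ ?_
        rw [add_sub_cancel_left]
        simpa using norm_iteratedDeriv_davieCurve_le f x c hS.le hr0 hr1 h 0 hϵ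
    · intro i hi1 hi
      rw [norm_iteratedFDeriv_eq_norm_iteratedDeriv]
      have e1 := iteratedDeriv_const_smul (n := i) (x := ϵ)
        (contDiff_davieCurve (k := i) N f x c).contDiffAt S⁻¹
      change ‖iteratedDeriv i (S⁻¹ • davieCurve N f x c) ϵ‖ ≤ _
      rw [e1, norm_smul, norm_inv, Real.norm_of_nonneg hS.le, mul_pow]
      have e2 := norm_iteratedDeriv_davieCurve_le f x c hS.le hr0 hr1 h i hϵ
      calc S⁻¹ * ‖iteratedDeriv i (davieCurve N f x c) ϵ‖ ≤ S⁻¹ * (W * (S * r ^ i)) :=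
            mul_le_mul_of_nonneg_left e2 (by positivity)
        _ = W * r ^ i := by field_simp
        _ ≤ W ^ i * r ^ i := mul_le_mul_of_nonneg_right (le_self_pow₀ hW1 (by omega))
            (by positivity)
  refine (norm_sub_davieTaylor_le hf x c hτ key (by simp)).trans ?_
  rw [one_pow, mul_one, mul_pow]
  have e1 : (k.factorial : ℝ) ≤ N.factorial := by
    exact_mod_cast Nat.factorial_le (by omega)
  have e2 : W ^ k ≤ W ^ N := pow_le_pow_right₀ hW1 (by omega)
  gcongr

end DavieTaylor

/-! ### Chen's relation for trees -/

section RoughPath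

variable {m n : ℕ} {γ : ℝ}

theorem PlaneForest.append_nil (τ : PlaneForest n) : τ.append nil = τ := by
  induction τ with
  | nil => rfl
  | cons i σ ρ _ ih => rw [append, ih]

theorem PlaneForest.size_append (τ κ : PlaneForest n) :
    (τ.append κ).size = τ.size + κ.size := by
  induction τ with
  | nil => simp [append, size]
  | cons i σ ρ _ ih => simp only [append, size, ih]; omega

theorem PlaneForest.size_add_size_of_mem_coproduct {τ : PlaneForest n}
    {a : PlaneForest n × PlaneForest n} (h : a ∈ τ.coproduct) :
    a.1.size + a.2.size = τ.size := by
  induction τ generalizing a with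
  | nil =>
      simp only [coproduct, List.mem_singleton] at h
      subst h
      rfl
  | cons i σ ρ ih₁ ih₂ =>
      simp only [coproduct, List.mem_append, List.mem_map, List.mem_flatMap] at h
      rcases h with ⟨b, hb, rfl⟩ | ⟨a, ha, b, hb, rfl⟩
      · have := ih₂ hb
        simp only [size]
        omega
      · have := ih₁ ha
        have := ih₂ hb
        simp only [size, size_append]
        omega

/-- The values of the rough path on trees. -/
def BranchedRoughPath.tree (X : BranchedRoughPath n γ) (s t : ℝ) (i : Fin n) (σ : Forest n) : ℝ :=
  X.X (σ.graft i) s t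

theorem BranchedRoughPath.vec_eq (X : BranchedRoughPath n γ) (τ : Forest n) (s t : ℝ) :
    X.vec τ s t = WithLp.toLp 2 fun i => X.tree s t i τ := rfl

theorem BranchedRoughPath.eq_character (X : BranchedRoughPath n γ) {s t : ℝ}
    (hs : s ∈ Set.Icc (-1 : ℝ) 0) (ht : t ∈ Set.Icc (-1 : ℝ) 0) {τ : Forest n}
    (hτ : τ.size ≤ level γ) : X.X τ s t = character (X.tree s t) τ := by
  induction τ using Forest.cons_induction with
  | h0 => exact X.map_empty s hs t ht
  | hc i σ ρ _ ih =>
      rw [Forest.size_cons] at hτ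
      rw [character_cons, ← ih (by omega), Forest.cons_eq_mul,
        X.map_mul _ _ (by rw [Forest.size_graft]; omega) s hs t ht]
      rfl

/-- Chen's relation for the tree `[κ]_i`. -/
theorem BranchedRoughPath.tree_eq_add_coproductSum (X : BranchedRoughPath n γ) {s u t : ℝ}
    (hs : s ∈ Set.Icc (-1 : ℝ) 0) (hu : u ∈ Set.Icc (-1 : ℝ) 0) (ht : t ∈ Set.Icc (-1 : ℝ) 0)
    (i : Fin n) {κ : Forest n} (hκ : κ.size < level γ) :
    X.tree s t i κ =
      X.tree s u i κ + Forest.coproductSum (X.tree s u) (fun τ => X.tree u t i τ) κ := by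
  induction κ using Forest.ind_mk with | h κ =>
  rw [Forest.size_mk] at hκ
  have h := X.chen (PlaneForest.cons i κ .nil)
    (by simp only [PlaneForest.size]; omega) s hs u hu t ht
  have e : X.X (Forest.mk PlaneForest.nil) u t = 1 := X.map_empty u hu t ht
  simp only [PlaneForest.coproduct, List.map_append, List.map_cons, List.map_nil,
    List.sum_append, List.sum_cons, List.sum_nil, e, PlaneForest.append_nil] at h
  rw [mul_one, add_zero] at h
  refine h.trans ?_
  congr 1
  rw [Forest.coproductSum_mk, PlaneForest.coproductSum, List.flatMap_def, List.map_flatten,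
    List.sum_flatten, List.map_map, List.map_map]
  congr 1
  refine List.map_congr_left fun a ha => ?_
  have hsize := PlaneForest.size_add_size_of_mem_coproduct ha
  simp only [Function.comp, List.map_cons, List.map_nil, List.sum_cons, List.sum_nil, add_zero]
  rw [X.eq_character hs hu (by rw [Forest.size_mk]; omega)]
  rfl

/-- The remainder of the Davie expansion for a path whose drift has the primitive `-V`. -/
def davieRem (f : Vec m → Lin n m) (X : BranchedRoughPath n γ) (φ V : ℝ → Vec m) (s t : ℝ) :
    Vec m :=
  φ t - φ s + (V t - V s) -
    ∑ τ ∈ Forest.below n (level γ), davieTerm f (φ s) (X.tree s t) τ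

theorem davieCurve_one (N : ℕ) (f : Vec m → Lin n m) (x : Vec m) (c : Fin n → Forest n → ℝ) :
    davieCurve N f x c 1 = ∑ τ ∈ Forest.below n N, davieTerm f x c τ := by
  simp [davieCurve]

/-- By Chen's relation, the defect of additivity of the remainder only involves the distances of
`f^τ(φ_u)` to the Taylor polynomials along the Davie curve. -/
theorem davieRem_sub_sub {f : Vec m → Lin n m} (hf : ContDiff ℝ (level γ) f)
    (X : BranchedRoughPath n γ) (φ V : ℝ → Vec m) {s u t : ℝ}
    (hs : s ∈ Set.Icc (-1 : ℝ) 0) (hu : u ∈ Set.Icc (-1 : ℝ) 0) (ht : t ∈ Set.Icc (-1 : ℝ) 0) :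
    davieRem f X φ V s t - davieRem f X φ V s u - davieRem f X φ V u t =
      ∑ τ ∈ Forest.below n (level γ), (τ.symFactor : ℝ)⁻¹ •
        (elemDiff f τ (φ u) - davieTaylor (level γ) f (φ s) (X.tree s u) τ 1) (X.vec τ u t) := by
  have key : ∑ κ ∈ Forest.below n (level γ), davieTerm f (φ s) (X.tree s t) κ -
      ∑ κ ∈ Forest.below n (level γ), davieTerm f (φ s) (X.tree s u) κ =
      ∑ τ ∈ Forest.below n (level γ), (τ.symFactor : ℝ)⁻¹ •
        davieTaylor (level γ) f (φ s) (X.tree s u) τ 1 (X.vec τ u t) := by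
    have h1 : ∀ κ ∈ Forest.below n (level γ),
        davieTerm f (φ s) (X.tree s t) κ - davieTerm f (φ s) (X.tree s u) κ =
        ∑ i, (((κ.symFactor : ℝ)⁻¹ * Forest.coproductSum (X.tree s u)
          (fun τ => X.tree u t i τ) κ) • elemDiff f κ (φ s))
            (EuclideanSpace.single i (1 : ℝ)) := by
      intro κ hκ
      have hv : (WithLp.toLp 2 fun i => X.tree s t i κ : Vec n) -
          WithLp.toLp 2 (fun i => X.tree s u i κ) = WithLp.toLp 2 fun i =>
            Forest.coproductSum (X.tree s u) (fun τ => X.tree u t i τ) κ := by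
        ext i
        change X.tree s t i κ - X.tree s u i κ = _
        rw [X.tree_eq_add_coproductSum hs hu ht i (Forest.mem_below.1 hκ), add_sub_cancel_left]
      rw [davieTerm, davieTerm, ← smul_sub, ← map_sub, hv, toLp_eq_sum, map_sum, Finset.smul_sum]
      refine Finset.sum_congr rfl fun i _ => ?_
      rw [map_smul, smul_smul, smul_apply]
    rw [← Finset.sum_sub_distrib, Finset.sum_congr rfl h1, Finset.sum_comm]
    have h2 : ∀ i : Fin n, ∑ κ ∈ Forest.below n (level γ),
        (((κ.symFactor : ℝ)⁻¹ * Forest.coproductSum (X.tree s u)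
          (fun τ => X.tree u t i τ) κ) • elemDiff f κ (φ s))
            (EuclideanSpace.single i (1 : ℝ)) =
        ∑ τ ∈ Forest.below n (level γ), (((τ.symFactor : ℝ)⁻¹ * X.tree u t i τ) •
          davieTaylor (level γ) f (φ s) (X.tree s u) τ 1) (EuclideanSpace.single i (1 : ℝ)) := by
      intro i
      rw [← sum_apply, sum_coproductSum_eq_sum_davieTaylor hf, sum_apply]
    rw [Finset.sum_congr rfl fun i _ => h2 i, Finset.sum_comm]
    refine Finset.sum_congr rfl fun τ _ => ?_
    rw [X.vec_eq, toLp_eq_sum, map_sum, Finset.smul_sum]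
    refine Finset.sum_congr rfl fun i _ => ?_
    rw [map_smul, smul_smul, smul_apply]
  have h3 : ∑ τ ∈ Forest.below n (level γ), davieTerm f (φ u) (X.tree u t) τ =
      ∑ τ ∈ Forest.below n (level γ), (τ.symFactor : ℝ)⁻¹ • elemDiff f τ (φ u) (X.vec τ u t) :=
    rfl
  simp only [sub_apply, smul_sub, Finset.sum_sub_distrib]
  rw [← key, ← h3, davieRem, davieRem, davieRem]
  abel

end RoughPath

/-! ### The sewing estimate -/

section Sewing

variable {m n : ℕ} {γ : ℝ}

/-- The number `|{τ : |τ| < N}| N!`, which controls the Davie curve and its derivatives. -/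
def curveConst (n N : ℕ) : ℝ := (Forest.below n N).card * N.factorial

/-- Bounds for the coefficients of the equation on `[a, b]`, at the time scale `T` and the space
scale `S`: the drift moves the path by at most `β S` over a time `T`, each term of the Davie
expansion moves it by at most `κ S`, and each term with a derivative of an elementary differential
by at most `ε S`. -/
structure ScaleBounds (f : Vec m → Lin n m) (X : BranchedRoughPath n γ) (φ V : ℝ → Vec m)
    (a b T S β κ ε : ℝ) (Ξ : Forest n → ℝ) : Prop where
  T_pos : 0 < T
  S_pos : 0 < S
  β_nonneg : 0 ≤ β
  κ_le : κ ≤ 1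
  ε_nonneg : 0 ≤ ε
  Ξ_nonneg : ∀ τ, 0 ≤ Ξ τ
  drift : ∀ s ∈ Set.Icc a b, ∀ t ∈ Set.Icc a b, s ≤ t → t - s ≤ T →
    ‖V t - V s‖ ≤ β * S * ((t - s) / T)
  path : ∀ τ ∈ Forest.below n (level γ), ∀ s ∈ Set.Icc a b, ∀ t ∈ Set.Icc a b, s ≤ t →
    ‖X.vec τ s t‖ ≤ Ξ τ * ((t - s) / T) ^ (γ * ((τ.size : ℝ) + 1))
  field : ∀ τ ∈ Forest.below n (level γ), ∀ s ∈ Set.Icc a b,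
    ‖elemDiff f τ (φ s)‖ * Ξ τ ≤ κ * S
  fieldDeriv : ∀ τ ∈ Forest.below n (level γ), ∀ ℓ, 1 ≤ ℓ → τ.size + ℓ ≤ level γ →
    ∀ s ∈ Set.Icc a b, ∀ y, ‖y - φ s‖ ≤ (β + curveConst n (level γ) + 2) * S →
      ‖iteratedFDeriv ℝ ℓ (elemDiff f τ) y‖ * S ^ ℓ * Ξ τ ≤ ε * S

/-- The constant in the bound for the defect of additivity of the remainder. -/
def defectConst (n N : ℕ) (β : ℝ) : ℝ :=
  (Forest.below n N).card * (β + 2 + N.factorial * curveConst n N ^ N)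

theorem level_mul_le (hγ : 0 < γ) : γ * level γ ≤ 1 := by
  have h := Nat.floor_le (one_div_nonneg.2 hγ.le)
  calc γ * level γ ≤ γ * (1 / γ) := mul_le_mul_of_nonneg_left h hγ.le
    _ = 1 := mul_one_div_cancel hγ.ne'

theorem one_lt_mul_level_add_one (hγ : 0 < γ) : 1 < γ * (level γ + 1) := by
  have h : 1 / γ < level γ + 1 := Nat.lt_floor_add_one (1 / γ)
  calc 1 = γ * (1 / γ) := (mul_one_div_cancel hγ.ne').symm
    _ < _ := mul_lt_mul_of_pos_left h hγ

theorem card_below_le_curveConst (n N : ℕ) : ((Forest.below n N).card : ℝ) ≤ curveConst n N :=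
  le_mul_of_one_le_right (Nat.cast_nonneg _) (by exact_mod_cast Nat.factorial_pos N)

variable {f : Vec m → Lin n m} {X : BranchedRoughPath n γ} {φ V : ℝ → Vec m}
  {a b T S β κ ε : ℝ} {Ξ : Forest n → ℝ}

theorem ScaleBounds.norm_davieTerm_le (h : ScaleBounds f X φ V a b T S β κ ε Ξ) {τ : Forest n}
    (hτ : τ ∈ Forest.below n (level γ)) {s t : ℝ} (hs : s ∈ Set.Icc a b) (ht : t ∈ Set.Icc a b)
    (hst : s ≤ t) :
    ‖davieTerm f (φ s) (X.tree s t) τ‖ ≤ κ * S * ((t - s) / T) ^ (γ * ((τ.size : ℝ) + 1)) := by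
  have hr : 0 ≤ ((t - s) / T) ^ (γ * ((τ.size : ℝ) + 1)) :=
    Real.rpow_nonneg (div_nonneg (by linarith) h.T_pos.le) _
  have h1 : ((τ.symFactor : ℝ)⁻¹) ≤ 1 :=
    inv_le_one_of_one_le₀ (by exact_mod_cast Forest.symFactor_pos τ)
  rw [davieTerm, norm_smul, Real.norm_of_nonneg (by positivity)]
  calc (τ.symFactor : ℝ)⁻¹ * ‖elemDiff f τ (φ s) (X.vec τ s t)‖
      ≤ 1 * (‖elemDiff f τ (φ s)‖ * (Ξ τ * ((t - s) / T) ^ (γ * ((τ.size : ℝ) + 1)))) := by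
        refine mul_le_mul h1 (((elemDiff f τ (φ s)).le_opNorm _).trans
          (mul_le_mul_of_nonneg_left (h.path τ hτ s hs t ht hst) (norm_nonneg _)))
          (norm_nonneg _) zero_le_one
    _ = ‖elemDiff f τ (φ s)‖ * Ξ τ * ((t - s) / T) ^ (γ * ((τ.size : ℝ) + 1)) := by ring
    _ ≤ _ := mul_le_mul_of_nonneg_right (h.field τ hτ s hs) hr

theorem ScaleBounds.norm_davieTerm_le_pow (h : ScaleBounds f X φ V a b T S β κ ε Ξ)
    {τ : Forest n} (hτ : τ ∈ Forest.below n (level γ)) {s t : ℝ} (hs : s ∈ Set.Icc a b)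
    (ht : t ∈ Set.Icc a b) (hst : s ≤ t) :
    ‖davieTerm f (φ s) (X.tree s t) τ‖ ≤ S * (((t - s) / T) ^ γ) ^ (τ.size + 1) := by
  have hr : 0 ≤ (t - s) / T := div_nonneg (by linarith) h.T_pos.le
  refine (h.norm_davieTerm_le hτ hs ht hst).trans ?_
  rw [← Real.rpow_mul_natCast hr]
  push_cast
  exact mul_le_mul_of_nonneg_right (by nlinarith [h.κ_le, h.S_pos]) (Real.rpow_nonneg hr _)

/-- A bound for the defect of additivity of the remainder, from a crude bound for the remainder
itself. -/
theorem ScaleBounds.norm_davieRem_sub_sub_le (hγ : 0 < γ) (hf : ContDiff ℝ (level γ) f)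
    (h : ScaleBounds f X φ V a b T S β κ ε Ξ) (hab : Set.Icc a b ⊆ Set.Icc (-1) 0) {s u t : ℝ}
    (hs : s ∈ Set.Icc a b) (hu : u ∈ Set.Icc a b) (ht : t ∈ Set.Icc a b) (hsu : s ≤ u)
    (hut : u ≤ t) (hle : t - u ≤ u - s) (hT : u - s ≤ T)
    (hR : ‖davieRem f X φ V s u‖ ≤ 2 * S * ((u - s) / T)) :
    ‖davieRem f X φ V s t - davieRem f X φ V s u - davieRem f X φ V u t‖ ≤
      defectConst n (level γ) β * ε * S * ((u - s) / T) ^ (γ * (level γ + 1)) := by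
  have hT0 := h.T_pos
  have hS0 := h.S_pos
  set N := level γ with hN
  set r := (u - s) / T with hr
  have hr0 : 0 ≤ r := div_nonneg (by linarith) hT0.le
  have hr1 : r ≤ 1 := (div_le_one hT0).2 hT
  have hrγ0 : 0 ≤ r ^ γ := Real.rpow_nonneg hr0 _
  have hrγ1 : r ^ γ ≤ 1 := Real.rpow_le_one hr0 hr1 hγ.le
  have hNγ : γ * N ≤ 1 := level_mul_le hγ
  have hcc := card_below_le_curveConst n N
  set x := φ s with hx
  set c := X.tree s u with hc
  have hterm : ∀ σ ∈ Forest.below n N, ‖davieTerm f x c σ‖ ≤ S * (r ^ γ) ^ (σ.size + 1) :=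
    fun σ hσ => h.norm_davieTerm_le_pow hσ hs hu hsu
  have hcurve : ‖davieCurve N f x c 1‖ ≤ curveConst n N * S := by
    rw [davieCurve_one]
    refine (norm_sum_le _ _).trans ?_
    refine (Finset.sum_le_card_nsmul _ _ S fun σ hσ => (hterm σ hσ).trans ?_).trans ?_
    · exact mul_le_of_le_one_right hS0.le (pow_le_one₀ hrγ0 hrγ1)
    · rw [nsmul_eq_mul]
      exact mul_le_mul_of_nonneg_right hcc hS0.le
  have hdist : ‖φ u - (x + davieCurve N f x c 1)‖ ≤ (β + 2) * S * r := by
    have e : φ u - (x + davieCurve N f x c 1) = davieRem f X φ V s u - (V u - V s) := by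
      rw [davieRem, davieCurve_one]
      abel
    rw [e]
    refine (norm_sub_le _ _).trans ?_
    have := h.drift s hs u hu hsu hT
    calc _ ≤ 2 * S * r + β * S * r := add_le_add hR this
      _ = _ := by ring
  have hdist1 : (β + 2) * S * r ≤ (β + 2) * S :=
    mul_le_of_le_one_right (mul_nonneg (by linarith [h.β_nonneg]) hS0.le) hr1
  rw [davieRem_sub_sub hf X φ V (hab hs) (hab hu) (hab ht), defectConst]
  have hterms : ∀ τ ∈ Forest.below n N, ‖(τ.symFactor : ℝ)⁻¹ •
      (elemDiff f τ (φ u) - davieTaylor N f x c τ 1) (X.vec τ u t)‖ ≤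
      (β + 2 + N.factorial * curveConst n N ^ N) * ε * S * r ^ (γ * (N + 1)) := by
    intro τ hτ
    have hτN := Forest.mem_below.1 hτ
    have hΞ := h.Ξ_nonneg τ
    have hvec : ‖X.vec τ u t‖ ≤ Ξ τ * r ^ (γ * ((τ.size : ℝ) + 1)) := by
      refine (h.path τ hτ u hu t ht hut).trans (mul_le_mul_of_nonneg_left ?_ hΞ)
      exact Real.rpow_le_rpow (div_nonneg (by linarith) hT0.le)
        (div_le_div_of_nonneg_right hle hT0.le) (by positivity)
    -- `φ u` is close to the end point of the Davie curve
    have e1 : ‖elemDiff f τ (φ u) - elemDiff f τ (x + davieCurve N f x c 1)‖ * Ξ τ ≤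
        ε * ((β + 2) * S * r) := by
      rcases hΞ.eq_or_lt with h0 | h0
      · rw [← h0, mul_zero]
        have := h.β_nonneg
        have := h.ε_nonneg
        positivity
      · have hd : Differentiable ℝ (elemDiff f τ) :=
          (contDiff_elemDiff (k := 1) hf (by omega)).differentiable (by norm_num)
        have hb : ∀ y ∈ Metric.closedBall x ((β + curveConst n N + 2) * S),
            ‖fderiv ℝ (elemDiff f τ) y‖ ≤ ε / Ξ τ := by
          intro y hy
          rw [mem_closedBall_iff_norm] at hy
          have := h.fieldDeriv τ hτ 1 le_rfl (by omega) s hs y hy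
          rw [norm_iteratedFDeriv_one, pow_one] at this
          rw [le_div_iff₀ h0]
          refine le_of_mul_le_mul_right ?_ hS0
          linarith
        have := Convex.norm_image_sub_le_of_norm_fderiv_le (f := elemDiff f τ)
          (fun y _ => hd y) hb (convex_closedBall x ((β + curveConst n N + 2) * S))
          (x := x + davieCurve N f x c 1) (y := φ u) (by
            rw [mem_closedBall_iff_norm, add_sub_cancel_left]
            nlinarith [h.β_nonneg]) (by
            rw [mem_closedBall_iff_norm]
            have e : φ u - x = (φ u - (x + davieCurve N f x c 1)) + davieCurve N f x c 1 := by abel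
            rw [e]
            refine (norm_add_le _ _).trans ?_
            linarith)
        calc _ ≤ (ε / Ξ τ * ‖φ u - (x + davieCurve N f x c 1)‖) * Ξ τ :=
              mul_le_mul_of_nonneg_right this hΞ
          _ = ε * ‖φ u - (x + davieCurve N f x c 1)‖ := by field_simp
          _ ≤ _ := mul_le_mul_of_nonneg_left hdist h.ε_nonneg
    -- Taylor's formula along the Davie curve
    have e2 : ‖elemDiff f τ (x + davieCurve N f x c 1) - davieTaylor N f x c τ 1‖ * Ξ τ ≤
        N.factorial * curveConst n N ^ N * ε * S * (r ^ γ) ^ (N - τ.size) := by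
      rcases hΞ.eq_or_lt with h0 | h0
      · rw [← h0, mul_zero]
        have := h.ε_nonneg
        have : 0 ≤ curveConst n N := le_trans (Nat.cast_nonneg _) hcc
        positivity
      · have := norm_sub_davieTaylor_one_le hf x c hτN (A := ε * S / Ξ τ) hS0 hrγ0 hrγ1 hterm
          (fun ℓ hℓ hℓ' y hy => by
            rw [le_div_iff₀ h0]
            refine h.fieldDeriv τ hτ ℓ hℓ hℓ' s hs y (hy.trans ?_)
            refine mul_le_mul_of_nonneg_right ?_ hS0.le
            rw [curveConst]
            linarith [h.β_nonneg])
        refine (mul_le_mul_of_nonneg_right this hΞ).trans (le_of_eq ?_)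
        rw [curveConst]
        field_simp
    have hsym : ((τ.symFactor : ℝ)⁻¹) ≤ 1 :=
      inv_le_one_of_one_le₀ (by exact_mod_cast Forest.symFactor_pos τ)
    have p1 : r * r ^ (γ * ((τ.size : ℝ) + 1)) ≤ r ^ (γ * (N + 1)) := by
      have : r * r ^ (γ * ((τ.size : ℝ) + 1)) = r ^ (1 + γ * ((τ.size : ℝ) + 1)) := by
        rw [Real.rpow_add_of_nonneg hr0 zero_le_one (by positivity), Real.rpow_one]
      rw [this]
      refine Real.rpow_le_rpow_of_exponent_ge_of_imp hr0 hr1 ?_ ?_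
      · have : 0 ≤ γ * (τ.size : ℝ) := by positivity
        linarith
      · intro _ h0
        have : 0 < γ * ((τ.size : ℝ) + 1) := by positivity
        linarith
    have p2 : (r ^ γ) ^ (N - τ.size) * r ^ (γ * ((τ.size : ℝ) + 1)) = r ^ (γ * (N + 1)) := by
      rw [← Real.rpow_mul_natCast hr0, ← Real.rpow_add_of_nonneg hr0 (by positivity)
        (by positivity), Nat.cast_sub hτN.le]
      congr 1
      ring
    rw [norm_smul, Real.norm_of_nonneg (by positivity)]
    set D1 := ‖elemDiff f τ (φ u) - elemDiff f τ (x + davieCurve N f x c 1)‖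
    set D2 := ‖elemDiff f τ (x + davieCurve N f x c 1) - davieTaylor N f x c τ 1‖
    have hD : ‖elemDiff f τ (φ u) - davieTaylor N f x c τ 1‖ ≤ D1 + D2 :=
      norm_sub_le_norm_sub_add_norm_sub _ _ _
    set q := r ^ (γ * ((τ.size : ℝ) + 1)) with hq
    have hq0 : 0 ≤ q := Real.rpow_nonneg hr0 _
    calc (τ.symFactor : ℝ)⁻¹ *
          ‖(elemDiff f τ (φ u) - davieTaylor N f x c τ 1) (X.vec τ u t)‖
        ≤ 1 * ((D1 + D2) * (Ξ τ * q)) := by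
          refine mul_le_mul hsym ((ContinuousLinearMap.le_opNorm _ _).trans
            (mul_le_mul hD hvec (norm_nonneg _) (by positivity))) (norm_nonneg _) zero_le_one
      _ = (D1 * Ξ τ) * q + (D2 * Ξ τ) * q := by ring
      _ ≤ (ε * ((β + 2) * S * r)) * q +
          (N.factorial * curveConst n N ^ N * ε * S * (r ^ γ) ^ (N - τ.size)) * q :=
          add_le_add (mul_le_mul_of_nonneg_right e1 hq0) (mul_le_mul_of_nonneg_right e2 hq0)
      _ = (ε * ((β + 2) * S)) * (r * q) +
          (N.factorial * curveConst n N ^ N * ε * S) * ((r ^ γ) ^ (N - τ.size) * q) := by ring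
      _ ≤ (ε * ((β + 2) * S)) * r ^ (γ * (N + 1)) +
          (N.factorial * curveConst n N ^ N * ε * S) * r ^ (γ * (N + 1)) := by
          rw [p2]
          refine add_le_add_left (mul_le_mul_of_nonneg_left p1 ?_) _
          have := h.β_nonneg
          have := h.ε_nonneg
          positivity
      _ = _ := by ring
  refine (norm_sum_le _ _).trans ((Finset.sum_le_card_nsmul _ _ _ hterms).trans (le_of_eq ?_))
  rw [nsmul_eq_mul]
  ring

end Sewing

section SewingBound

variable {m n : ℕ} {γ : ℝ}

theorem defectConst_nonneg (n N : ℕ) {β : ℝ} (hβ : 0 ≤ β) : 0 ≤ defectConst n N β := by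
  have : 0 ≤ curveConst n N := le_trans (Nat.cast_nonneg _) (card_below_le_curveConst n N)
  rw [defectConst]
  positivity

/-- The constant in the bound for the remainder of the Davie expansion. The denominator is positive
because the exponent `γ (N + 1)` exceeds `1`. -/
def sewConst (n : ℕ) (γ β : ℝ) : ℝ :=
  defectConst n (level γ) β / (2 ^ (γ * (level γ + 1)) - 2)

theorem two_rpow_sub_two_pos (hγ : 0 < γ) : 0 < (2 : ℝ) ^ (γ * ((level γ : ℝ) + 1)) - 2 := by
  have := Real.rpow_lt_rpow_of_exponent_lt (one_lt_two (α := ℝ)) (one_lt_mul_level_add_one hγ)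
  rw [Real.rpow_one] at this
  linarith

theorem sewConst_nonneg (n : ℕ) (hγ : 0 < γ) {β : ℝ} (hβ : 0 ≤ β) : 0 ≤ sewConst n γ β :=
  div_nonneg (defectConst_nonneg n _ hβ) (two_rpow_sub_two_pos hγ).le

variable {f : Vec m → Lin n m} {X : BranchedRoughPath n γ} {φ V : ℝ → Vec m}
  {a b T S β κ ε : ℝ} {Ξ : Forest n → ℝ}

/-- A remainder that is `o(t - s)` obeys a quantitative bound up to an arbitrarily small multiple of
`t - s`: the bound holds for short intervals, and bisection carries it to intervals of twice
the length. -/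
theorem ScaleBounds.norm_davieRem_le_add (hγ : 0 < γ) (hf : ContDiff ℝ (level γ) f)
    (h : ScaleBounds f X φ V a b T S β κ ε Ξ) (hab : Set.Icc a b ⊆ Set.Icc (-1) 0)
    (hε : sewConst n γ β * ε ≤ 1) {ω δ : ℝ} (hωT : ω * T ≤ S)
    (ho : ∀ s ∈ Set.Icc a b, ∀ t ∈ Set.Icc a b, s ≤ t → t - s < δ →
      ‖davieRem f X φ V s t‖ ≤ ω * (t - s)) (k : ℕ) :
    ∀ s ∈ Set.Icc a b, ∀ t ∈ Set.Icc a b, s ≤ t → t - s ≤ T → t - s < δ * 2 ^ k →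
      ‖davieRem f X φ V s t‖ ≤
        sewConst n γ β * ε * S * ((t - s) / T) ^ (γ * (level γ + 1)) + ω * (t - s) := by
  have hT0 := h.T_pos
  have hS0 := h.S_pos
  have hC := sewConst_nonneg n hγ h.β_nonneg
  have hε0 := h.ε_nonneg
  have hθ := one_lt_mul_level_add_one hγ
  induction k with
  | zero =>
      intro s hs t ht hst _ hlt
      rw [pow_zero, mul_one] at hlt
      refine (ho s hs t ht hst hlt).trans (le_add_of_nonneg_left ?_)
      have : 0 ≤ (t - s) / T := div_nonneg (by linarith) hT0.le
      positivity
  | succ k ih =>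
      intro s hs t ht hst hT hlt
      obtain ⟨u, hu⟩ : ∃ u, u = (s + t) / 2 := ⟨_, rfl⟩
      have hsu : u - s = (t - s) / 2 := by rw [hu]; ring
      have hut : t - u = (t - s) / 2 := by rw [hu]; ring
      have hsu' : s ≤ u := by linarith
      have hut' : u ≤ t := by linarith
      have huI : u ∈ Set.Icc a b := ⟨hs.1.trans hsu', hut'.trans ht.2⟩
      rw [pow_succ] at hlt
      have h1 := ih s hs u huI hsu' (by linarith) (by linarith)
      have h2 := ih u huI t ht hut' (by linarith) (by linarith)
      set θ := γ * ((level γ : ℝ) + 1) with hθdef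
      obtain ⟨r, hr⟩ : ∃ r, r = (u - s) / T := ⟨_, rfl⟩
      have hr0 : 0 ≤ r := by rw [hr]; exact div_nonneg (by linarith) hT0.le
      have hr1 : r ≤ 1 := by rw [hr]; exact (div_le_one hT0).2 (by linarith)
      have hru : u - s = r * T := by rw [hr]; field_simp
      have hrθ : r ^ θ ≤ r := by
        have := Real.rpow_le_rpow_of_exponent_ge_of_imp hr0 hr1 hθ.le (fun _ h0 => by linarith)
        rwa [Real.rpow_one] at this
      have hcrude : ‖davieRem f X φ V s u‖ ≤ 2 * S * ((u - s) / T) := by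
        refine h1.trans ?_
        rw [← hr, hru]
        have e1 : sewConst n γ β * ε * S * r ^ θ ≤ 1 * S * r :=
          mul_le_mul (mul_le_mul_of_nonneg_right hε hS0.le) hrθ (Real.rpow_nonneg hr0 _)
            (by linarith)
        have e2 : ω * (r * T) ≤ S * r := by nlinarith
        linarith
      have h3 := h.norm_davieRem_sub_sub_le hγ hf hab hs huI ht hsu' hut' (by linarith)
        (by linarith) hcrude
      rw [← hθdef] at h3
      have e : davieRem f X φ V s t = (davieRem f X φ V s t - davieRem f X φ V s u -
          davieRem f X φ V u t) + davieRem f X φ V s u + davieRem f X φ V u t := by abel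
      have h4 := (congrArg norm e).trans_le norm_add₃_le
      have h2r : (t - s) / T = 2 * r := by rw [hr, hsu]; ring
      have h2θ : (2 * r) ^ θ = 2 ^ θ * r ^ θ := Real.mul_rpow (by norm_num) hr0
      have hpos : (2 : ℝ) ^ θ - 2 ≠ 0 := (two_rpow_sub_two_pos hγ).ne'
      have hdef : defectConst n (level γ) β = sewConst n γ β * (2 ^ θ - 2) := by
        rw [sewConst, ← hθdef, div_mul_cancel₀ _ hpos]
      have hut2 : (t - u) / T = r := by rw [hr, hsu, hut]
      rw [hut2] at h2
      rw [← hr] at h1 h3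
      rw [hdef] at h3
      rw [h2r, h2θ]
      refine h4.trans ((add_le_add (add_le_add h3 h1) h2).trans (le_of_eq ?_))
      rw [hsu, hut]
      ring

/-- The remainder of the Davie expansion of a solution is of order `ε S ((t - s) / T)^{γ(N+1)}`. -/
theorem ScaleBounds.norm_davieRem_le (hγ : 0 < γ) (hf : ContDiff ℝ (level γ) f)
    (h : ScaleBounds f X φ V a b T S β κ ε Ξ) (hab : Set.Icc a b ⊆ Set.Icc (-1) 0)
    (hε : sewConst n γ β * ε ≤ 1)
    (ho : ∀ ω > 0, ∃ δ > 0, ∀ s ∈ Set.Icc a b, ∀ t ∈ Set.Icc a b, s ≤ t → t - s < δ →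
      ‖davieRem f X φ V s t‖ ≤ ω * (t - s)) {s t : ℝ} (hs : s ∈ Set.Icc a b)
    (ht : t ∈ Set.Icc a b) (hst : s ≤ t) (hT : t - s ≤ T) :
    ‖davieRem f X φ V s t‖ ≤
      sewConst n γ β * ε * S * ((t - s) / T) ^ (γ * (level γ + 1)) := by
  refine le_of_forall_pos_le_add fun ω hω => ?_
  have hT0 := h.T_pos
  have hS0 := h.S_pos
  obtain ⟨ω', hω', hω1, hω2⟩ : ∃ ω' > 0, ω' * T ≤ S ∧ ω' * T ≤ ω := by
    refine ⟨min S ω / T, div_pos (lt_min hS0 hω) hT0, ?_, ?_⟩ <;> rw [div_mul_cancel₀ _ hT0.ne']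
    exacts [min_le_left _ _, min_le_right _ _]
  obtain ⟨δ, hδ, ho⟩ := ho ω' hω'
  obtain ⟨k, hk⟩ := pow_unbounded_of_one_lt ((t - s) / δ) (one_lt_two (α := ℝ))
  rw [div_lt_iff₀' hδ] at hk
  refine (h.norm_davieRem_le_add hγ hf hab hε hω1 ho k s hs t ht hst hT hk).trans ?_
  have := mul_le_mul_of_nonneg_left hT hω'.le
  linarith

theorem ScaleBounds.norm_sub_add_le (hγ : 0 < γ) (hf : ContDiff ℝ (level γ) f)
    (h : ScaleBounds f X φ V a b T S β κ ε Ξ) (hab : Set.Icc a b ⊆ Set.Icc (-1) 0)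
    (hκ : 0 ≤ κ) (hε : sewConst n γ β * ε ≤ 1)
    (ho : ∀ ω > 0, ∃ δ > 0, ∀ s ∈ Set.Icc a b, ∀ t ∈ Set.Icc a b, s ≤ t → t - s < δ →
      ‖davieRem f X φ V s t‖ ≤ ω * (t - s)) {s t : ℝ} (hs : s ∈ Set.Icc a b)
    (ht : t ∈ Set.Icc a b) (hst : s ≤ t) (hT : t - s ≤ T) :
    ‖φ t - φ s + (V t - V s)‖ ≤
      (sewConst n γ β * ε + (Forest.below n (level γ)).card * κ) * S := by
  have hT0 := h.T_pos
  have hS0 := h.S_pos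
  have hr0 : 0 ≤ (t - s) / T := div_nonneg (by linarith) hT0.le
  have hr1 : (t - s) / T ≤ 1 := (div_le_one hT0).2 hT
  have e : φ t - φ s + (V t - V s) = davieRem f X φ V s t +
      ∑ τ ∈ Forest.below n (level γ), davieTerm f (φ s) (X.tree s t) τ := by
    rw [davieRem, sub_add_cancel]
  have h1 : ‖davieRem f X φ V s t‖ ≤ sewConst n γ β * ε * S := by
    refine (h.norm_davieRem_le hγ hf hab hε ho hs ht hst hT).trans (mul_le_of_le_one_right ?_ ?_)
    · have := sewConst_nonneg n hγ h.β_nonneg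
      have := h.ε_nonneg
      positivity
    · exact Real.rpow_le_one hr0 hr1 (by positivity)
  have h2 : ‖∑ τ ∈ Forest.below n (level γ), davieTerm f (φ s) (X.tree s t) τ‖ ≤
      (Forest.below n (level γ)).card * (κ * S) := by
    rw [← nsmul_eq_mul]
    refine (norm_sum_le _ _).trans (Finset.sum_le_card_nsmul _ _ _ fun τ hτ => ?_)
    exact (h.norm_davieTerm_le hτ hs ht hst).trans
      (mul_le_of_le_one_right (by positivity) (Real.rpow_le_one hr0 hr1 (by positivity)))
  rw [e]
  refine (norm_add_le _ _).trans ((add_le_add h1 h2).trans (le_of_eq ?_))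
  ring

/-- Over a long time interval, the increments on the consecutive subintervals of length `T` add
up. -/
theorem ScaleBounds.norm_sub_add_le_mul (hγ : 0 < γ) (hf : ContDiff ℝ (level γ) f)
    (h : ScaleBounds f X φ V a b T S β κ ε Ξ) (hab : Set.Icc a b ⊆ Set.Icc (-1) 0)
    (hκ : 0 ≤ κ) (hε : sewConst n γ β * ε ≤ 1)
    (ho : ∀ ω > 0, ∃ δ > 0, ∀ s ∈ Set.Icc a b, ∀ t ∈ Set.Icc a b, s ≤ t → t - s < δ →
      ‖davieRem f X φ V s t‖ ≤ ω * (t - s)) {s t : ℝ} (hs : s ∈ Set.Icc a b)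
    (ht : t ∈ Set.Icc a b) (hst : s ≤ t) :
    ‖φ t - φ s + (V t - V s)‖ ≤ ((t - s) / T + 1) *
      ((sewConst n γ β * ε + (Forest.below n (level γ)).card * κ) * S) := by
  have hT0 := h.T_pos
  set E := (sewConst n γ β * ε + (Forest.below n (level γ)).card * κ) * S with hE
  have hE0 : 0 ≤ E := by
    have := sewConst_nonneg n hγ h.β_nonneg
    have := h.ε_nonneg
    have := h.S_pos
    positivity
  have key : ∀ k : ℕ, ∀ t ∈ Set.Icc a b, s ≤ t → t - s ≤ k * T →
      ‖φ t - φ s + (V t - V s)‖ ≤ k * E := by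
    intro k
    induction k with
    | zero =>
        intro t _ hst hle
        rw [Nat.cast_zero, zero_mul] at hle
        obtain rfl : t = s := by linarith
        simp
    | succ k ih =>
        intro t ht hst hle
        push_cast at hle ⊢
        by_cases hT : t - s ≤ T
        · have := h.norm_sub_add_le hγ hf hab hκ hε ho hs ht hst hT
          have : (0 : ℝ) ≤ k * E := by positivity
          linarith
        · have hu : t - T ∈ Set.Icc a b := ⟨by linarith [hs.1], by linarith [ht.2]⟩
          have h1 := ih (t - T) hu (by linarith) (by linarith)
          have h2 := h.norm_sub_add_le hγ hf hab hκ hε ho hu ht (by linarith) (by linarith)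
          have e : φ t - φ s + (V t - V s) = (φ (t - T) - φ s + (V (t - T) - V s)) +
              (φ t - φ (t - T) + (V t - V (t - T))) := by abel
          rw [e]
          refine (norm_add_le _ _).trans ?_
          linarith
  have hq : 0 ≤ (t - s) / T := div_nonneg (by linarith) hT0.le
  refine (key ⌈(t - s) / T⌉₊ t ht hst ?_).trans
    (mul_le_mul_of_nonneg_right (Nat.ceil_lt_add_one hq).le hE0)
  exact (div_le_iff₀ hT0).1 (Nat.le_ceil _)

end SewingBound

/-! ### Coming down from infinity -/

section Drift

variable {E : Type*} [NormedAddCommGroup E] [InnerProductSpace ℝ E] {φ V : ℝ → E} {a b p : ℝ}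

/-- Going backwards in time, the path `u ↦ φ_b + V_b - V_u`, whose speed is the drift, moves away
from the origin as long as it stays close to `φ`. -/
theorem norm_sq_add_le_of_norm_sub_add_le (hp : 1 < p) (hab : a ≤ b)
    (hV : ∀ t ∈ Set.Icc a b, HasDerivAt V (‖φ t‖ ^ (p - 1) • φ t) t)
    (hlow : ∀ t ∈ Set.Icc a b, ‖φ b‖ / 2 ≤ ‖φ t‖)
    (hdev : ∀ t ∈ Set.Icc a b, ‖φ b - φ t + (V b - V t)‖ ≤ ‖φ b‖ / 8) :
    ‖φ b‖ ^ 2 + (b - a) * ((‖φ b‖ / 2) ^ (p - 1) * (‖φ b‖ ^ 2 / 4)) ≤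
      ‖φ b + (V b - V a)‖ ^ 2 := by
  set M := ‖φ b‖ with hM
  have hM0 : 0 ≤ M := norm_nonneg _
  set c := (M / 2) ^ (p - 1) * (M ^ 2 / 4) with hc
  have hderiv : ∀ t ∈ Set.Icc a b, HasDerivAt (fun u => ‖φ b + (V b - V u)‖ ^ 2 + c * u)
      (2 * inner ℝ (φ b + (V b - V t)) (-(‖φ t‖ ^ (p - 1) • φ t)) + c * 1) t := fun t ht =>
    ((((hV t ht).const_sub (V b)).const_add (φ b)).norm_sq).add ((hasDerivAt_id t).const_mul c)
  have hanti : AntitoneOn (fun u => ‖φ b + (V b - V u)‖ ^ 2 + c * u) (Set.Icc a b) := by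
    refine antitoneOn_of_deriv_nonpos (convex_Icc a b)
      (fun t ht => (hderiv t ht).continuousAt.continuousWithinAt)
      (fun t ht => (hderiv t (interior_subset ht)).differentiableAt.differentiableWithinAt)
      fun t ht => ?_
    have ht := interior_subset ht
    rw [(hderiv t ht).deriv, inner_neg_right, real_inner_smul_right]
    have hl := hlow t ht
    have h1 : (M / 2) ^ (p - 1) ≤ ‖φ t‖ ^ (p - 1) :=
      Real.rpow_le_rpow (by positivity) hl (by linarith)
    have h2 : M ^ 2 / 8 ≤ inner ℝ (φ b + (V b - V t)) (φ t) := by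
      have e : φ b + (V b - V t) = φ t + (φ b - φ t + (V b - V t)) := by abel
      have h3 := (abs_le.1 ((abs_real_inner_le_norm (φ b - φ t + (V b - V t)) (φ t)).trans
        (mul_le_mul_of_nonneg_right (hdev t ht) (norm_nonneg _)))).1
      rw [e, inner_add_left, real_inner_self_eq_norm_sq]
      nlinarith
    have h4 := mul_le_mul h1 h2 (by positivity) (by positivity)
    rw [hc]
    linarith
  have := hanti (Set.left_mem_Icc.2 hab) (Set.right_mem_Icc.2 hab) hab
  simp only [sub_self, add_zero] at this
  rw [← hM] at this
  linarith

/-- A path `φ` that stays close to a solution of `dφ = -φ^p dt`, as long as it is not much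
smaller than its final value, forgets its initial value: after a long time its final value is small
compared with its initial one. -/
theorem sub_mul_rpow_le_of_norm_sub_add_le (hp : 1 < p) (hab : a ≤ b)
    (hφ : ContinuousOn φ (Set.Icc a b))
    (hV : ∀ t ∈ Set.Icc a b, HasDerivAt V (‖φ t‖ ^ (p - 1) • φ t) t) {B : ℝ} (hb : 0 < ‖φ b‖)
    (ha : ‖φ a‖ ≤ B * ‖φ b‖)
    (hdev : ∀ s ∈ Set.Icc a b, (∀ t ∈ Set.Icc s b, ‖φ b‖ / 2 ≤ ‖φ t‖) →
      ‖φ b - φ s + (V b - V s)‖ ≤ ‖φ b‖ / 8) :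
    (b - a) * ‖φ b‖ ^ (p - 1) ≤ 2 ^ (p + 1) * (B + 1) ^ 2 := by
  set M := ‖φ b‖ with hM
  -- a bound from below on `[s, b]` improves itself at `s`
  have hstep : ∀ s ∈ Set.Icc a b, (∀ t ∈ Set.Icc s b, M / 2 ≤ ‖φ t‖) →
      M ^ 2 + (b - s) * ((M / 2) ^ (p - 1) * (M ^ 2 / 4)) ≤ ‖φ b + (V b - V s)‖ ^ 2 := by
    intro s hs hlow
    have hsub : Set.Icc s b ⊆ Set.Icc a b := Set.Icc_subset_Icc_left hs.1
    exact norm_sq_add_le_of_norm_sub_add_le hp hs.2 (fun t ht => hV t (hsub ht)) hlow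
      fun t ht => hdev t (hsub ht) fun u hu => hlow u ⟨ht.1.trans hu.1, hu.2⟩
  have hivt : ∀ s ∈ Set.Icc a b, ‖φ s‖ ≤ M / 2 → ∃ u ∈ Set.Icc s b, ‖φ u‖ = M / 2 := by
    intro s hs hle
    exact intermediate_value_Icc hs.2 (hφ.norm.mono (Set.Icc_subset_Icc_left hs.1))
      ⟨hle, by linarith⟩
  have hlow : ∀ s ∈ Set.Icc a b, M / 2 ≤ ‖φ s‖ := by
    by_contra! hcon
    obtain ⟨s, hs, hlt⟩ := hcon
    obtain ⟨u, hu, hueq⟩ := hivt s hs hlt.le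
    have hcomp : IsCompact (Set.Icc a b ∩ (fun t => ‖φ t‖) ⁻¹' {M / 2}) :=
      isCompact_Icc.of_isClosed_subset
        (hφ.norm.preimage_isClosed_of_isClosed isClosed_Icc isClosed_singleton)
        Set.inter_subset_left
    obtain ⟨s₀, ⟨hs₀, hs₀eq⟩, hmax⟩ := hcomp.exists_isGreatest
      ⟨u, ⟨hs.1.trans hu.1, hu.2⟩, hueq⟩
    have hs₀eq : ‖φ s₀‖ = M / 2 := hs₀eq
    have hlow₀ : ∀ t ∈ Set.Icc s₀ b, M / 2 ≤ ‖φ t‖ := by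
      intro t ht
      by_contra! hlt
      have htI : t ∈ Set.Icc a b := ⟨hs₀.1.trans ht.1, ht.2⟩
      obtain ⟨v, hv, hveq⟩ := hivt t htI hlt.le
      have hvs : v ≤ s₀ := hmax ⟨⟨htI.1.trans hv.1, hv.2⟩, hveq⟩
      obtain rfl : v = t := le_antisymm (hvs.trans ht.1) hv.1
      linarith
    have h1 := hstep s₀ hs₀ hlow₀
    have h2 : 0 ≤ (b - s₀) * ((M / 2) ^ (p - 1) * (M ^ 2 / 4)) :=
      mul_nonneg (by linarith [hs₀.2]) (by positivity)
    have h3 : M ≤ ‖φ b + (V b - V s₀)‖ :=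
      le_of_sq_le_sq (by linarith) (norm_nonneg _)
    have h4 : ‖φ b + (V b - V s₀)‖ ≤ ‖φ s₀‖ + ‖φ b - φ s₀ + (V b - V s₀)‖ := by
      refine (le_of_eq (congrArg norm ?_)).trans (norm_add_le _ _)
      abel
    have h5 := hdev s₀ hs₀ hlow₀
    linarith
  have haI : a ∈ Set.Icc a b := Set.left_mem_Icc.2 hab
  have h1 := hstep a haI hlow
  have h2 : ‖φ b + (V b - V a)‖ ≤ (B + 1) * M := by
    have h3 := hdev a haI hlow
    have h4 : ‖φ b + (V b - V a)‖ ≤ ‖φ a‖ + ‖φ b - φ a + (V b - V a)‖ := by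
      refine (le_of_eq (congrArg norm ?_)).trans (norm_add_le _ _)
      abel
    linarith
  have h3 : ‖φ b + (V b - V a)‖ ^ 2 ≤ (B + 1) ^ 2 * M ^ 2 := by
    rw [← mul_pow]
    exact pow_le_pow_left₀ (norm_nonneg _) h2 2
  have h4 : (b - a) * (M / 2) ^ (p - 1) * (1 / 4) ≤ (B + 1) ^ 2 := by
    refine le_of_mul_le_mul_right ?_ (pow_pos hb 2)
    nlinarith [sq_nonneg M]
  have h5 : (M / 2) ^ (p - 1) = M ^ (p - 1) / 2 ^ (p - 1) :=
    Real.div_rpow hb.le (by norm_num) _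
  have h6 : (2 : ℝ) ^ (p + 1) = 2 ^ (p - 1) * 4 := by
    rw [show p + 1 = p - 1 + 2 by ring, Real.rpow_add (by norm_num)]
    norm_num
  rw [h5] at h4
  rw [h6]
  have h7 : (0 : ℝ) < 2 ^ (p - 1) := by positivity
  calc (b - a) * M ^ (p - 1) = ((b - a) * (M ^ (p - 1) / 2 ^ (p - 1)) * (1 / 4)) *
        (2 ^ (p - 1) * 4) := by field_simp
    _ ≤ (B + 1) ^ 2 * (2 ^ (p - 1) * 4) := mul_le_mul_of_nonneg_right h4 (by positivity)
    _ = _ := by ring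

end Drift

/-! ### Solutions in terms of the remainder of the Davie expansion -/

section Solution

variable {m n : ℕ} {γ p : ℝ}

theorem exists_hasDerivAt_of_continuousOn {φ : ℝ → Vec m} {a b : ℝ} (hab : a ≤ b)
    (hφ : ContinuousOn φ (Set.Icc a b)) :
    ∃ V : ℝ → Vec m, ∀ t ∈ Set.Icc a b, HasDerivAt V (φ t) t := by
  obtain ⟨g, hg, hgφ⟩ : ∃ g : ℝ → Vec m, Continuous g ∧ ∀ t ∈ Set.Icc a b, g t = φ t :=
    ⟨Set.IccExtend hab ((Set.Icc a b).domRestrict φ), hφ.domRestrict.Icc_extend',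
      fun t ht => Set.IccExtend_of_mem hab _ ht⟩
  refine ⟨fun t => ∫ u in a..t, g u, fun t ht => ?_⟩
  rw [← hgφ t ht]
  exact intervalIntegral.integral_hasDerivAt_right (hg.intervalIntegrable _ _)
    (hg.stronglyMeasurableAtFilter _ _) hg.continuousAt

theorem IsSolution.continuousOn {f : Vec m → Lin n m} {X : BranchedRoughPath n γ}
    {φ : ℝ → Vec m} (hγ : 0 < γ) (h : IsSolution p f X φ) :
    ContinuousOn φ (Set.Icc (-1) 0) := by
  obtain ⟨⟨K, hK⟩, -⟩ := h
  intro s hs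
  rw [ContinuousWithinAt, tendsto_iff_norm_sub_tendsto_zero]
  refine squeeze_zero' (.of_forall fun _ => norm_nonneg _)
    (Filter.eventually_of_mem self_mem_nhdsWithin fun t ht => hK s hs t ht) ?_
  have : Continuous fun t : ℝ => K * |t - s| ^ γ :=
    continuous_const.mul ((continuous_id.sub continuous_const).abs.rpow_const fun _ => .inr hγ.le)
  have h0 := this.tendsto s
  rw [sub_self, abs_zero, Real.zero_rpow hγ.ne', mul_zero] at h0
  exact h0.mono_left nhdsWithin_le_nhds

/-- The term `-φ_s^p (t - s)` in the definition of a solution may be replaced by the increment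
of a primitive of `-φ^p`. -/
theorem IsSolution.norm_davieRem_le {f : Vec m → Lin n m} {X : BranchedRoughPath n γ}
    {φ V : ℝ → Vec m} (hγ : 0 < γ) (hp : 1 < p) (h : IsSolution p f X φ)
    (hV : ∀ t ∈ Set.Icc (-1 : ℝ) 0, HasDerivAt V (‖φ t‖ ^ (p - 1) • φ t) t) :
    ∀ ω > 0, ∃ δ > 0, ∀ s ∈ Set.Icc (-1 : ℝ) 0, ∀ t ∈ Set.Icc (-1 : ℝ) 0, s ≤ t → t - s < δ →
      ‖davieRem f X φ V s t‖ ≤ ω * (t - s) := by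
  intro ω hω
  have hc := h.continuousOn hγ
  have hd : ContinuousOn (fun t => ‖φ t‖ ^ (p - 1) • φ t) (Set.Icc (-1) 0) :=
    (hc.norm.rpow_const fun _ _ => .inr (by linarith)).smul hc
  have huc := isCompact_Icc.uniformContinuousOn_of_continuous hd
  rw [Metric.uniformContinuousOn_iff] at huc
  obtain ⟨δ₁, hδ₁, h1⟩ := huc (ω / 2) (half_pos hω)
  obtain ⟨δ₂, hδ₂, h2⟩ := h.2 (ω / 2) (half_pos hω)
  refine ⟨min δ₁ δ₂, lt_min hδ₁ hδ₂, fun s hs t ht hst hlt => ?_⟩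
  have h3 := h2 s hs t ht hst (hlt.trans_le (min_le_right _ _))
  have hsub : Set.Icc s t ⊆ Set.Icc (-1) 0 := Set.Icc_subset_Icc hs.1 ht.2
  have h4 : ‖V t - V s - (t - s) • (‖φ s‖ ^ (p - 1) • φ s)‖ ≤ ω / 2 * (t - s) := by
    have := norm_image_sub_le_of_norm_deriv_le_segment'
      (f := fun u => V u - u • (‖φ s‖ ^ (p - 1) • φ s)) (C := ω / 2)
      (f' := fun u => ‖φ u‖ ^ (p - 1) • φ u - (1 : ℝ) • (‖φ s‖ ^ (p - 1) • φ s)) (a := s) (b := t)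
      (fun u hu => ((hV u (hsub hu)).sub ((hasDerivAt_id u).smul_const _)).hasDerivWithinAt)
      (fun u hu => by
        have hu' : u ∈ Set.Icc s t := Set.Ico_subset_Icc_self hu
        have := h1 u (hsub hu') s hs (by
          rw [Real.dist_eq, abs_of_nonneg (by linarith [hu.1])]
          linarith [hu.2, hlt.trans_le (min_le_left _ _)])
        rw [one_smul, ← dist_eq_norm]
        exact this.le) t ⟨hst, le_rfl⟩
    refine (le_of_eq (congrArg norm ?_)).trans this
    rw [sub_smul]
    abel
  have e : davieRem f X φ V s t = (φ t - φ s - (-((t - s) • (‖φ s‖ ^ (p - 1) • φ s)) +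
      ∑ τ ∈ Forest.below n (level γ),
        ((τ.symFactor : ℝ)⁻¹) • elemDiff f τ (φ s) (X.vec τ s t))) +
      (V t - V s - (t - s) • (‖φ s‖ ^ (p - 1) • φ s)) := by
    have e' : ∑ τ ∈ Forest.below n (level γ), davieTerm f (φ s) (X.tree s t) τ =
      ∑ τ ∈ Forest.below n (level γ),
        ((τ.symFactor : ℝ)⁻¹) • elemDiff f τ (φ s) (X.vec τ s t) := rfl
    rw [davieRem, e']
    abel
  rw [e]
  refine (norm_add_le _ _).trans ?_
  linarith

end Solution

/-! ### Local norms -/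

section Weights

variable {m n : ℕ} {γ : ℝ}

/-- A constant such that `|y|_η ≤ weightConst B η * M ^ η` whenever `M / 4 ≤ |y| ≤ 2 B M`. -/
def weightConst (B η : ℝ) : ℝ := (2 * B) ^ |η| + 4 ^ |η| + 1

theorem weightConst_pos {B : ℝ} (hB : 0 ≤ B) (η : ℝ) : 0 < weightConst B η := by
  rw [weightConst]
  positivity

theorem weight_le {B M η : ℝ} (hB : 0 ≤ B) (hM : 1 ≤ M) {y : Vec m} (h1 : M / 4 ≤ ‖y‖)
    (h2 : ‖y‖ ≤ 2 * B * M) : weight η y ≤ weightConst B η * M ^ η := by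
  have hM0 : 0 < M := by linarith
  rw [weight, weightConst]
  split_ifs with hη
  · have e1 : ‖y‖ ^ η ≤ (2 * B) ^ η * M ^ η := by
      rw [← Real.mul_rpow (by positivity) hM0.le]
      exact Real.rpow_le_rpow (norm_nonneg _) h2 hη
    have e2 : 1 ≤ M ^ η := Real.one_le_rpow hM hη
    have e3 : 0 ≤ (4 : ℝ) ^ |η| * M ^ η := by positivity
    rw [abs_of_nonneg hη] at e3 ⊢
    linarith
  · have hη := not_le.1 hη
    have e1 : ‖y‖ ^ η ≤ (M / 4) ^ η :=
      Real.rpow_le_rpow_of_nonpos (by positivity) h1 hη.le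
    rw [Real.div_rpow hM0.le (by norm_num), div_eq_mul_inv, ← Real.rpow_neg (by norm_num)] at e1
    have e3 : 0 ≤ (2 * B) ^ |η| * M ^ η := by positivity
    have e4 : 0 ≤ M ^ η := by positivity
    rw [abs_of_neg hη] at e3 ⊢
    linarith

theorem weight_pos (η : ℝ) {y : Vec m} (hy : y ≠ 0) : 0 < weight η y := by
  have := norm_pos_iff.2 hy
  rw [weight]
  split_ifs <;> positivity

theorem weight_nonneg (η : ℝ) (y : Vec m) : 0 ≤ weight η y := by
  rw [weight]
  split_ifs <;> positivity

theorem weightedNorm_nonneg (g : Vec m → Lin n m) (ℓ : ℕ) (η : ℝ) : 0 ≤ weightedNorm g ℓ η :=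
  Real.iSup_nonneg fun y => div_nonneg (norm_nonneg _) (weight_nonneg η y)

theorem norm_iteratedFDeriv_le_weightedNorm_mul {g : Vec m → Lin n m} {ℓ : ℕ} {η : ℝ}
    (h : BddAbove (Set.range (weightedQuotient g ℓ η))) {B M : ℝ} (hB : 0 ≤ B) (hM : 1 ≤ M)
    {y : Vec m} (h1 : M / 4 ≤ ‖y‖) (h2 : ‖y‖ ≤ 2 * B * M) :
    ‖iteratedFDeriv ℝ ℓ g y‖ ≤ weightedNorm g ℓ η * (weightConst B η * M ^ η) := by
  have hy : y ≠ 0 := norm_pos_iff.1 (by linarith)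
  have h3 : weightedQuotient g ℓ η y ≤ weightedNorm g ℓ η := le_ciSup h y
  rw [weightedQuotient, div_le_iff₀ (weight_pos η hy)] at h3
  exact h3.trans (mul_le_mul_of_nonneg_left (weight_le hB hM h1 h2) (weightedNorm_nonneg _ _ _))

theorem BranchedRoughPath.exists_norm_vec_le (X : BranchedRoughPath n γ) {τ : Forest n}
    (hτ : τ.size < level γ) : ∃ K : ℝ, ∀ s ∈ Set.Icc (-1 : ℝ) 0, ∀ t ∈ Set.Icc (-1 : ℝ) 0,
      ‖X.vec τ s t‖ ≤ K * |t - s| ^ (γ * ((τ.size : ℝ) + 1)) := by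
  have h : ∀ i : Fin n, ∃ K : ℝ, ∀ s ∈ Set.Icc (-1 : ℝ) 0, ∀ t ∈ Set.Icc (-1 : ℝ) 0,
      |X.X (τ.graft i) s t| ≤ K * |t - s| ^ (γ * ((τ.size : ℝ) + 1)) := by
    intro i
    have := X.holder (τ.graft i) (by rw [Forest.size_graft]; omega)
    rw [Forest.size_graft] at this
    exact_mod_cast this
  choose K hK using h
  refine ⟨∑ i, K i, fun s hs t ht => ?_⟩
  rw [X.vec_eq, toLp_eq_sum, Finset.sum_mul]
  refine (norm_sum_le _ _).trans (Finset.sum_le_sum fun i _ => ?_)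
  rw [norm_smul, PiLp.norm_single, norm_one, mul_one, Real.norm_eq_abs]
  exact hK i s hs t ht

theorem BranchedRoughPath.seminorm_nonneg (X : BranchedRoughPath n γ) (τ : Forest n) (a b : ℝ) :
    0 ≤ X.seminorm τ a b :=
  Real.iSup_nonneg fun _ => div_nonneg (norm_nonneg _) (Real.rpow_nonneg (abs_nonneg _) _)

theorem BranchedRoughPath.norm_vec_le_seminorm_mul (hγ : 0 < γ) (X : BranchedRoughPath n γ)
    {τ : Forest n} (hτ : τ.size < level γ) {a b : ℝ} (hab : Set.Icc a b ⊆ Set.Icc (-1) 0)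
    {s t : ℝ} (hs : s ∈ Set.Icc a b) (ht : t ∈ Set.Icc a b) :
    ‖X.vec τ s t‖ ≤ X.seminorm τ a b * |t - s| ^ (γ * ((τ.size : ℝ) + 1)) := by
  obtain ⟨K, hK⟩ := X.exists_norm_vec_le hτ
  rcases eq_or_ne s t with rfl | hne
  · have := hK s (hab hs) s (hab hs)
    have hpos : γ * ((τ.size : ℝ) + 1) ≠ 0 := by positivity
    rwa [sub_self, abs_zero, Real.zero_rpow hpos, mul_zero] at this ⊢
  · have hpos : ∀ q : ℝ × ℝ, q.1 ≠ q.2 → 0 < |q.2 - q.1| ^ (γ * ((τ.size : ℝ) + 1)) :=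
      fun q hq => Real.rpow_pos_of_pos (abs_pos.2 (sub_ne_zero.2 hq.symm)) _
    rw [← div_le_iff₀ (hpos (s, t) hne)]
    refine le_ciSup (f := fun q : {q : ℝ × ℝ // q.1 ∈ Set.Icc a b ∧ q.2 ∈ Set.Icc a b ∧
      q.1 ≠ q.2} => ‖X.vec τ q.1.1 q.1.2‖ / |q.1.2 - q.1.1| ^ (γ * ((τ.size : ℝ) + 1)))
      ⟨K, ?_⟩ ⟨(s, t), hs, ht, hne⟩
    rintro _ ⟨⟨q, hq1, hq2, hq⟩, rfl⟩
    exact (div_le_iff₀ (hpos q hq)).2 (hK q.1 (hab hq1) q.2 (hab hq2))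

end Weights

section LocNorm

variable {m n : ℕ} {γ p : ℝ} {η : Forest n → ℕ → ℝ}

theorem finite_isTriple (n : ℕ) (γ : ℝ) : {q : Forest n × ℕ × Forest n | IsTriple γ q}.Finite := by
  refine (((Forest.below n (level γ)).finite_toSet.prod ((Set.finite_Iic (level γ)).prod
    (Forest.below n (level γ)).finite_toSet))).subset ?_
  rintro ⟨τ, ℓ, σ⟩ ⟨h1, -, h2, h3, -⟩
  refine ⟨Forest.mem_below.2 h1, ?_, Forest.mem_below.2 h3⟩
  change ℓ ≤ level γ
  simp only at h2
  omega

theorem locH_nonneg (η : Forest n → ℕ → ℝ) (f : Vec m → Lin n m) (X : BranchedRoughPath n γ)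
    (z r : ℝ) (τ : Forest n) : 0 ≤ locH η f X z r τ :=
  mul_nonneg (weightedNorm_nonneg _ _ _) (X.seminorm_nonneg _ _ _)

theorem locNorm₁_nonneg (p : ℝ) (η : Forest n → ℕ → ℝ) (f : Vec m → Lin n m)
    (X : BranchedRoughPath n γ) (z r : ℝ) : 0 ≤ locNorm₁ p η f X z r :=
  Real.iSup_nonneg fun _ => Real.rpow_nonneg (locH_nonneg _ _ _ _ _ _) _

theorem locNorm₂_nonneg (p : ℝ) (η : Forest n → ℕ → ℝ) (f : Vec m → Lin n m)
    (X : BranchedRoughPath n γ) (z r : ℝ) : 0 ≤ locNorm₂ p η f X z r :=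
  Real.iSup_nonneg fun _ => Real.rpow_nonneg (mul_nonneg (mul_nonneg (weightedNorm_nonneg _ _ _)
    (X.seminorm_nonneg _ _ _)) (Real.rpow_nonneg (locH_nonneg _ _ _ _ _ _) _)) _

theorem alpha_pos (hp : 1 < p) : 0 < alpha p := one_div_pos.2 (by linarith)

theorem le_rpow_of_rpow_div_le {x α d y : ℝ} (hx : 0 ≤ x) (hα : 0 < α) (hd : 0 < d)
    (h : x ^ (α / d) ≤ y) : x ≤ y ^ (d / α) := by
  have h1 := Real.rpow_le_rpow (Real.rpow_nonneg hx _) h (div_pos hd hα).le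
  rwa [← Real.rpow_mul hx, div_mul_div_cancel₀ hd.ne', div_self hα.ne', Real.rpow_one] at h1

theorem locH_le (hp : 1 < p) (hη : PositiveExponents γ p η) (f : Vec m → Lin n m)
    (X : BranchedRoughPath n γ) {z r y : ℝ} (h : locNorm₁ p η f X z r ≤ y) {τ : Forest n}
    (hτ : τ.size < level γ) : locH η f X z r τ ≤ y ^ (Delta γ p η τ 0 / alpha p) := by
  refine le_rpow_of_rpow_div_le (locH_nonneg _ _ _ _ _ _) (alpha_pos hp) (hη.1 τ hτ)
    (le_trans ?_ h)
  have : Finite {τ : Forest n // τ.size < level γ} := (Forest.finite_size_lt n (level γ)).to_subtype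
  exact le_ciSup (f := fun τ : {τ : Forest n // τ.size < level γ} =>
    locH η f X z r τ.1 ^ (alpha p / Delta γ p η τ.1 0)) (Set.finite_range _).bddAbove ⟨τ, hτ⟩

theorem weightedNorm_mul_seminorm_mul_locH_le (hp : 1 < p) (hη : PositiveExponents γ p η)
    (f : Vec m → Lin n m) (X : BranchedRoughPath n γ) {z r y : ℝ}
    (h : locNorm₂ p η f X z r ≤ y) {τ σ : Forest n} {ℓ : ℕ} (hq : IsTriple γ (τ, ℓ, σ)) :
    weightedNorm (elemDiff f τ) ℓ (η τ ℓ) * X.seminorm τ (z - r) z *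
        locH η f X z r σ ^ zeta γ τ ℓ σ ≤
      y ^ ((Delta γ p η τ ℓ + zeta γ τ ℓ σ * Delta γ p η σ 0) / alpha p) := by
  refine le_rpow_of_rpow_div_le (mul_nonneg (mul_nonneg (weightedNorm_nonneg _ _ _)
    (X.seminorm_nonneg _ _ _)) (Real.rpow_nonneg (locH_nonneg _ _ _ _ _ _) _)) (alpha_pos hp)
    (hη.2 τ ℓ σ hq) (le_trans ?_ h)
  have : Finite {q : Forest n × ℕ × Forest n // IsTriple γ q} := (finite_isTriple n γ).to_subtype
  exact le_ciSup (f := fun q : {q : Forest n × ℕ × Forest n // IsTriple γ q} =>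
    (weightedNorm (elemDiff f q.1.1) q.1.2.1 (η q.1.1 q.1.2.1) * X.seminorm q.1.1 (z - r) z *
        locH η f X z r q.1.2.2 ^ zeta γ q.1.1 q.1.2.1 q.1.2.2) ^
      (alpha p / (Delta γ p η q.1.1 q.1.2.1 +
        zeta γ q.1.1 q.1.2.1 q.1.2.2 * Delta γ p η q.1.2.2 0)))
    (Set.finite_range _).bddAbove ⟨(τ, ℓ, σ), hq⟩

end LocNorm

/-! ### The choice of the scale -/

section Scale

open Filter Topology

theorem eventually_mul_rpow_le (a : ℝ) {e c : ℝ} (he : 0 < e) (hc : 0 < c) :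
    ∀ᶠ x in 𝓝[>] (0 : ℝ), a * x ^ e ≤ c := by
  have h : Tendsto (fun x : ℝ => a * x ^ e) (𝓝 0) (𝓝 0) := by
    have : Continuous fun x : ℝ => a * x ^ e :=
      continuous_const.mul (continuous_id.rpow_const fun _ => .inr he.le)
    simpa [Real.zero_rpow he.ne'] using this.tendsto 0
  exact ((h.mono_left nhdsWithin_le_nhds).eventually_lt_const hc).mono fun _ => le_of_lt

/-- The scale `δ` is the smallest one for which `h i ≤ κ δ ^ q i` for all `i`; if all `h i` vanish,
any sufficiently small `δ` will do. -/
theorem exists_scale {ι ι' : Type*} (I : Finset ι) (J : Finset ι') {h q : ι → ℝ} {a e : ι' → ℝ}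
    {κ ε δ₀ : ℝ} (hκ : 0 < κ) (hε : 0 < ε) (hδ₀ : 0 < δ₀) (hq : ∀ i ∈ I, 0 < q i)
    (he : ∀ j ∈ J, 0 < e j) (hh : ∀ i ∈ I, 0 ≤ h i) (hi : ∀ i ∈ I, h i ≤ κ * δ₀ ^ q i)
    (hij : ∀ i ∈ I, ∀ j ∈ J, a j * h i ^ (e j / q i) ≤ κ ^ (e j / q i) * ε) :
    ∃ δ, 0 < δ ∧ δ ≤ δ₀ ∧ (∀ i ∈ I, h i ≤ κ * δ ^ q i) ∧ ∀ j ∈ J, a j * δ ^ e j ≤ ε := by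
  by_cases hz : ∀ i ∈ I, h i = 0
  · have h1 : ∀ᶠ x in 𝓝[>] (0 : ℝ), ∀ j ∈ J, a j * x ^ e j ≤ ε :=
      (eventually_all_finset J).2 fun j hj => eventually_mul_rpow_le _ (he j hj) hε
    have h2 : ∀ᶠ x in 𝓝[>] (0 : ℝ), x ≤ δ₀ :=
      (eventually_le_nhds hδ₀).filter_mono nhdsWithin_le_nhds
    obtain ⟨δ, hδ1, hδ2, hδ⟩ := (h1.and (h2.and eventually_mem_nhdsWithin)).exists
    have hδ : 0 < δ := hδ
    refine ⟨δ, hδ, hδ2, fun i hi => ?_, hδ1⟩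
    rw [hz i hi]
    positivity
  · push Not at hz
    obtain ⟨i₀, hi₀, hne⟩ := hz
    obtain ⟨k, hk, hmax⟩ := I.exists_max_image (fun i => (h i / κ) ^ (q i)⁻¹) ⟨i₀, hi₀⟩
    have hpos : 0 < (h k / κ) ^ (q k)⁻¹ :=
      (Real.rpow_pos_of_pos (div_pos ((hh i₀ hi₀).lt_of_ne' hne) hκ) _).trans_le (hmax i₀ hi₀)
    have hdiv : ∀ i ∈ I, 0 ≤ h i / κ := fun i hi => div_nonneg (hh i hi) hκ.le
    refine ⟨(h k / κ) ^ (q k)⁻¹, hpos, ?_, fun i hi' => ?_, fun j hj => ?_⟩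
    · rw [Real.rpow_inv_le_iff_of_pos (hdiv k hk) hδ₀.le (hq k hk), div_le_iff₀' hκ]
      exact hi k hk
    · have := hmax i hi'
      rwa [Real.rpow_inv_le_iff_of_pos (hdiv i hi') hpos.le (hq i hi'), div_le_iff₀' hκ] at this
    · rw [← Real.rpow_mul (hdiv k hk), inv_mul_eq_div, Real.div_rpow (hh k hk) hκ.le,
        ← mul_div_assoc, div_le_iff₀' (Real.rpow_pos_of_pos hκ _)]
      exact hij k hk j hj

end Scale

/-! ### The a priori bound -/

section APriori

open Filter Topology

variable {m n : ℕ} {γ p : ℝ} {η : Forest n → ℕ → ℝ}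

/-- While `M / 2 ≤ |φ| ≤ B M`, the required bounds at the space scale `M δ` follow from bounds for
the vector fields on the annulus `M / 4 ≤ |y| ≤ 2 B M`. -/
theorem scaleBounds_of_norm_le {f : Vec m → Lin n m} {X : BranchedRoughPath n γ}
    {φ V : ℝ → Vec m} {a b M B δ κ ε : ℝ} {ξ : Forest n → ℝ} {A : Forest n → ℕ → ℝ} (hp : 1 < p)
    (hV : ∀ t ∈ Set.Icc a b, HasDerivAt V (‖φ t‖ ^ (p - 1) • φ t) t) (hM : 0 < M)
    (hB : 1 ≤ B) (hκ : κ ≤ 1) (hε : 0 ≤ ε) (hlow : ∀ t ∈ Set.Icc a b, M / 2 ≤ ‖φ t‖)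
    (hup : ∀ t ∈ Set.Icc a b, ‖φ t‖ ≤ B * M) (hξ : ∀ τ, 0 ≤ ξ τ)
    (hpath : ∀ τ ∈ Forest.below n (level γ), ∀ s ∈ Set.Icc a b, ∀ t ∈ Set.Icc a b,
      ‖X.vec τ s t‖ ≤ ξ τ * |t - s| ^ (γ * ((τ.size : ℝ) + 1)))
    (hA : ∀ τ ∈ Forest.below n (level γ), ∀ ℓ, τ.size + ℓ ≤ level γ → ∀ y, M / 4 ≤ ‖y‖ →
      ‖y‖ ≤ 2 * B * M → ‖iteratedFDeriv ℝ ℓ (elemDiff f τ) y‖ ≤ A τ ℓ)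
    (hδ : 0 < δ) (hδ₀ : (B ^ p + curveConst n (level γ) + 2) * δ ≤ 1 / 4)
    (hfield : ∀ τ ∈ Forest.below n (level γ),
      A τ 0 * (ξ τ * (δ * M ^ (-(p - 1))) ^ (γ * ((τ.size : ℝ) + 1))) ≤ κ * (M * δ))
    (hfieldDeriv : ∀ τ ∈ Forest.below n (level γ), ∀ ℓ, 1 ≤ ℓ → τ.size + ℓ ≤ level γ →
      A τ ℓ * (M * δ) ^ ℓ * (ξ τ * (δ * M ^ (-(p - 1))) ^ (γ * ((τ.size : ℝ) + 1))) ≤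
        ε * (M * δ)) :
    ScaleBounds f X φ V a b (δ * M ^ (-(p - 1))) (M * δ) (B ^ p) κ ε
      (fun τ => ξ τ * (δ * M ^ (-(p - 1))) ^ (γ * ((τ.size : ℝ) + 1))) := by
  have hB0 : 0 < B := by linarith
  have hMp : 0 < M ^ (-(p - 1)) := Real.rpow_pos_of_pos hM _
  have hT : 0 < δ * M ^ (-(p - 1)) := mul_pos hδ hMp
  have hΞ : ∀ τ : Forest n, 0 ≤ ξ τ * (δ * M ^ (-(p - 1))) ^ (γ * ((τ.size : ℝ) + 1)) :=
    fun τ => mul_nonneg (hξ τ) (Real.rpow_nonneg hT.le _)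
  refine ⟨hT, mul_pos hM hδ, by positivity, hκ, hε, hΞ, ?_, ?_, ?_, ?_⟩
  · intro s hs t ht hst _
    have hsub : Set.Icc s t ⊆ Set.Icc a b := Set.Icc_subset_Icc hs.1 ht.2
    have h1 := norm_image_sub_le_of_norm_deriv_le_segment' (f := V) (C := (B * M) ^ p)
      (fun u hu => (hV u (hsub hu)).hasDerivWithinAt)
      (fun u hu => by
        have hu' := hup u (hsub (Set.Ico_subset_Icc_self hu))
        rw [norm_smul, Real.norm_of_nonneg (by positivity)]
        calc ‖φ u‖ ^ (p - 1) * ‖φ u‖ = ‖φ u‖ ^ p := by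
              conv_lhs => rw [← Real.rpow_one ‖φ u‖, ← Real.rpow_mul (norm_nonneg _), one_mul]
              rw [← Real.rpow_add_of_nonneg (norm_nonneg _) (by linarith) zero_le_one,
                sub_add_cancel]
          _ ≤ _ := Real.rpow_le_rpow (norm_nonneg _) hu' (by linarith)) t ⟨hst, le_rfl⟩
    refine h1.trans (le_of_eq ?_)
    have e : M ^ p = M / M ^ (-(p - 1)) := by
      rw [Real.rpow_neg hM.le, div_inv_eq_mul, ← Real.rpow_one_add' hM.le (by linarith)]
      congr 1
      ring
    rw [Real.mul_rpow hB0.le hM.le, e]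
    field_simp
  · intro τ hτ s hs t ht hst
    refine (hpath τ hτ s hs t ht).trans (le_of_eq ?_)
    rw [mul_assoc, ← Real.mul_rpow hT.le (div_nonneg (by linarith) hT.le),
      mul_div_cancel₀ _ hT.ne', abs_of_nonneg (by linarith)]
  · intro τ hτ s hs
    refine (mul_le_mul_of_nonneg_right ?_ (hΞ τ)).trans (hfield τ hτ)
    have := hA τ hτ 0 (Forest.mem_below.1 hτ).le (φ s) (by linarith [hlow s hs])
      (by nlinarith [hup s hs])
    rwa [norm_iteratedFDeriv_zero] at this
  · intro τ hτ ℓ hℓ hℓN s hs y hy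
    have h1 : ‖y - φ s‖ ≤ M / 4 := by
      refine hy.trans ?_
      nlinarith
    have h2 : ‖φ s‖ ≤ ‖y‖ + ‖y - φ s‖ := by
      have := norm_sub_norm_le (φ s) y
      rw [norm_sub_rev] at this
      linarith
    have h3 : ‖y‖ ≤ ‖φ s‖ + ‖y - φ s‖ := by
      have := norm_sub_norm_le y (φ s)
      linarith
    have h4 := hlow s hs
    have h5 := hup s hs
    refine le_trans ?_ (hfieldDeriv τ hτ ℓ hℓ hℓN)
    refine mul_le_mul_of_nonneg_right (mul_le_mul_of_nonneg_right ?_ (by positivity)) (hΞ τ)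
    exact hA τ hτ ℓ hℓN y (by linarith) (by nlinarith)

/-- The scaling behind the exponents `Δ(τ,ℓ)`: at the space scale `M δ` and the time scale
`M ^ (1 - p) δ`, the size `M ^ η(τ,ℓ)` of `D^ℓ f^τ` turns into `M ^ (-Δ(τ,ℓ)/α)`. -/
theorem rpow_mul_scale (hp : 1 < p) (η : Forest n → ℕ → ℝ) (γ : ℝ) {M δ : ℝ} (hM : 0 < M)
    (hδ : 0 < δ) (τ : Forest n) (ℓ : ℕ) :
    M ^ η τ ℓ * (M * δ) ^ ℓ * (δ * M ^ (-(p - 1))) ^ (γ * ((τ.size : ℝ) + 1)) =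
      M ^ (-(Delta γ p η τ ℓ / alpha p)) * δ ^ (((τ.size : ℝ) + 1) * γ + ℓ - 1) * (M * δ) := by
  have hp' : p - 1 ≠ 0 := by linarith
  have e : Delta γ p η τ ℓ / alpha p =
      (p - 1) * (γ * ((τ.size : ℝ) + 1)) + 1 - ℓ - η τ ℓ := by
    rw [Delta, alpha]
    field_simp
    ring
  have e1 : M ^ (-(Delta γ p η τ ℓ / alpha p)) * M =
      M ^ η τ ℓ * M ^ (ℓ : ℝ) * M ^ (-(p - 1) * (γ * ((τ.size : ℝ) + 1))) := by
    rw [e, ← Real.rpow_add_one hM.ne', ← Real.rpow_add hM, ← Real.rpow_add hM]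
    congr 1
    ring
  have e2 : δ ^ (((τ.size : ℝ) + 1) * γ + ℓ - 1) * δ =
      δ ^ (ℓ : ℝ) * δ ^ (γ * ((τ.size : ℝ) + 1)) := by
    rw [← Real.rpow_add_one hδ.ne', ← Real.rpow_add hδ]
    congr 1
    ring
  rw [mul_pow, Real.mul_rpow hδ.le (Real.rpow_nonneg hM.le _), ← Real.rpow_mul hM.le,
    ← Real.rpow_natCast M ℓ, ← Real.rpow_natCast δ ℓ]
  calc _ = (M ^ η τ ℓ * M ^ (ℓ : ℝ) * M ^ (-(p - 1) * (γ * ((τ.size : ℝ) + 1)))) *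
        (δ ^ (ℓ : ℝ) * δ ^ (γ * ((τ.size : ℝ) + 1))) := by ring
    _ = _ := by rw [← e1, ← e2]; ring

theorem zeta_denom_nonneg (hγ : 0 < γ) {σ : Forest n} (hσ : σ.size < level γ) :
    0 ≤ 1 - ((σ.size : ℝ) + 1) * γ := by
  have h1 : ((σ.size : ℝ) + 1) ≤ level γ := by exact_mod_cast hσ
  have h2 := level_mul_le hγ
  nlinarith

theorem zeta_num_pos (hγ : 0 < γ) (τ : Forest n) {ℓ : ℕ} (hℓ : 1 ≤ ℓ) :
    0 < ((τ.size : ℝ) + 1) * γ + (ℓ : ℝ) - 1 := by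
  have h1 : (1 : ℝ) ≤ ℓ := by exact_mod_cast hℓ
  have : 0 < ((τ.size : ℝ) + 1) * γ := by positivity
  linarith

/-- The triples `(τ, ℓ, σ)` are admissible as soon as the denominator of `ζ` is positive. -/
theorem isTriple_of_zeta_denom_pos {τ σ : Forest n} {ℓ : ℕ} (hτ : τ.size < level γ)
    (hℓ : 1 ≤ ℓ) (hτℓ : τ.size + ℓ ≤ level γ) (hσ : σ.size < level γ)
    (hq : 0 < 1 - ((σ.size : ℝ) + 1) * γ) : IsTriple γ (τ, ℓ, σ) := by
  refine ⟨hτ, hℓ, hτℓ, hσ, fun ⟨h1, h2⟩ => ?_⟩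
  have h2 : ((σ.size : ℝ) + 1) = level γ := by exact_mod_cast h2
  have h3 : (level γ : ℝ) ≠ 0 := by
    rw [← h2]
    positivity
  rw [h2] at hq
  have : (level γ : ℝ) * γ = 1 := by
    have := mul_one_div_cancel h3
    rwa [← h1] at this
  linarith

/-- A bound `ω` on the local norms, relative to the size of the solution, which makes the rough
terms a perturbation of the drift. -/
theorem exists_smallness (hp : 1 < p) (hη : PositiveExponents γ p η) {B κ ε δ₀ : ℝ}
    (hκ : 0 < κ) (hε : 0 < ε) (hδ₀ : 0 < δ₀) :
    ∃ ω > 0, (∀ τ : Forest n, τ.size < level γ →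
        weightConst B (η τ 0) * ω ^ (Delta γ p η τ 0 / alpha p) ≤
          κ * δ₀ ^ (1 - ((τ.size : ℝ) + 1) * γ)) ∧
      ∀ (τ : Forest n) (ℓ : ℕ) (σ : Forest n), IsTriple γ (τ, ℓ, σ) →
        weightConst B (η τ ℓ) * weightConst B (η σ 0) ^ zeta γ τ ℓ σ *
          ω ^ ((Delta γ p η τ ℓ + zeta γ τ ℓ σ * Delta γ p η σ 0) / alpha p) ≤
            κ ^ zeta γ τ ℓ σ * ε := by
  have hα := alpha_pos hp
  have h1 : ∀ᶠ ω in 𝓝[>] (0 : ℝ), ∀ τ ∈ Forest.below n (level γ),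
      weightConst B (η τ 0) * ω ^ (Delta γ p η τ 0 / alpha p) ≤
        κ * δ₀ ^ (1 - ((τ.size : ℝ) + 1) * γ) :=
    (eventually_all_finset _).2 fun τ hτ => eventually_mul_rpow_le _
      (div_pos (hη.1 τ (Forest.mem_below.1 hτ)) hα) (by positivity)
  have h2 : ∀ᶠ ω in 𝓝[>] (0 : ℝ), ∀ q ∈ (finite_isTriple n γ).toFinset,
      weightConst B (η q.1 q.2.1) * weightConst B (η q.2.2 0) ^ zeta γ q.1 q.2.1 q.2.2 *
        ω ^ ((Delta γ p η q.1 q.2.1 + zeta γ q.1 q.2.1 q.2.2 * Delta γ p η q.2.2 0) / alpha p) ≤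
          κ ^ zeta γ q.1 q.2.1 q.2.2 * ε :=
    (eventually_all_finset _).2 fun q hq => eventually_mul_rpow_le _
      (div_pos (hη.2 _ _ _ ((finite_isTriple n γ).mem_toFinset.1 hq)) hα) (by positivity)
  obtain ⟨ω, h1, h2, hω⟩ := (h1.and (h2.and eventually_mem_nhdsWithin)).exists
  exact ⟨ω, hω, fun τ hτ => h1 τ (Forest.mem_below.2 hτ), fun τ ℓ σ hq =>
    h2 (τ, ℓ, σ) ((finite_isTriple n γ).mem_toFinset.2 hq)⟩

theorem mul_rpow_mul_rpow_neg {x y d : ℝ} (hx : 0 ≤ x) (hy : 0 < y) :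
    (x * y) ^ d * y ^ (-d) = x ^ d := by
  rw [Real.mul_rpow hx hy.le, mul_assoc, ← Real.rpow_add hy, add_neg_cancel, Real.rpow_zero,
    mul_one]

/-- If the local norms are small compared with `M`, there is a scale at which the rough terms are a
small perturbation. -/
theorem exists_scale_of_locNorm_le (hγ : 0 < γ) (hp : 1 < p) (hη : PositiveExponents γ p η)
    {B κ ε δ₀ ω : ℝ} (hB : 0 ≤ B) (hκ : 0 < κ) (hε : 0 < ε) (hδ₀ : 0 < δ₀) (hω : 0 < ω)
    (hω₁ : ∀ τ : Forest n, τ.size < level γ →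
      weightConst B (η τ 0) * ω ^ (Delta γ p η τ 0 / alpha p) ≤
        κ * δ₀ ^ (1 - ((τ.size : ℝ) + 1) * γ))
    (hω₂ : ∀ (τ : Forest n) (ℓ : ℕ) (σ : Forest n), IsTriple γ (τ, ℓ, σ) →
      weightConst B (η τ ℓ) * weightConst B (η σ 0) ^ zeta γ τ ℓ σ *
        ω ^ ((Delta γ p η τ ℓ + zeta γ τ ℓ σ * Delta γ p η σ 0) / alpha p) ≤
          κ ^ zeta γ τ ℓ σ * ε)
    (f : Vec m → Lin n m) (X : BranchedRoughPath n γ) {z r M : ℝ} (hM : 0 < M)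
    (h₁ : locNorm₁ p η f X z r ≤ ω * M) (h₂ : locNorm₂ p η f X z r ≤ ω * M) :
    ∃ δ, 0 < δ ∧ δ ≤ δ₀ ∧
      (∀ τ ∈ Forest.below n (level γ), weightConst B (η τ 0) *
        (weightedNorm (elemDiff f τ) 0 (η τ 0) * X.seminorm τ (z - r) z) *
          M ^ (-(Delta γ p η τ 0 / alpha p)) ≤ κ * δ ^ (1 - ((τ.size : ℝ) + 1) * γ)) ∧
      ∀ τ ∈ Forest.below n (level γ), ∀ ℓ, 1 ≤ ℓ → τ.size + ℓ ≤ level γ →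
        weightConst B (η τ ℓ) *
        (weightedNorm (elemDiff f τ) ℓ (η τ ℓ) * X.seminorm τ (z - r) z) *
          M ^ (-(Delta γ p η τ ℓ / alpha p)) * δ ^ (((τ.size : ℝ) + 1) * γ + ℓ - 1) ≤ ε := by
  have hc : ∀ τ ℓ, 0 < weightConst B (η τ ℓ) := fun τ ℓ => weightConst_pos hB _
  have hbound : ∀ τ : Forest n, τ.size < level γ → weightConst B (η τ 0) * locH η f X z r τ *
      M ^ (-(Delta γ p η τ 0 / alpha p)) ≤ κ * δ₀ ^ (1 - ((τ.size : ℝ) + 1) * γ) := by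
    intro τ hτ
    refine le_trans ?_ (hω₁ τ hτ)
    rw [← mul_rpow_mul_rpow_neg hω.le hM, ← mul_assoc]
    exact mul_le_mul_of_nonneg_right (mul_le_mul_of_nonneg_left (locH_le hp hη f X h₁ hτ)
      (hc _ _).le) (by positivity)
  obtain ⟨δ, hδ, hδle, hI, hJ⟩ := exists_scale
    (I := (Forest.below n (level γ)).filter fun σ => 0 < 1 - ((σ.size : ℝ) + 1) * γ)
    (J := (Forest.below n (level γ) ×ˢ Finset.range (level γ + 1)).filter fun q =>
      1 ≤ q.2 ∧ q.1.size + q.2 ≤ level γ)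
    (h := fun σ => weightConst B (η σ 0) * locH η f X z r σ * M ^ (-(Delta γ p η σ 0 / alpha p)))
    (q := fun σ => 1 - ((σ.size : ℝ) + 1) * γ)
    (a := fun q => weightConst B (η q.1 q.2) *
        (weightedNorm (elemDiff f q.1) q.2 (η q.1 q.2) * X.seminorm q.1 (z - r) z) *
          M ^ (-(Delta γ p η q.1 q.2 / alpha p)))
    (e := fun q => ((q.1.size : ℝ) + 1) * γ + q.2 - 1) hκ hε hδ₀
    (fun σ hσ => (Finset.mem_filter.1 hσ).2)
    (fun q hq => zeta_num_pos hγ q.1 (Finset.mem_filter.1 hq).2.1)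
    (fun σ _ => mul_nonneg (mul_nonneg (hc _ _).le (locH_nonneg _ _ _ _ _ _)) (by positivity))
    (fun σ hσ => hbound σ (Forest.mem_below.1 (Finset.mem_filter.1 hσ).1))
    (fun σ hσ q hq => by
      obtain ⟨τ, ℓ⟩ := q
      obtain ⟨hσ1, hσ2⟩ := Finset.mem_filter.1 hσ
      obtain ⟨hq1, hq2, hq3⟩ := Finset.mem_filter.1 hq
      have hτ := Forest.mem_below.1 (Finset.mem_product.1 hq1).1
      have ht : IsTriple γ (τ, ℓ, σ) :=
        isTriple_of_zeta_denom_pos hτ hq2 hq3 (Forest.mem_below.1 hσ1) hσ2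
      refine le_trans ?_ (hω₂ τ ℓ σ ht)
      have h3 := weightedNorm_mul_seminorm_mul_locH_le hp hη f X h₂ ht
      change _ * _ ^ zeta γ τ ℓ σ ≤ _
      set ζ := zeta γ τ ℓ σ
      have hMM : M ^ (-(Delta γ p η τ ℓ / alpha p)) * (M ^ (-(Delta γ p η σ 0 / alpha p))) ^ ζ =
          M ^ (-((Delta γ p η τ ℓ + ζ * Delta γ p η σ 0) / alpha p)) := by
        rw [← Real.rpow_mul hM.le, ← Real.rpow_add hM]
        congr 1
        ring
      rw [← mul_rpow_mul_rpow_neg hω.le hM, ← hMM,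
        Real.mul_rpow (mul_nonneg (hc _ _).le (locH_nonneg _ _ _ _ _ _)) (by positivity),
        Real.mul_rpow (hc _ _).le (locH_nonneg _ _ _ _ _ _)]
      have hc1 := (hc τ ℓ).le
      have hc2 := (hc σ 0).le
      calc _ = (weightConst B (η τ ℓ) * weightConst B (η σ 0) ^ ζ *
            (M ^ (-(Delta γ p η τ ℓ / alpha p)) * (M ^ (-(Delta γ p η σ 0 / alpha p))) ^ ζ)) *
            (weightedNorm (elemDiff f τ) ℓ (η τ ℓ) * X.seminorm τ (z - r) z *
              locH η f X z r σ ^ ζ) := by ring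
        _ ≤ (weightConst B (η τ ℓ) * weightConst B (η σ 0) ^ ζ *
            (M ^ (-(Delta γ p η τ ℓ / alpha p)) * (M ^ (-(Delta γ p η σ 0 / alpha p))) ^ ζ)) *
            (ω * M) ^ ((Delta γ p η τ ℓ + ζ * Delta γ p η σ 0) / alpha p) :=
          mul_le_mul_of_nonneg_left h3 (by positivity)
        _ = _ := by ring)
  refine ⟨δ, hδ, hδle, fun τ hτ => ?_, fun τ hτ ℓ hℓ hℓN => ?_⟩
  · rcases (zeta_denom_nonneg hγ (Forest.mem_below.1 hτ)).eq_or_lt with h0 | h0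
    · have := hbound τ (Forest.mem_below.1 hτ)
      rw [← h0, Real.rpow_zero] at this ⊢
      exact this
    · exact hI τ (Finset.mem_filter.2 ⟨hτ, h0⟩)
  · exact hJ (τ, ℓ) (Finset.mem_filter.2 ⟨Finset.mem_product.2 ⟨hτ, Finset.mem_range.2 (by omega)⟩,
      hℓ, hℓN⟩)

/-- As long as the local norms are small compared with the final value `M` of the solution, the
solution comes down from infinity like the solutions of `dφ = -φ^p dt`. -/
theorem sub_mul_rpow_le_of_locNorm_le (hγ : 0 < γ) (hp : 1 < p) (hη : PositiveExponents γ p η)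
    {B κ ε δ₀ ω L : ℝ} (hB : 1 ≤ B) (hκ : 0 < κ) (hκ1 : κ ≤ 1) (hε : 0 < ε) (hδ₀ : 0 < δ₀)
    (hω : 0 < ω) (hδ₁ : δ₀ ≤ 1) (hδB : (B ^ p + curveConst n (level γ) + 2) * δ₀ ≤ 1 / 4)
    (hL : 0 ≤ L)
    (hsew : sewConst n γ (B ^ p) * ε ≤ 1)
    (hsmall : (L + 1) * (sewConst n γ (B ^ p) * ε + (Forest.below n (level γ)).card * κ) ≤ 1 / 8)
    (hω₁ : ∀ τ : Forest n, τ.size < level γ →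
      weightConst B (η τ 0) * ω ^ (Delta γ p η τ 0 / alpha p) ≤
        κ * δ₀ ^ (1 - ((τ.size : ℝ) + 1) * γ))
    (hω₂ : ∀ (τ : Forest n) (ℓ : ℕ) (σ : Forest n), IsTriple γ (τ, ℓ, σ) →
      weightConst B (η τ ℓ) * weightConst B (η σ 0) ^ zeta γ τ ℓ σ *
        ω ^ ((Delta γ p η τ ℓ + zeta γ τ ℓ σ * Delta γ p η σ 0) / alpha p) ≤
          κ ^ zeta γ τ ℓ σ * ε)
    {f : Vec m → Lin n m} (hf : ContDiff ℝ (level γ) f) (hfη : WeightedBounds γ η f)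
    {X : BranchedRoughPath n γ} {φ : ℝ → Vec m} (hφ : IsSolution p f X φ) {z r a b : ℝ}
    (hzr : Set.Icc (z - r) z ⊆ Set.Icc (-1) 0) (ha : z - r ≤ a) (hab : a ≤ b) (hb : b ≤ z)
    (hM : 1 ≤ ‖φ b‖) (hup : ∀ t ∈ Set.Icc a b, ‖φ t‖ ≤ B * ‖φ b‖)
    (h₁ : locNorm₁ p η f X z r ≤ ω * ‖φ b‖) (h₂ : locNorm₂ p η f X z r ≤ ω * ‖φ b‖)
    (hlen : (b - a) * ‖φ b‖ ^ (p - 1) ≤ L) :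
    (b - a) * ‖φ b‖ ^ (p - 1) ≤ 2 ^ (p + 1) * (B + 1) ^ 2 := by
  have hsub : Set.Icc a b ⊆ Set.Icc (z - r) z := Set.Icc_subset_Icc ha hb
  have hsub' := hsub.trans hzr
  have hcont := hφ.continuousOn hγ
  obtain ⟨V, hV⟩ := exists_hasDerivAt_of_continuousOn (by norm_num : (-1 : ℝ) ≤ 0)
    ((hcont.norm.rpow_const fun _ _ => .inr (by linarith : 0 ≤ p - 1)).smul hcont)
  have hM0 : 0 < ‖φ b‖ := by linarith
  refine sub_mul_rpow_le_of_norm_sub_add_le hp hab (hcont.mono hsub')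
    (fun t ht => hV t (hsub' ht)) hM0 (hup a (Set.left_mem_Icc.2 hab)) fun s hs hlow => ?_
  set M := ‖φ b‖ with hMdef
  obtain ⟨δ, hδ, hδle, hI, hJ⟩ := exists_scale_of_locNorm_le hγ hp hη (by linarith) hκ hε hδ₀ hω
    hω₁ hω₂ f X hM0 h₁ h₂
  have hsb : Set.Icc s b ⊆ Set.Icc a b := Set.Icc_subset_Icc_left hs.1
  have hcurve : 0 ≤ curveConst n (level γ) :=
    le_trans (Nat.cast_nonneg _) (card_below_le_curveConst n _)
  have hB0 : 0 < B := by linarith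
  have hscale := scaleBounds_of_norm_le (X := X) (f := f) (φ := φ) (V := V) (a := s) (b := b)
    (κ := κ) (ε := ε) (ξ := fun τ => X.seminorm τ (z - r) z)
    (A := fun τ ℓ => weightedNorm (elemDiff f τ) ℓ (η τ ℓ) *
      (weightConst B (η τ ℓ) * M ^ η τ ℓ)) hp
    (fun t ht => hV t (hsub' (hsb ht))) hM0 hB hκ1 hε.le hlow (fun t ht => hup t (hsb ht))
    (fun τ => X.seminorm_nonneg τ _ _)
    (fun τ hτ s hs t ht => X.norm_vec_le_seminorm_mul hγ (Forest.mem_below.1 hτ) hzr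
      (hsub (hsb hs)) (hsub (hsb ht)))
    (fun τ hτ ℓ hℓ y hy1 hy2 => norm_iteratedFDeriv_le_weightedNorm_mul
      (hfη τ ℓ (Forest.mem_below.1 hτ) hℓ) hB0.le hM hy1 hy2)
    hδ (le_trans (mul_le_mul_of_nonneg_left hδle (by positivity)) hδB)
    (fun τ hτ => by
      have h3 := rpow_mul_scale hp η γ hM0 hδ τ 0
      rw [pow_zero, mul_one] at h3
      have h4 := hI τ hτ
      have e : κ * (M * δ) = κ * δ ^ (1 - ((τ.size : ℝ) + 1) * γ) *
          (δ ^ (((τ.size : ℝ) + 1) * γ + (0 : ℕ) - 1) * (M * δ)) := by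
        rw [mul_assoc κ, ← mul_assoc (δ ^ _), ← Real.rpow_add hδ]
        rw [show 1 - ((τ.size : ℝ) + 1) * γ + (((τ.size : ℝ) + 1) * γ + (0 : ℕ) - 1) = 0 by
          push_cast; ring, Real.rpow_zero, one_mul]
      rw [e]
      refine le_trans (le_of_eq ?_) (mul_le_mul_of_nonneg_right h4 (by positivity))
      linear_combination weightedNorm (elemDiff f τ) 0 (η τ 0) * weightConst B (η τ 0) *
        X.seminorm τ (z - r) z * h3)
    (fun τ hτ ℓ hℓ hℓN => by
      have h3 := rpow_mul_scale hp η γ hM0 hδ τ ℓ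
      refine le_trans (le_of_eq ?_) (mul_le_mul_of_nonneg_right (hJ τ hτ ℓ hℓ hℓN)
        (by positivity : 0 ≤ M * δ))
      linear_combination weightedNorm (elemDiff f τ) ℓ (η τ ℓ) * weightConst B (η τ ℓ) *
        X.seminorm τ (z - r) z * h3)
  obtain ho := hφ.norm_davieRem_le hγ hp hV
  have hsb' := hsb.trans hsub'
  have h3 := hscale.norm_sub_add_le_mul hγ hf hsb' hκ.le hsew
    (fun ω hω => by
      obtain ⟨δ, hδ, h⟩ := ho ω hω
      exact ⟨δ, hδ, fun s hs t ht => h s (hsb' hs) t (hsb' ht)⟩)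
    (Set.left_mem_Icc.2 hs.2) (Set.right_mem_Icc.2 hs.2) hs.2
  refine h3.trans ?_
  set E := sewConst n γ (B ^ p) * ε + (Forest.below n (level γ)).card * κ with hE
  have hE0 : 0 ≤ E := by
    have := sewConst_nonneg n hγ (β := B ^ p) (by positivity)
    positivity
  have h4 : (b - s) / (δ * M ^ (-(p - 1))) ≤ L / δ := by
    rw [Real.rpow_neg hM0.le, ← div_div, div_inv_eq_mul, div_mul_eq_mul_div]
    refine div_le_div_of_nonneg_right (le_trans ?_ hlen) hδ.le
    exact mul_le_mul_of_nonneg_right (by linarith [hs.1]) (by positivity)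
  -- there are about `L / δ` subintervals, each contributing `E M δ`
  calc ((b - s) / (δ * M ^ (-(p - 1))) + 1) * (E * (M * δ))
      ≤ (L / δ + 1) * (E * (M * δ)) :=
        mul_le_mul_of_nonneg_right (by linarith) (by positivity)
    _ = (L + δ) * E * M := by field_simp
    _ ≤ (L + 1) * E * M := by
        have : δ ≤ 1 := hδle.trans hδ₁
        gcongr
    _ ≤ 1 / 8 * M := mul_le_mul_of_nonneg_right hsmall hM0.le
    _ = M / 8 := by ring

/-- Before a suitable time, chosen as a maximum point of `|φ_t|^(p-1) (t - a)`, the solution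
is not much larger than at this time. -/
theorem exists_time_norm_le_mul (hp : 1 < p) {φ : ℝ → Vec m} {a z L : ℝ} (hL : 0 < L)
    (hφ : ContinuousOn φ (Set.Icc a z)) (hz : 0 < ‖φ z‖)
    (ha : z - a = L * ‖φ z‖ ^ (-(p - 1))) :
    ∃ b ∈ Set.Icc a z, ‖φ z‖ ≤ ‖φ b‖ ∧ a ≤ b - L / 2 * ‖φ b‖ ^ (-(p - 1)) ∧
      ∀ t ∈ Set.Icc (b - L / 2 * ‖φ b‖ ^ (-(p - 1))) b, ‖φ t‖ ≤ 2 ^ alpha p * ‖φ b‖ := by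
  have hp0 : 0 < p - 1 := by linarith
  have haz : a < z := by
    have : 0 < L * ‖φ z‖ ^ (-(p - 1)) := by positivity
    linarith
  have hcancel : ∀ x : ℝ, 0 < x → x ^ (-(p - 1)) * x ^ (p - 1) = 1 := fun x hx => by
    rw [← Real.rpow_add hx, neg_add_cancel, Real.rpow_zero]
  obtain ⟨b, hb, hmax⟩ := isCompact_Icc.exists_isMaxOn (Set.nonempty_Icc.2 haz.le)
    ((hφ.norm.rpow_const fun _ _ => .inr hp0.le).mul (continuousOn_id.sub continuousOn_const) :
      ContinuousOn (fun t => ‖φ t‖ ^ (p - 1) * (t - a)) (Set.Icc a z))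
  have hmax : ∀ t ∈ Set.Icc a z, ‖φ t‖ ^ (p - 1) * (t - a) ≤ ‖φ b‖ ^ (p - 1) * (b - a) := hmax
  have h1 : L ≤ ‖φ b‖ ^ (p - 1) * (b - a) := by
    refine le_trans (le_of_eq ?_) (hmax z (Set.right_mem_Icc.2 haz.le))
    rw [ha]
    linear_combination -L * hcancel _ hz
  have hba : 0 ≤ b - a := by linarith [hb.1]
  have h2 : ‖φ z‖ ^ (p - 1) ≤ ‖φ b‖ ^ (p - 1) := by
    have e := hcancel _ hz
    have h3 : ‖φ b‖ ^ (p - 1) * (b - a) ≤ ‖φ b‖ ^ (p - 1) * (z - a) :=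
      mul_le_mul_of_nonneg_left (by linarith [hb.2]) (by positivity)
    have h4 : 0 < z - a := by linarith
    refine le_of_mul_le_mul_right ?_ h4
    refine le_trans (le_of_eq ?_) (h1.trans h3)
    rw [ha]
    linear_combination L * e
  have hzb : ‖φ z‖ ≤ ‖φ b‖ := (Real.rpow_le_rpow_iff hz.le (norm_nonneg _) hp0).1 h2
  have hb0 : 0 < ‖φ b‖ := hz.trans_le hzb
  have h3 : L * ‖φ b‖ ^ (-(p - 1)) ≤ b - a := by
    have : 0 < ‖φ b‖ ^ (p - 1) := by positivity
    refine le_of_mul_le_mul_left ?_ this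
    refine le_trans (le_of_eq ?_) h1
    linear_combination L * hcancel _ hb0
  have h4 : 0 < L * ‖φ b‖ ^ (-(p - 1)) := by positivity
  refine ⟨b, hb, hzb, by linarith, fun t ht => ?_⟩
  have hta : (b - a) / 2 ≤ t - a := by linarith [ht.1]
  have h5 := hmax t ⟨by linarith [ht.1], ht.2.trans hb.2⟩
  have h6 : ‖φ t‖ ^ (p - 1) ≤ 2 * ‖φ b‖ ^ (p - 1) := by
    have h7 : ‖φ t‖ ^ (p - 1) * ((b - a) / 2) ≤ ‖φ t‖ ^ (p - 1) * (t - a) :=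
      mul_le_mul_of_nonneg_left hta (by positivity)
    refine le_of_mul_le_mul_right ?_ (by linarith : 0 < (b - a) / 2)
    linarith
  refine (Real.rpow_le_rpow_iff (norm_nonneg _) (by positivity) hp0).1 (h6.trans (le_of_eq ?_))
  rw [Real.mul_rpow (by positivity) hb0.le, ← Real.rpow_mul (by norm_num), alpha,
    one_div_mul_cancel hp0.ne', Real.rpow_one]

end APriori

end RDE

end

theorem mainTheorem3 (m n : ℕ) (γ p : ℝ) (hγ : 0 < γ) (hγ1 : γ ≤ 1) (hp : 1 < p)
    (η : RDE.Forest n → ℕ → ℝ) (hη : RDE.PositiveExponents γ p η) :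
    ∃ C : ℝ, 0 < C ∧
      ∀ f : RDE.Vec m → RDE.Lin n m, ContDiff ℝ (RDE.level γ) f → RDE.WeightedBounds γ η f →
      ∀ (X : RDE.BranchedRoughPath n γ) (φ : ℝ → RDE.Vec m), RDE.IsSolution p f X φ →
      ∀ z ∈ Set.Ioc (-1 : ℝ) 0,
        ‖φ z‖ ≤ C * (RDE.locNorm₁ p η f X z (RDE.localScale p C z (φ z)) +
          RDE.locNorm₂ p η f X z (RDE.localScale p C z (φ z)) +
          |z + 1| ^ (-RDE.alpha p)) := by
  have hp0 : 0 < p - 1 := by linarith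
  have hα := RDE.alpha_pos hp
  obtain ⟨B, hB⟩ : ∃ B : ℝ, B = 2 ^ RDE.alpha p := ⟨_, rfl⟩
  have hB1 : 1 ≤ B := hB ▸ Real.one_le_rpow one_le_two hα.le
  have hB0 : 0 < B := by linarith
  -- in units of `M^{-1/α}`, the time `L` exceeds the bound of `sub_mul_rpow_le_of_locNorm_le`
  obtain ⟨L, hL⟩ : ∃ L : ℝ, L = 2 ^ (p + 1) * (B + 1) ^ 2 + 1 := ⟨_, rfl⟩
  have hL0 : 0 < L := by rw [hL]; positivity
  set w : ℝ := ((RDE.Forest.below n (RDE.level γ)).card : ℝ)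
  have hw : 0 ≤ w := Nat.cast_nonneg _
  set S := RDE.sewConst n γ (B ^ p)
  have hS : 0 ≤ S := RDE.sewConst_nonneg n hγ (by positivity)
  set K := B ^ p + RDE.curveConst n (RDE.level γ) + 2 with hK
  have hK2 : 2 ≤ K := by
    have h1 : 0 ≤ RDE.curveConst n (RDE.level γ) :=
      le_trans (Nat.cast_nonneg _) (RDE.card_below_le_curveConst n _)
    have h2 : 0 ≤ B ^ p := by positivity
    linarith
  -- the perturbation over a time `L` must not exceed `1/8` of the size of the solution
  obtain ⟨κ, hκ⟩ : ∃ κ : ℝ, κ = 1 / (16 * (L + 1) * (w + 1)) := ⟨_, rfl⟩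
  obtain ⟨ε, hε⟩ : ∃ ε : ℝ, ε = 1 / (16 * (L + 1) * (S + 1)) := ⟨_, rfl⟩
  have hκ0 : 0 < κ := by rw [hκ]; positivity
  have hε0 : 0 < ε := by rw [hε]; positivity
  have hκ1 : (L + 1) * (w * κ) ≤ 1 / 16 := by
    have : (L + 1) * ((w + 1) * κ) = 1 / 16 := by rw [hκ]; field_simp
    nlinarith
  have hε1 : (L + 1) * (S * ε) ≤ 1 / 16 := by
    have : (L + 1) * ((S + 1) * ε) = 1 / 16 := by rw [hε]; field_simp
    nlinarith
  have hκle : κ ≤ 1 := by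
    rw [hκ]
    exact div_le_one_of_le₀ (by nlinarith [mul_nonneg hL0.le hw]) (by positivity)
  have hSε : S * ε ≤ 1 := by nlinarith [mul_nonneg hS hε0.le]
  obtain ⟨ω, hω, hω₁, hω₂⟩ := RDE.exists_smallness (B := B) hp hη hκ0 hε0
    (show 0 < 1 / (4 * K) by positivity)
  obtain ⟨C, hC1, hCL, hCω, hCp⟩ :
      ∃ C : ℝ, 1 ≤ C ∧ 2 * L ≤ C ∧ 1 / ω ≤ C ∧ 4 * L ≤ C ^ (p - 1) := by
    have hev : ∀ᶠ C in Filter.atTop, (4 * L : ℝ) ≤ C ^ (p - 1) :=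
      (tendsto_rpow_atTop hp0).eventually_ge_atTop _
    exact ((Filter.eventually_ge_atTop 1).and ((Filter.eventually_ge_atTop (2 * L)).and
      ((Filter.eventually_ge_atTop (1 / ω)).and hev))).exists
  have hC0 : 0 < C := by linarith
  refine ⟨C, hC0, fun f hf hfη X φ hφ z hz => ?_⟩
  by_contra! hcon
  set r := RDE.localScale p C z (φ z) with hr
  have hl₁ := RDE.locNorm₁_nonneg p η f X z r
  have hl₂ := RDE.locNorm₂_nonneg p η f X z r
  have hCl₁ := mul_nonneg hC0.le hl₁
  have hCl₂ := mul_nonneg hC0.le hl₂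
  have hz1 : 0 < z + 1 := by linarith [hz.1]
  rw [abs_of_pos hz1] at hcon
  have hzα : 0 < (z + 1) ^ (-RDE.alpha p) := by positivity
  have hCz := mul_nonneg hC0.le hzα.le
  have hy0 : 0 < ‖φ z‖ := lt_of_le_of_lt (by positivity) hcon
  have hyα : C * (z + 1) ^ (-RDE.alpha p) ≤ ‖φ z‖ := by linarith
  have hy1 : 1 ≤ ‖φ z‖ := by
    have : 1 ≤ (z + 1) ^ (-RDE.alpha p) :=
      Real.one_le_rpow_of_pos_of_le_one_of_nonpos hz1 (by linarith [hz.2]) (by linarith)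
    exact (one_le_mul_of_one_le_of_one_le hC1 this).trans hyα
  have hαp : RDE.alpha p * (p - 1) = 1 := by rw [RDE.alpha, one_div_mul_cancel hp0.ne']
  -- the time scale of the solution at `z` is much shorter than `z + 1`
  have hlen : 2 * L * ‖φ z‖ ^ (-(p - 1)) ≤ (z + 1) / 2 := by
    have h1 := Real.rpow_le_rpow (by positivity) hyα hp0.le
    rw [Real.mul_rpow hC0.le hzα.le, ← Real.rpow_mul hz1.le, neg_mul, hαp,
      Real.rpow_neg_one] at h1
    rw [Real.rpow_neg hy0.le, ← div_eq_mul_inv, div_le_iff₀ (by positivity)]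
    have h2 : 4 * L * (z + 1)⁻¹ ≤ ‖φ z‖ ^ (p - 1) :=
      (mul_le_mul_of_nonneg_right hCp (by positivity)).trans h1
    rw [← div_eq_mul_inv, div_le_iff₀ hz1] at h2
    linarith
  have hrlen : 2 * L * ‖φ z‖ ^ (-(p - 1)) ≤ r := by
    rw [hr, RDE.localScale, if_neg (norm_pos_iff.1 hy0), abs_of_pos hz1]
    refine le_min ?_ hlen
    rw [RDE.alpha, one_div_one_div]
    exact mul_le_mul_of_nonneg_right hCL (by positivity)
  have hr2 : r ≤ (z + 1) / 2 := by
    rw [hr, RDE.localScale, if_neg (norm_pos_iff.1 hy0), abs_of_pos hz1]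
    exact min_le_right _ _
  have hzr : Set.Icc (z - r) z ⊆ Set.Icc (-1) 0 := Set.Icc_subset_Icc (by linarith) hz.2
  obtain ⟨a, ha⟩ : ∃ a, a = z - 2 * L * ‖φ z‖ ^ (-(p - 1)) := ⟨_, rfl⟩
  have haz : Set.Icc a z ⊆ Set.Icc (z - r) z := Set.Icc_subset_Icc_left (by linarith)
  obtain ⟨b, hb, hzb, hab, hup⟩ := RDE.exists_time_norm_le_mul hp (by positivity : 0 < 2 * L)
    ((hφ.continuousOn hγ).mono (haz.trans hzr)) hy0 (by linarith)
  rw [mul_div_cancel_left₀ L (two_ne_zero' ℝ)] at hab hup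
  rw [← hB] at hup
  have hb0 : 0 < ‖φ b‖ := by linarith
  have hωb : ∀ l, C * l ≤ ‖φ z‖ → l ≤ ω * ‖φ b‖ := by
    intro l hl
    have h1 : 1 ≤ C * ω := (div_le_iff₀ hω).1 hCω
    refine le_of_mul_le_mul_left ?_ hC0
    calc C * l ≤ 1 * ‖φ b‖ := by linarith
      _ ≤ C * ω * ‖φ b‖ := mul_le_mul_of_nonneg_right h1 hb0.le
      _ = _ := mul_assoc _ _ _
  have hbL : (b - (b - L * ‖φ b‖ ^ (-(p - 1)))) * ‖φ b‖ ^ (p - 1) = L := by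
    rw [sub_sub_cancel, mul_assoc, ← Real.rpow_add hb0, neg_add_cancel, Real.rpow_zero, mul_one]
  have hpos : 0 ≤ L * ‖φ b‖ ^ (-(p - 1)) := by positivity
  have := RDE.sub_mul_rpow_le_of_locNorm_le hγ hp hη hB1 hκ0 hκle hε0
    (show 0 < 1 / (4 * K) by positivity) hω
    (div_le_one_of_le₀ (by linarith) (by positivity)) (le_of_eq (by rw [← hK]; field_simp))
    hL0.le hSε (by linarith) hω₁ hω₂ hf hfη hφ hzr (by linarith) (by linarith) hb.2 (by linarith)
    hup (hωb _ (by linarith)) (hωb _ (by linarith)) hbL.le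
  rw [hbL] at this
  linarith
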